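/- **Setting.** Consider $\min_{x\in\mathbb R^n} f(x)$ s.t. $c(x)=0$, $c:\mathbb R^n\to\mathbb R^m$, $J=\nabla c^T$, where either (finite sum) $f(x)=\frac1{|\mathcal S|}\sum_{\xi\in\mathcal S}F(x,\xi)$ with $\mathcal S$ finite and nonempty, or (expectation) $f(x)=\mathbb E_{\xi\sim\mathcal P}[F(x,\xi)]$. For a sample set $S$ let $F_S=\frac1{|S|}\sum_{\xi\in S}F(\cdot,\xi)$, $g_S=\nabla F_S$, $T_S(x,\lambda)=(g_S(x)+J(x)^T\lambda,\;c(x))$, and $T(x,\lambda)=(\nabla f(x)+J(x)^T\lambda,\;c(x))$. $\|\cdot\|$ is the Euclidean (for matrices: Frobenius) norm. **Algorithm (equality constrained RA-SQP).** Inputs: $x_{0,0}$, $\lambda_{-1,0}$, $\gamma_k\in[0,1)$, $\epsilon_k\ge0$, $\bar\tau,\kappa'>0$, $\epsilon_\sigma,\epsilon_\tau,\epsilon_d,\epsilon_\alpha,\eta\in(0,1)$, $\epsilon_{feas},\epsilon_{opt},\kappa_T\in(0,\frac12)$. In outer iteration $k$ a nonempty sample set $S_k$ is chosen, $x_{k,0}=x_{k-1,N_{k-1}}$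 ($N_{-1}=0$), and $\lambda_{k,0}$ is $\lambda_{k-1,N_{k-1}}$ (carry-over), or $-(JJ^T)^{-1}Jg_{S_k}(x_{k,0})$ with $J=J(x_{k,0})$ (reinitialize), or any $\lambda$ with $\|T_{S_k}(x_{k,0},\lambda)\|\le\|T_{S_k}(x_{k,0},\lambda_{k-1,N_{k-1}})\|$. For $j=0,1,\dots$: stop with $N_k=j$ if $\|T_{S_k}(x_{k,j},\lambda_{k,j})\|\le\gamma_k\|T_{S_k}(x_{k,0},\lambda_{k,0})\|+\epsilon_k$. Otherwise, with $g,J,c,T$ denoting $g_{S_k},J,c$ at $x_{k,j}$ and $T_{S_k}(x_{k,j},\lambda_{k,j})$, take a symmetric $H=H_{k,j}$ and $(d,\delta)$, $(\rho,r)$ with $$\begin{bmatrix}H&J^T\\J&0\end{bmatrix}\begin{bmatrix}d\\\delta\end{bmatrix}=-T+\begin{bmatrix}\rho\\r\end{bmatrix}.$$ Put $\Delta l(\tau)=-\tau g^Td+\|c\|_1-\|c+Jd\|_1$, $w=\max\{d^THd,\epsilon_d\|d\|^2\}$, $q=g^Td+w$, $\tau_{k,-1}=\bar\tau$. Accept the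 solution - if it is exact ($\rho=0$, $r=0$) or satisfies (II) $\|r\|\le\epsilon_{feas}\|c\|$ and $\|\rho\|\le\epsilon_{opt}\|c\|$; then set $\tau^{trial}=\infty$ if $q\le0$ and $\tau^{trial}=(1-\epsilon_\sigma)(\|c\|_1-\|r\|_1)/q$ otherwise, and $\tau_{k,j}=\tau_{k,j-1}$ if $\tau_{k,j-1}\le\tau^{trial}$, $\tau_{k,j}=(1-\epsilon_\tau)\tau^{trial}$ otherwise; - or if it satisfies (I): $\Delta l(\tau_{k,j-1})\ge\epsilon_\sigma(1-\epsilon_{feas})\big(\max\{\|c\|_1,\|r\|-\|c\|_1\}+\tau_{k,j-1}w\big)$, $\|(\rho,r)\|\le\kappa_T\min\{\|T\|,\|d\|\}$, $\|\rho\|\le\kappa'\max\{\|J\|,\|g\|\}$; then $\tau_{k,j}=\tau_{k,j-1}$. With $\phi(x)=\tau_{k,j}F_{S_k}(x)+\|c(x)\|_1$, let $\alpha$ be the first element of $1,\epsilon_\alpha,\epsilon_\alpha^2,\dots$ such that $\phi(x_{k,j}+\alpha d)\le\phi(x_{k,j})-\eta\alpha\Delta l(\tau_{k,j})$, and set $(x_{k,j+1},\lambda_{k,j+1})=(x_{k,j},\lambda_{k,j})+\alpha(d,\delta)$.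 **Assumptions.** $\chi$ is a closed bounded convex set containing all iterates $x_{k,j}$, and $D\supseteq\chi$ is a convex set containing all trial points of the line searches. $f$, $c$ and all $F(\cdot,\xi)$ are $C^1$ on $\mathbb R^n$; $\nabla f$ is Lipschitz on $\chi$; $J$ and all $g_{S_k}$ are Lipschitz on $D$; in the expectation case the Lipschitz constant of $g_{S_k}$ on $D$ and a bound of $\|g_{S_k}\|$ on $\chi$ are common to all $k$ (almost surely). $J(x)$ has full row rank for $x\in\chi$. There are $\kappa_H,\mu_H>0$ with $\|H_{k,j}\|\le\kappa_H$ and $u^TH_{k,j}u\ge\mu_H\|u\|^2$ whenever $J(x_{k,j})u=0$. Moreover $\epsilon_d\le\mu_H$ and $\sqrt m\,\epsilon_{feas}<1$. For constants $\omega_1,\omega_2\ge0$ and all $x\in\chi$: $\|\nabla F(x,\xi)\|^2\le\omega_1^2\|\nabla f(x)\|^2+\omega_2^2$ for all $\xi\in\mathcal S$ (finite sum), resp. $\mathbb E\|\nabla f(x)-\nabla F(x,\xi)\|^2\le\omega_1^2\|\nabla f(x)\|^2+\omega_2^2$ (expectation). In the expectation case there are $\epsilon_G,\kappa_G>0$ such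 that $G_S=\sup_{x\in\chi}\frac{\|\nabla f(x)-g_S(x)\|}{\epsilon_G+\|\nabla f(x)\|}$ satisfies $\mathbb E[G_S^2]\le\kappa_G^2/|S|$ for every i.i.d. sample $S$ from $\mathcal P$. **Claim 1 (well-posedness, sublinear inner loop; both problems, every realization of the samples).** Whenever an SQP iteration is carried out, the matrix of its linear system is nonsingular, $\tau_{k,j}>0$, and the line search stops after finitely many backtracking steps; and the inner loop of each outer iteration $k$ that is reached stops ($N_k<\infty$) provided $\gamma_k$ and $\epsilon_k$ are not both zero. If moreover only carry-over and reinitialize are used, or $\gamma_k\le\bar\gamma<1$ and $\epsilon_k\le\bar\epsilon$ for all $k$, then there is $C>0$, independent of the run and of $k$, such that for every $e>0$ the inner loop makes at most $Ce^{-2}$ iterations before it has found a point with $\|T_{S_k}(x_{k,j},\lambda_{k,j})\|\le e$ or stops. **Claim 2 (finite sum).** Let $\theta,\hat\theta,a\ge0$, $\beta\in(0,1)$, $\omega,\hat\omega>0$, $0\le\gamma_k\le\gamma$, $\gamma+\theta(\omega+\hat\theta+\gamma)<\beta$, $\epsilon_k=\omega\|\nabla f(x_{k,0})-g_{S_k}(x_{k,0})\|+\hat\omega\beta^k$,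 and let the sets $S_k$ satisfy, for all $k$, $$\|\nabla f(x_{k,0})-g_{S_k}(x_{k,0})\|^2\le R_k,\quad\|\nabla f(x_{k,N_k})-g_{S_k}(x_{k,N_k})\|^2\le\hat\theta^2R_k,\quad R_k=\theta^2\|T(x_{k,0},\lambda_{k-1,N_{k-1}})\|^2+a^2\beta^{2k}.$$ Then all inner loops stop, and there is $C>0$, independent of the run, such that for every $e\in(0,1]$ there is $K$ with $\|T(x_{K,N_K},\lambda_{K,N_K})\|\le e$, $\sum_{k\le K}N_k\le Ce^{-2}$ (inner iterations, i.e. SQP linear systems) and $\sum_{k\le K}|S_k|N_k\le C|\mathcal S|e^{-2}$ (gradient evaluations). **Claim 3 (expectation).** Let $S_k$ consist of i.i.d. samples from $\mathcal P$ independent of the past $\mathcal F_k$, with $x_{k,0}$ and $|S_k|$ being $\mathcal F_k$-measurable. Write $V_k=\mathrm{Var}(\nabla F(x_{k,0},\xi)\mid\mathcal F_k)$. Suppose that almost surely, for all $k$, $V_k\ge\kappa_G^2\kappa_\sigma^2$ with $\kappa_\sigma>0$ and $\|\nabla f(x_{k,0})\|\le\kappa_g$. Let $|S_0|\ge1$ be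 the given initial batch size, $\tilde\theta\ge0$, $\tilde\beta\in(0,1)$, $\tilde\omega>0$, $0\le\gamma_k\le\tilde\gamma$, $\tilde\gamma+\tilde\theta\big(\tilde\omega+\frac{\epsilon_G+\kappa_g}{\kappa_\sigma}+\tilde\gamma\big)<\tilde\beta$, $\tilde a=\sqrt{(\omega_1^2\kappa_g^2+\omega_2^2)/|S_0|}$, $\epsilon_k=\tilde\omega\sqrt{V_k/|S_k|}$, and for $k\ge1$ let $|S_k|$ be the smallest batch size for which $$\mathbb E\big[\|\nabla f(x_{k,0})-g_{S_k}(x_{k,0})\|^2\mid\mathcal F_k\big]\le\tilde\theta^2\|T(x_{k,0},\lambda_{k-1,N_{k-1}})\|^2+\tilde a^2\tilde\beta^{2k}.$$ Then almost surely all inner loops stop, and there is $C>0$, independent of the run, such that for every $e\in(0,1]$ there is $K$ with $\mathbb E\|T(x_{K,N_K},\lambda_{K,N_K})\|\le e$, $\sum_{k\le K}\mathbb E[N_k]\le Ce^{-2}$ (SQP linear systems) and $\sum_{k\le K}\mathbb E[|S_k|N_k]\le Ce^{-4}$ (gradient evaluations). -/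

import Mathlib

open MeasureTheory ProbabilityTheory
open scoped ENNReal NNReal

noncomputable section

namespace RASQP

/-- Euclidean space `ℝⁿ`. -/
abbrev E (n : ℕ) := EuclideanSpace ℝ (Fin n)

variable {n m : ℕ}

/-- The `ℓ₁` norm. -/
def l1 (v : E m) : ℝ := ∑ i, |v i|

/-- The Frobenius norm of a linear map, i.e. of its matrix in the standard bases. -/
def frob {p q : ℕ} (A : E p →L[ℝ] E q) : ℝ :=
  Real.sqrt (∑ i, ‖A (EuclideanSpace.single i (1 : ℝ))‖ ^ 2)

/-- The Jacobian `J(x) = ∇c(x)ᵀ`. -/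
def jac (c : E n → E m) (x : E n) : E n →L[ℝ] E m := fderiv ℝ c x

/-- The transposed Jacobian `J(x)ᵀ = ∇c(x)`. -/
def jacT (c : E n → E m) (x : E n) : E m →L[ℝ] E n := ContinuousLinearMap.adjoint (jac c x)

/-- The `x`-gradient of the Lagrangian `φ(x) + λᵀ c(x)`. -/
def gradLag (φ : E n → ℝ) (c : E n → E m) (x : E n) (lam : E m) : E n :=
  gradient φ x + jacT c x lam

/-- The Euclidean norm of the KKT residual `T(x, λ) = (∇φ(x) + ∇c(x) λ, c(x))`. -/
def kktErr (φ : E n → ℝ) (c : E n → E m) (x : E n) (lam : E m) : ℝ :=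
  Real.sqrt (‖gradLag φ c x lam‖ ^ 2 + ‖c x‖ ^ 2)

/-! ### The line-search SQP iteration for `min φ(x) s.t. c(x) = 0` -/

/-- User-defined parameters of the SQP method. -/
structure Params where
  (εσ ετ εd εα η εfeas εopt κT κρ τbar : ℝ)
  hεσ : εσ ∈ Set.Ioo (0 : ℝ) 1
  hετ : ετ ∈ Set.Ioo (0 : ℝ) 1
  hεd : εd ∈ Set.Ioo (0 : ℝ) 1
  hεα : εα ∈ Set.Ioo (0 : ℝ) 1
  hη : η ∈ Set.Ioo (0 : ℝ) 1
  hεfeas : εfeas ∈ Set.Ioo (0 : ℝ) (1 / 2)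
  hεopt : εopt ∈ Set.Ioo (0 : ℝ) (1 / 2)
  hκT : κT ∈ Set.Ioo (0 : ℝ) (1 / 2)
  hκρ : 0 < κρ
  hτbar : 0 < τbar

/-- The `ℓ₁` merit function `τ φ(x) + ‖c(x)‖₁`. -/
def merit (φ : E n → ℝ) (c : E n → E m) (τ : ℝ) (x : E n) : ℝ := τ * φ x + l1 (c x)

/-- Reduction of the local linear model of the merit function along `d`. -/
def deltaL (φ : E n → ℝ) (c : E n → E m) (x : E n) (τ : ℝ) (d : E n) : ℝ :=
  -τ * inner ℝ (gradient φ x) d + l1 (c x) - l1 (c x + jac c x d)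

/-- `max {dᵀ H d, ε_d ‖d‖²}`. -/
def curv (prm : Params) (H : E n →L[ℝ] E n) (d : E n) : ℝ :=
  max (inner ℝ d (H d)) (prm.εd * ‖d‖ ^ 2)

/-- `(d, δ)` solves the SQP linear system at `(x, λ)` with residual `(ρ, r)`. -/
def SolvesSystem (φ : E n → ℝ) (c : E n → E m) (x : E n) (lam : E m) (H : E n →L[ℝ] E n)
    (d : E n) (δ : E m) (ρ : E n) (r : E m) : Prop :=
  H d + jacT c x δ = -gradLag φ c x lam + ρ ∧ jac c x d = -c x + r

/-- Inexactness conditions I (`τ` is the merit parameter of the previous inner iteration). -/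
def InexactI (prm : Params) (φ : E n → ℝ) (c : E n → E m) (x : E n) (lam : E m)
    (H : E n →L[ℝ] E n) (τ : ℝ) (d : E n) (ρ : E n) (r : E m) : Prop :=
  prm.εσ * (1 - prm.εfeas) * max (l1 (c x)) (‖r‖ - l1 (c x))
      + prm.εσ * (1 - prm.εfeas) * τ * curv prm H d ≤ deltaL φ c x τ d ∧
  Real.sqrt (‖ρ‖ ^ 2 + ‖r‖ ^ 2) ≤ prm.κT * min (kktErr φ c x lam) ‖d‖ ∧
  ‖ρ‖ ≤ prm.κρ * max (frob (jac c x)) ‖gradient φ x‖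

/-- Inexactness conditions II. -/
def InexactII (prm : Params) (c : E n → E m) (x : E n) (ρ : E n) (r : E m) : Prop :=
  ‖r‖ ≤ prm.εfeas * ‖c x‖ ∧ ‖ρ‖ ≤ prm.εopt * ‖c x‖

/-- The merit parameter update; the first branch is the case of an infinite trial value. -/
def meritUpdate (prm : Params) (φ : E n → ℝ) (c : E n → E m) (x : E n) (H : E n →L[ℝ] E n)
    (d : E n) (r : E m) (τ : ℝ) : ℝ :=
  let q := inner ℝ (gradient φ x) d + curv prm H d
  let trial := (1 - prm.εσ) * (l1 (c x) - l1 r) / q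
  if q ≤ 0 then τ else if τ ≤ trial then τ else (1 - prm.ετ) * trial

/-- The Armijo sufficient decrease condition. -/
def Armijo (prm : Params) (φ : E n → ℝ) (c : E n → E m) (x : E n) (τ : ℝ) (d : E n)
    (α : ℝ) : Prop :=
  merit φ c τ (x + α • d) ≤ merit φ c τ x - prm.η * α * deltaL φ c x τ d

/-- Initialization of the dual variable by one of the two basic options: carry-over of the
previous value, or reinitialization by the least-squares multiplier
`-(J Jᵀ)⁻¹ J ∇φ(x)` (written as a linear equation; `J` has full row rank in the theorem). -/
def DualStd (φ : E n → ℝ) (c : E n → E m) (x : E n) (prev lam : E m) : Prop :=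
  lam = prev ∨ jac c x (jacT c x lam) = -jac c x (gradient φ x)

/-- Initialization of the dual variable: a basic option, or any estimate whose KKT error is at
most that of the previous dual variable. -/
def DualInit (φ : E n → ℝ) (c : E n → E m) (x : E n) (prev lam : E m) : Prop :=
  DualStd φ c x prev lam ∨ kktErr φ c x lam ≤ kktErr φ c x prev

/-! ### Runs of the nested algorithm -/

/-- Inputs: the constraints, the subsampled objective `F_{S_k}` of every outer iteration `k`, the
termination parameters `γ_k`, `ε_k`, and the initial primal and dual variables. -/
structure Input (n m : ℕ) where
  c : E n → E m
  Φ : ℕ → E n → ℝ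
  γ : ℕ → ℝ
  ε : ℕ → ℝ
  x0 : E n
  lam0 : E m

/-- The quantities computed in outer iteration `k` and inner iteration `j`. `ls k j` is the number
of backtracking steps of the line search (`⊤` if it never stops). Entries at indices that
the algorithm does not reach are irrelevant. -/
structure Trace (n m : ℕ) where
  x : ℕ → ℕ → E n
  lam : ℕ → ℕ → E m
  H : ℕ → ℕ → (E n →L[ℝ] E n)
  d : ℕ → ℕ → E n
  δ : ℕ → ℕ → E m
  ρ : ℕ → ℕ → E n
  r : ℕ → ℕ → E m
  τ : ℕ → ℕ → ℝ
  ls : ℕ → ℕ → ℕ∞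

/-- The merit parameter before inner iteration `j`; it is reset to `τ̄` in every outer
iteration. -/
def tauPrev (prm : Params) (tr : Trace n m) (k : ℕ) : ℕ → ℝ
  | 0 => prm.τbar
  | j + 1 => tr.τ k j

/-- The KKT error of the subsampled problem at the iterate `(k, j)`. -/
def subErr (I : Input n m) (tr : Trace n m) (k j : ℕ) : ℝ :=
  kktErr (I.Φ k) I.c (tr.x k j) (tr.lam k j)

/-- The termination test of the inner loop. -/
def Term (I : Input n m) (tr : Trace n m) (k j : ℕ) : Prop :=
  subErr I tr k j ≤ I.γ k * subErr I tr k 0 + I.ε k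

/-- The index pairs `(k, j)` that the algorithm reaches. -/
inductive Reached (I : Input n m) (tr : Trace n m) : ℕ → ℕ → Prop
  | start : Reached I tr 0 0
  | inner (k j : ℕ) : Reached I tr k j → ¬ Term I tr k j → tr.ls k j ≠ ⊤ →
      Reached I tr k (j + 1)
  | outer (k j : ℕ) : Reached I tr k j → Term I tr k j → Reached I tr (k + 1) 0

/-- The inner loop is at `(k, j)` and carries out an SQP iteration there. -/
def Active (I : Input n m) (tr : Trace n m) (k j : ℕ) : Prop :=
  Reached I tr k j ∧ ¬ Term I tr k j

/-- `tr` is a run of the equality constrained RA-SQP algorithm on the input `I`. The linear systems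
may be solved exactly or inexactly. -/
structure IsRun (prm : Params) (I : Input n m) (tr : Trace n m) : Prop where
  start : tr.x 0 0 = I.x0 ∧ DualInit (I.Φ 0) I.c I.x0 I.lam0 (tr.lam 0 0)
  next : ∀ k j, Reached I tr k j → Term I tr k j →
    tr.x (k + 1) 0 = tr.x k j ∧
    DualInit (I.Φ (k + 1)) I.c (tr.x k j) (tr.lam k j) (tr.lam (k + 1) 0)
  solve : ∀ k j, Active I tr k j →
    SolvesSystem (I.Φ k) I.c (tr.x k j) (tr.lam k j) (tr.H k j) (tr.d k j) (tr.δ k j)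
      (tr.ρ k j) (tr.r k j)
  accept : ∀ k j, Active I tr k j →
    (((tr.ρ k j = 0 ∧ tr.r k j = 0) ∨ InexactII prm I.c (tr.x k j) (tr.ρ k j) (tr.r k j)) ∧
      tr.τ k j = meritUpdate prm (I.Φ k) I.c (tr.x k j) (tr.H k j) (tr.d k j) (tr.r k j)
        (tauPrev prm tr k j)) ∨
    (InexactI prm (I.Φ k) I.c (tr.x k j) (tr.lam k j) (tr.H k j) (tauPrev prm tr k j)
        (tr.d k j) (tr.ρ k j) (tr.r k j) ∧
      tr.τ k j = tauPrev prm tr k j)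
  search : ∀ k j, Active I tr k j → ∀ i : ℕ,
    ((i : ℕ∞) < tr.ls k j →
      ¬ Armijo prm (I.Φ k) I.c (tr.x k j) (tr.τ k j) (tr.d k j) (prm.εα ^ i)) ∧
    (tr.ls k j = i →
      Armijo prm (I.Φ k) I.c (tr.x k j) (tr.τ k j) (tr.d k j) (prm.εα ^ i))
  update : ∀ k j, Active I tr k j → ∀ i : ℕ, tr.ls k j = i →
    tr.x k (j + 1) = tr.x k j + prm.εα ^ i • tr.d k j ∧
    tr.lam k (j + 1) = tr.lam k j + prm.εα ^ i • tr.δ k j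

/-- The run initializes the dual variable by the two basic options only. -/
def StdDualRun (I : Input n m) (tr : Trace n m) : Prop :=
  DualStd (I.Φ 0) I.c I.x0 I.lam0 (tr.lam 0 0) ∧
  ∀ k j, Reached I tr k j → Term I tr k j →
    DualStd (I.Φ (k + 1)) I.c (tr.x k j) (tr.lam k j) (tr.lam (k + 1) 0)

/-- The number `N_k` of inner iterations in outer iteration `k`. -/
def innerCount (I : Input n m) (tr : Trace n m) (k : ℕ) : ℕ :=
  sInf {j | Reached I tr k j ∧ Term I tr k j}

/-- Every outer iteration `k` is reached and its inner loop stops. -/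
def AllTerminate (I : Input n m) (tr : Trace n m) : Prop :=
  ∀ k, ∃ j, Reached I tr k j ∧ Term I tr k j

/-- The final dual variable `λ_{k-1, N_{k-1}}` of the previous outer iteration (the initial dual
variable if `k = 0`). -/
def prevLam (I : Input n m) (tr : Trace n m) : ℕ → E m
  | 0 => I.lam0
  | k + 1 => tr.lam k (innerCount I tr k)

/-- KKT error `‖T(x_{k,N_k}, λ_{k,N_k})‖` of the true problem with objective `f` at the end of
outer iteration `k`. -/
def endErr (f : E n → ℝ) (I : Input n m) (tr : Trace n m) (k : ℕ) : ℝ :=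
  kktErr f I.c (tr.x k (innerCount I tr k)) (tr.lam k (innerCount I tr k))

/-- KKT error `‖T(x_{k,0}, λ_{k-1,N_{k-1}})‖` of the true problem with objective `f` at the
beginning of outer iteration `k`. -/
def startErr (f : E n → ℝ) (I : Input n m) (tr : Trace n m) (k : ℕ) : ℝ :=
  kktErr f I.c (tr.x k 0) (prevLam I tr k)

/-! ### Assumptions -/

/-- Assumptions on the set `χ` that contains the iterates, on the set `D ⊇ χ` that also contains
the trial points of the line searches, and on the constraints. -/
structure ConstraintAssumptions (c : E n → E m) (χ D : Set (E n)) : Prop where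
  closed : IsClosed χ
  bounded : Bornology.IsBounded χ
  convex : Convex ℝ χ
  convexD : Convex ℝ D
  subset : χ ⊆ D
  smooth : ContDiff ℝ 1 c
  lipschitz : ∃ L : ℝ≥0, LipschitzOnWith L (jac c) D
  licq : ∀ x ∈ χ, Function.Surjective (jac c x)

/-- The iterates of the run lie in `χ`, the trial points of its line searches in `D`, and its
Hessian approximations are symmetric, bounded in norm by `κH`, and positive definite with
constant `μH` on the null space of the Jacobian. -/
structure RunAssumptions (prm : Params) (κH μH : ℝ) (χ D : Set (E n)) (I : Input n m)
    (tr : Trace n m) : Prop where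
  iterates : ∀ k j, Reached I tr k j → tr.x k j ∈ χ
  trials : ∀ k j, Active I tr k j → ∀ i : ℕ, (i : ℕ∞) ≤ tr.ls k j →
    tr.x k j + prm.εα ^ i • tr.d k j ∈ D
  hessSymm : ∀ k j, Active I tr k j → ∀ u v, inner ℝ (tr.H k j u) v = inner ℝ u (tr.H k j v)
  hessBound : ∀ k j, Active I tr k j → frob (tr.H k j) ≤ κH
  hessPos : ∀ k j, Active I tr k j → ∀ u, jac I.c (tr.x k j) u = 0 →
    μH * ‖u‖ ^ 2 ≤ inner ℝ u (tr.H k j u)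

/-! ### Conclusions about the inner loop -/

/-- Well-posedness of a run: whenever an SQP iteration is carried out, the SQP linear system is
nonsingular, the merit parameter is positive and the line search stops; and the inner loop of
outer iteration `k` stops if `γ_k` and `ε_k` are not both zero. -/
structure WellPosed (I : Input n m) (tr : Trace n m) : Prop where
  solvable : ∀ k j, Active I tr k j → ∀ (u : E n) (v : E m),
    ∃! p : E n × E m,
      tr.H k j p.1 + jacT I.c (tr.x k j) p.2 = u ∧ jac I.c (tr.x k j) p.1 = v
  merit_pos : ∀ k j, Active I tr k j → 0 < tr.τ k j
  search_stops : ∀ k j, Active I tr k j → tr.ls k j ≠ ⊤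
  terminates : ∀ k, Reached I tr k 0 → 0 < I.γ k ∨ 0 < I.ε k →
    ∃ j, Reached I tr k j ∧ Term I tr k j

/-- Sublinear rate with constant `C`: in every outer iteration, as long as no `e`-accurate
solution of the subsampled problem has been found, at most `C e⁻²` inner iterations have been
made. -/
def Sublinear (C : ℝ) (I : Input n m) (tr : Trace n m) : Prop :=
  ∀ k (e : ℝ), 0 < e → ∀ J, Reached I tr k J → (∀ j < J, e < subErr I tr k j) →
    (J : ℝ) ≤ C / e ^ 2

/-! ### The finite-sum problem -/

/-- The average `F_S` of `F(·, ξ)` over `ξ ∈ S`. -/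
def sampleMean {ι : Type*} (F : E n → ι → ℝ) (S : Finset ι) (x : E n) : ℝ :=
  (∑ ξ ∈ S, F x ξ) / S.card

/-- The objective of the finite-sum problem. -/
def finObj {ι : Type*} [Fintype ι] (F : E n → ι → ℝ) : E n → ℝ := sampleMean F Finset.univ

/-- Assumptions on the finite-sum objective. -/
structure FinSumAssumptions {ι : Type*} [Fintype ι] (F : E n → ι → ℝ) (χ : Set (E n))
    (ω₁ ω₂ : ℝ) : Prop where
  smooth : ∀ ξ, ContDiff ℝ 1 (fun x => F x ξ)
  lipschitz : ∃ L : ℝ≥0, LipschitzOnWith L (gradient (finObj F)) χ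
  gradErr : ∀ x ∈ χ, ∀ ξ, ‖gradient (fun y => F y ξ) x‖ ^ 2 ≤
    ω₁ ^ 2 * ‖gradient (finObj F) x‖ ^ 2 + ω₂ ^ 2

/-- The norm test for the finite-sum problem, at outer iteration `k`. -/
def FinNormTest (f : E n → ℝ) (θ θh a β : ℝ) (I : Input n m) (tr : Trace n m) (k : ℕ) : Prop :=
  ‖gradient f (tr.x k 0) - gradient (I.Φ k) (tr.x k 0)‖ ^ 2 ≤
    θ ^ 2 * startErr f I tr k ^ 2 + a ^ 2 * β ^ (2 * k) ∧
  ‖gradient f (tr.x k (innerCount I tr k)) - gradient (I.Φ k) (tr.x k (innerCount I tr k))‖ ^ 2 ≤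
    θh ^ 2 * (θ ^ 2 * startErr f I tr k ^ 2 + a ^ 2 * β ^ (2 * k))

/-! ### The expectation problem -/

/-- The average `F_S` over a sample `s` of size `N`. -/
def empMean {Ξ : Type*} (F : E n → Ξ → ℝ) (N : ℕ) (s : Fin N → Ξ) (x : E n) : ℝ :=
  (∑ i, F x (s i)) / N

variable {Ξ : Type*} [MeasurableSpace Ξ]

/-- The objective of the expectation problem. -/
def expObj (P : Measure Ξ) (F : E n → Ξ → ℝ) (x : E n) : ℝ := ∫ ξ, F x ξ ∂P

/-- The variance of `∇F(x, ξ)`. It is used at `x = x_{k,0}`, where it is the conditional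
variance given the past, because `ξ` is independent of the past and `x_{k,0}` is determined
by it. -/
def gradVar (P : Measure Ξ) (F : E n → Ξ → ℝ) (x : E n) : ℝ :=
  ∫ ξ, ‖gradient (fun y => F y ξ) x - ∫ ζ, gradient (fun y => F y ζ) x ∂P‖ ^ 2 ∂P

/-- `𝔼 ‖∇f(x) - g_S(x)‖²` for `N` i.i.d. samples. At `x = x_{k,0}` it is the conditional
expectation given the past, for the same reason. -/
def meanSqErr (P : Measure Ξ) (F : E n → Ξ → ℝ) (N : ℕ) (x : E n) : ℝ≥0∞ :=
  ∫⁻ s : Fin N → Ξ, ‖gradient (expObj P F) x - gradient (empMean F N s) x‖ₑ ^ 2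
    ∂(Measure.pi fun _ => P)

/-- The uniform relative gradient error `G_S`, for `φ = F_S`. -/
def relErr (f φ : E n → ℝ) (εG : ℝ) (χ : Set (E n)) : ℝ≥0∞ :=
  ⨆ x ∈ χ, ENNReal.ofReal (‖gradient f x - gradient φ x‖ / (εG + ‖gradient f x‖))

/-- Assumptions on the objective of the expectation problem: smoothness, the bound on the
gradient errors, and the CLT scaling. -/
structure ExpAssumptions (P : Measure Ξ) (F : E n → Ξ → ℝ) (χ : Set (E n))
    (ω₁ ω₂ εG κG : ℝ) : Prop where
  smoothF : ∀ ξ, ContDiff ℝ 1 (fun x => F x ξ)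
  measurableF : ∀ x, Measurable (F x)
  integrableF : ∀ x, Integrable (F x) P
  smooth : ContDiff ℝ 1 (expObj P F)
  lipschitz : ∃ L : ℝ≥0, LipschitzOnWith L (gradient (expObj P F)) χ
  gradErr : ∀ x ∈ χ,
    ∫⁻ ξ, ‖gradient (expObj P F) x - gradient (fun y => F y ξ) x‖ₑ ^ 2 ∂P ≤
      ENNReal.ofReal (ω₁ ^ 2 * ‖gradient (expObj P F) x‖ ^ 2 + ω₂ ^ 2)
  clt : ∀ N : ℕ, 0 < N →
    ∫⁻ s : Fin N → Ξ, relErr (expObj P F) (empMean F N s) εG χ ^ 2 ∂(Measure.pi fun _ => P) ≤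
      ENNReal.ofReal (κG ^ 2 / N)

/-- The subsampled objective `φ` has an `L`-Lipschitz gradient on `D`, bounded by `M` on `χ`. -/
def SubsampledSmooth (L : ℝ≥0) (M : ℝ) (χ D : Set (E n)) (φ : E n → ℝ) : Prop :=
  LipschitzOnWith L (gradient φ) D ∧ ∀ x ∈ χ, ‖gradient φ x‖ ≤ M

/-- The samples `ξ k i`, `i < b k`, of outer iteration `k` are i.i.d. with law `P` and independent
of the past `𝓕 k`, on which the batch size `b k` and the iterate `x_{k,0}` depend. -/
structure Sampling {Ω : Type*} [mΩ : MeasurableSpace Ω] (μ : Measure Ω) (P : Measure Ξ)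
    (𝓕 : Filtration ℕ mΩ) (ξ : ℕ → ℕ → Ω → Ξ) (b : ℕ → Ω → ℕ) (tr : Ω → Trace n m) : Prop where
  adapted : ∀ k i, Measurable[𝓕 (k + 1)] (ξ k i)
  law : ∀ k i, Measure.map (ξ k i) μ = P
  iid : ∀ k, iIndepFun (fun i => ξ k i) μ
  indep_past : ∀ k, Indep (⨆ i, MeasurableSpace.comap (ξ k i) inferInstance) (𝓕 k) μ
  batch : ∀ k, Measurable[𝓕 k] (b k)
  outer : ∀ k, Measurable[𝓕 k] (fun ω => (tr ω).x k 0)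
  primal : ∀ k j, Measurable[𝓕 (k + 1)] (fun ω => (tr ω).x k j)
  dual : ∀ k j, Measurable[𝓕 (k + 1)] (fun ω => (tr ω).lam k j)

end RASQP

end

namespace RASQP

/-! ### Norms -/

/-! The inner loop rests on one potential argument. Compactness of χ and full row rank give a σ > 0
with σ‖v‖ ≤ ‖J(x)ᵀv‖ on χ. Splitting d into a null space and a range space component then bounds the
residuals, d and λ + δ by constants that involve neither the current multiplier nor the sample
(`exists_direction_bound`). Under conditions II the quantity q is O(‖c‖₁), so every trial value of
the merit parameter exceeds a fixed positive number (`exists_merit_lower_bound`), and the model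
reduction dominates ‖c‖ + ‖d‖² (`exists_deltaL_lower_bound`). Taylor's formula yields a uniform
lower bound on the step sizes, so the decrease of the merit function makes ‖c‖ + ‖d‖² summable along
an inner loop (`SmoothRun.sum_step_le`).

To reach the KKT residual, let a be the norm of the gradient of the Lagrangian. A step of size α
gives a₊ ≤ (1 - α)a + αO(‖c‖ + ‖d‖), since the linear system cancels the fraction α of the old
gradient. Squaring and telescoping shows that the squared KKT residuals of an inner loop have a
bounded sum (`exists_sum_sq_bound`). This yields termination and the e⁻² rate, with a constant that
depends on the run only through a bound on the initial multiplier of the loop.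

The outer loop is a perturbed linear recursion. Every dual initialization leaves the KKT residual no
larger, the stopping test contracts it, and exchanging the sampled objective for the true one costs
a gradient error at each end of the loop. The norm test bounds these errors by θ times the residual
plus a multiple of βᵏ; as the resulting factor is below β, the residual is O(βᵏ). The tolerance is
at least of order βᵏ in the finite-sum case, so N_k = O(β⁻²ᵏ), and the sum up to the first K with an
O(e) residual is dominated by its last term.

In the expectation case the initial point is independent of the sample, and its mean-square error is
exactly V_k/|S_k|. The final point is not independent; there the uniform error G_S is used, and the
lower bound on V_k turns κ_G/√|S_k| into a multiple of √(V_k/|S_k|)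
(`Sampling.lintegral_endErr_le`). Minimality of the batch size gives |S_k| = O(β⁻²ᵏ). As ε_k² is at
least of order 1/|S_k|, N_k is O(β⁻²ᵏ) as well, and the product |S_k|N_k leads to e⁻⁴
(`exists_pathBounds`). -/

theorem l1_nonneg {m : ℕ} (v : E m) : 0 ≤ l1 v := Finset.sum_nonneg fun _ _ => abs_nonneg _

theorem norm_le_l1 {m : ℕ} (v : E m) : ‖v‖ ≤ l1 v := by
  rw [EuclideanSpace.norm_eq]
  apply Real.sqrt_le_iff.2 ⟨l1_nonneg v, ?_⟩
  simp only [Real.norm_eq_abs]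
  exact Finset.sum_sq_le_sq_sum_of_nonneg fun _ _ => abs_nonneg _

theorem l1_le_sqrt_mul_norm {m : ℕ} (v : E m) : l1 v ≤ Real.sqrt m * ‖v‖ := by
  have h := Real.sum_mul_le_sqrt_mul_sqrt Finset.univ (fun _ : Fin m => (1 : ℝ)) (fun i => |v i|)
  simp only [one_mul, one_pow, Finset.sum_const, Finset.card_univ, Fintype.card_fin,
    nsmul_eq_mul, mul_one] at h
  rw [EuclideanSpace.norm_eq]
  exact h

theorem l1_add_le {m : ℕ} (u v : E m) : l1 (u + v) ≤ l1 u + l1 v := by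
  unfold l1
  rw [← Finset.sum_add_distrib]
  exact Finset.sum_le_sum fun i _ => abs_add_le _ _

theorem l1_smul {m : ℕ} (t : ℝ) (v : E m) : l1 (t • v) = |t| * l1 v := by
  simp [l1, Finset.mul_sum, abs_mul]

theorem norm_apply_le_frob {p q : ℕ} (A : E p →L[ℝ] E q) (u : E p) : ‖A u‖ ≤ frob A * ‖u‖ := by
  have hu : u = ∑ i, u i • EuclideanSpace.single i (1 : ℝ) := by
    ext j
    simp [Finset.sum_apply, Pi.single_apply]
  calc ‖A u‖ = ‖∑ i, u i • A (EuclideanSpace.single i (1 : ℝ))‖ := by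
        conv_lhs => rw [hu]
        simp [map_sum]
    _ ≤ ∑ i, ‖u i‖ * ‖A (EuclideanSpace.single i (1 : ℝ))‖ := by
        refine (norm_sum_le _ _).trans (le_of_eq ?_)
        simp [norm_smul]
    _ ≤ Real.sqrt (∑ i, ‖u i‖ ^ 2) *
          Real.sqrt (∑ i, ‖A (EuclideanSpace.single i (1 : ℝ))‖ ^ 2) :=
        Real.sum_mul_le_sqrt_mul_sqrt _ _ _
    _ = frob A * ‖u‖ := by rw [EuclideanSpace.norm_eq, frob, mul_comm]

/-- Conditions I are phrased with the Frobenius norm, whereas compactness bounds the operator norm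
of the Jacobian. -/
theorem frob_le_sqrt_mul_norm {p q : ℕ} (A : E p →L[ℝ] E q) : frob A ≤ Real.sqrt p * ‖A‖ := by
  unfold frob
  refine Real.sqrt_le_iff.2 ⟨by positivity, ?_⟩
  rw [mul_pow, Real.sq_sqrt (Nat.cast_nonneg p)]
  calc ∑ i, ‖A (EuclideanSpace.single i (1 : ℝ))‖ ^ 2 ≤ ∑ _i : Fin p, ‖A‖ ^ 2 := by
        refine Finset.sum_le_sum fun i _ => ?_
        have := A.le_opNorm (EuclideanSpace.single i (1 : ℝ))
        simp at this
        gcongr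
    _ = p * ‖A‖ ^ 2 := by simp

/-! ### The KKT residual -/

theorem norm_gradLag_le_kktErr {n m : ℕ} (φ : E n → ℝ) (c : E n → E m) (x : E n) (lam : E m) :
    ‖gradLag φ c x lam‖ ≤ kktErr φ c x lam :=
  Real.le_sqrt_of_sq_le (by nlinarith [sq_nonneg ‖c x‖])

theorem kktErr_nonneg {n m : ℕ} (φ : E n → ℝ) (c : E n → E m) (x : E n) (lam : E m) :
    0 ≤ kktErr φ c x lam := Real.sqrt_nonneg _

theorem kktErr_sq {n m : ℕ} (φ : E n → ℝ) (c : E n → E m) (x : E n) (lam : E m) :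
    kktErr φ c x lam ^ 2 = ‖gradLag φ c x lam‖ ^ 2 + ‖c x‖ ^ 2 :=
  Real.sq_sqrt (by positivity)

theorem kktErr_le_add {n m : ℕ} (φ : E n → ℝ) (c : E n → E m) (x : E n) (lam : E m) :
    kktErr φ c x lam ≤ ‖gradLag φ c x lam‖ + ‖c x‖ := by
  refine Real.sqrt_le_iff.2 ⟨by positivity, ?_⟩
  nlinarith [norm_nonneg (gradLag φ c x lam), norm_nonneg (c x)]

/-- The KKT residuals of two objectives differ by at most the distance of their gradients. -/
theorem kktErr_le_add_norm_sub {n m : ℕ} (φ ψ : E n → ℝ) (c : E n → E m) (x : E n) (lam : E m) :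
    kktErr φ c x lam ≤ kktErr ψ c x lam + ‖gradient φ x - gradient ψ x‖ := by
  have h1 : ‖gradLag φ c x lam‖ ≤ ‖gradLag ψ c x lam‖ + ‖gradient φ x - gradient ψ x‖ := by
    have : gradLag φ c x lam = gradLag ψ c x lam + (gradient φ x - gradient ψ x) := by
      unfold gradLag; abel
    rw [this]; exact norm_add_le _ _
  have h2 := kktErr_sq ψ c x lam
  have h3 := norm_gradLag_le_kktErr ψ c x lam
  refine Real.sqrt_le_iff.2 ⟨add_nonneg (kktErr_nonneg _ _ _ _) (norm_nonneg _), ?_⟩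
  nlinarith [norm_nonneg (gradLag φ c x lam), norm_nonneg (gradient φ x - gradient ψ x),
    norm_nonneg (gradLag ψ c x lam)]

theorem inner_jacT {n m : ℕ} (c : E n → E m) (x u : E n) (v : E m) :
    inner ℝ u (jacT c x v) = inner ℝ (jac c x u) v :=
  ContinuousLinearMap.adjoint_inner_right _ _ _

/-- The least-squares multiplier minimizes the norm of the gradient of the Lagrangian. -/
theorem norm_gradLag_le_of_leastSquares {n m : ℕ} {φ : E n → ℝ} {c : E n → E m} {x : E n}
    {lam : E m} (h : jac c x (jacT c x lam) = -jac c x (gradient φ x)) (lam' : E m) :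
    ‖gradLag φ c x lam‖ ≤ ‖gradLag φ c x lam'‖ := by
  have h0 : jac c x (gradLag φ c x lam) = 0 := by
    unfold gradLag; rw [map_add, h]; abel
  have h1 : gradLag φ c x lam' = gradLag φ c x lam + jacT c x (lam' - lam) := by
    unfold gradLag; rw [map_sub]; abel
  have h2 : inner ℝ (gradLag φ c x lam) (jacT c x (lam' - lam)) = 0 := by
    rw [inner_jacT, h0, inner_zero_left]
  have h3 := norm_add_sq_real (gradLag φ c x lam) (jacT c x (lam' - lam))
  rw [← h1, h2] at h3
  refine (sq_le_sq₀ (norm_nonneg _) (norm_nonneg _)).1 ?_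
  nlinarith [sq_nonneg ‖jacT c x (lam' - lam)‖]

/-- The constraint part of the residual does not involve the multiplier, so minimizing the
Lagrangian gradient suffices for reinitialization. From here on the outer recursion no longer
distinguishes the three options. -/
theorem kktErr_le_of_dualInit {n m : ℕ} {φ : E n → ℝ} {c : E n → E m} {x : E n}
    {prev lam : E m} (h : DualInit φ c x prev lam) :
    kktErr φ c x lam ≤ kktErr φ c x prev := by
  rcases h with (rfl | h) | h
  · exact le_rfl
  · have := norm_gradLag_le_of_leastSquares h prev
    unfold kktErr
    gcongr
  · exact h

/-! ### Uniform bounds on the constraints -/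

/-- Uniform bounds on the constraints and their Jacobian. -/
structure ConstraintBounds {n m : ℕ} (c : E n → E m) (χ : Set (E n)) (σ κc κJ : ℝ) : Prop where
  pos : 0 < σ
  kc_nonneg : 0 ≤ κc
  kJ_nonneg : 0 ≤ κJ
  lower : ∀ x ∈ χ, ∀ v, σ * ‖v‖ ≤ ‖jacT c x v‖
  constr : ∀ x ∈ χ, ‖c x‖ ≤ κc
  jac_le : ∀ x ∈ χ, ‖jac c x‖ ≤ κJ

/-- The constant σ comes from minimizing the continuous function ‖J(x)ᵀv‖ over the compact set of
pairs with x ∈ χ and ‖v‖ = 1; surjectivity of J(x) excludes a zero there. -/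
theorem exists_constraintBounds {n m : ℕ} {c : E n → E m} {χ D : Set (E n)}
    (hc : ConstraintAssumptions c χ D) : ∃ σ κc κJ, ConstraintBounds c χ σ κc κJ := by
  have hK : IsCompact χ := Metric.isCompact_of_isClosed_isBounded hc.closed hc.bounded
  have hjac : Continuous (jac c) := hc.smooth.continuous_fderiv (by norm_num)
  have hjacT : Continuous (jacT c) :=
    (ContinuousLinearMap.adjoint (𝕜 := ℝ) (E := E n) (F := E m)).continuous.comp hjac
  obtain ⟨κc, hκc⟩ := hK.exists_bound_of_continuousOn hc.smooth.continuous.continuousOn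
  obtain ⟨κJ, hκJ⟩ := hK.exists_bound_of_continuousOn hjac.continuousOn
  have hS : IsCompact (χ ×ˢ Metric.sphere (0 : E m) 1) := hK.prod (isCompact_sphere _ _)
  have hcont : Continuous fun p : E n × E m => ‖jacT c p.1 p.2‖ :=
    ((hjacT.comp continuous_fst).clm_apply continuous_snd).norm
  obtain ⟨σ, hσ, hle⟩ := hS.exists_forall_le' hcont.continuousOn (a := 0) (by
    rintro ⟨x, v⟩ ⟨hx, hv⟩
    refine norm_pos_iff.2 fun h0 => ?_
    obtain ⟨d, hd⟩ := hc.licq x hx v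
    have := inner_jacT c x d v
    simp only at h0
    rw [h0, hd, inner_zero_right, real_inner_self_eq_norm_sq] at this
    simp at hv
    rw [hv] at this
    norm_num at this)
  refine ⟨σ, max κc 0, max κJ 0, hσ, le_max_right _ _, le_max_right _ _, fun x hx v => ?_,
    fun x hx => (hκc x hx).trans (le_max_left _ _), fun x hx => (hκJ x hx).trans (le_max_left _ _)⟩
  by_cases hv : v = 0
  · simp [hv]
  have hv' : 0 < ‖v‖ := norm_pos_iff.2 hv
  have := hle (x, ‖v‖⁻¹ • v) ⟨hx, by simp [norm_smul, hv'.ne']⟩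
  simp only [map_smul, norm_smul, norm_inv, norm_norm] at this
  rw [← div_eq_inv_mul, le_div_iff₀ hv'] at this
  exact this

/-- Full row rank makes the multiplier recoverable from the Lagrangian gradient: J(x)ᵀλ is that
gradient minus ∇φ(x). A bound on the KKT residual thus becomes a bound on λ. -/
theorem ConstraintBounds.norm_le_of_gradLag {n m : ℕ} {c : E n → E m} {χ : Set (E n)}
    {σ κc κJ M : ℝ} (hb : ConstraintBounds c χ σ κc κJ) {φ : E n → ℝ} {x : E n} (hx : x ∈ χ)
    (hM : ‖gradient φ x‖ ≤ M) (lam : E m) : ‖lam‖ ≤ (M + ‖gradLag φ c x lam‖) / σ := by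
  rw [le_div_iff₀ hb.pos, mul_comm]
  refine (hb.lower x hx lam).trans ?_
  have : jacT c x lam = gradLag φ c x lam - gradient φ x := by unfold gradLag; abel
  rw [this]
  linarith [norm_sub_le (gradLag φ c x lam) (gradient φ x)]

theorem ConstraintBounds.norm_gradLag_le {n m : ℕ} {c : E n → E m} {χ : Set (E n)}
    {σ κc κJ M : ℝ} (hb : ConstraintBounds c χ σ κc κJ) {φ : E n → ℝ} {x : E n} (hx : x ∈ χ)
    (hM : ‖gradient φ x‖ ≤ M) (lam : E m) : ‖gradLag φ c x lam‖ ≤ M + κJ * ‖lam‖ := by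
  have h : ‖jacT c x lam‖ ≤ κJ * ‖lam‖ := by
    refine (ContinuousLinearMap.le_opNorm _ _).trans ?_
    unfold jacT
    rw [LinearIsometryEquiv.norm_map]
    exact mul_le_mul_of_nonneg_right (hb.jac_le x hx) (norm_nonneg _)
  exact (norm_add_le _ _).trans (add_le_add hM h)

/-! ### Null space splitting and the SQP matrix. -/

/-- Splitting of a vector into a null space component of the Jacobian and an orthogonal component
controlled by the image under the Jacobian. -/
theorem exists_null_add_range {n m : ℕ} {c : E n → E m} {x : E n} {σ : ℝ} (hσ : 0 < σ)
    (hlow : ∀ v, σ * ‖v‖ ≤ ‖jacT c x v‖) (d : E n) :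
    ∃ u v, d = u + v ∧ jac c x u = 0 ∧ inner ℝ u v = 0 ∧ σ * ‖v‖ ≤ ‖jac c x d‖ := by
  -- JJᵀ is injective because Jᵀ is bounded below, hence surjective. The range component is Jᵀz,
  -- where JJᵀz = Jd.
  let A : E m →ₗ[ℝ] E m := (jac c x ∘L jacT c x).toLinearMap
  have hinj : Function.Injective A := by
    rw [← LinearMap.ker_eq_bot, LinearMap.ker_eq_bot']
    intro z hz
    have h1 : inner ℝ (jacT c x z) (jacT c x z) = 0 := by
      rw [inner_jacT]
      change inner ℝ (A z) z = 0
      rw [hz, inner_zero_left]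
    have h2 := hlow z
    rw [inner_self_eq_zero] at h1
    rw [h1, norm_zero] at h2
    have : ‖z‖ ≤ 0 := by
      by_contra h
      push Not at h
      nlinarith
    exact norm_le_zero_iff.1 this
  obtain ⟨z, hz⟩ := LinearMap.injective_iff_surjective.1 hinj (jac c x d)
  have hz' : jac c x (jacT c x z) = jac c x d := hz
  refine ⟨d - jacT c x z, jacT c x z, by abel, by rw [map_sub, hz', sub_self], ?_, ?_⟩
  · rw [inner_jacT, map_sub, hz', sub_self, inner_zero_left]
  · have h1 : ‖jacT c x z‖ ^ 2 = inner ℝ (jac c x d) z := by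
      rw [← real_inner_self_eq_norm_sq, inner_jacT, hz']
    have h2 := real_inner_le_norm (jac c x d) z
    have h3 := hlow z
    by_cases h0 : ‖jacT c x z‖ = 0
    · rw [h0]; simp
    have hp : 0 < ‖jacT c x z‖ := lt_of_le_of_ne (norm_nonneg _) (Ne.symm h0)
    have : ‖jacT c x z‖ * (σ * ‖jacT c x z‖) ≤ ‖jacT c x z‖ * ‖jac c x d‖ := by
      calc ‖jacT c x z‖ * (σ * ‖jacT c x z‖) = σ * ‖jacT c x z‖ ^ 2 := by ring
        _ ≤ σ * (‖jac c x d‖ * ‖z‖) := by gcongr; rw [h1]; exact h2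
        _ = ‖jac c x d‖ * (σ * ‖z‖) := by ring
        _ ≤ ‖jac c x d‖ * ‖jacT c x z‖ := by gcongr
        _ = _ := mul_comm _ _
    exact le_of_mul_le_mul_left this hp

/-- The matrix of the SQP linear system is nonsingular. -/
theorem existsUnique_kkt {n m : ℕ} {c : E n → E m} {x : E n} {σ μH : ℝ} (hσ : 0 < σ)
    (hlow : ∀ v, σ * ‖v‖ ≤ ‖jacT c x v‖) (hμ : 0 < μH) {H : E n →L[ℝ] E n}
    (hH : ∀ u, jac c x u = 0 → μH * ‖u‖ ^ 2 ≤ inner ℝ u (H u)) (u : E n) (v : E m) :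
    ∃! p : E n × E m, H p.1 + jacT c x p.2 = u ∧ jac c x p.1 = v := by
  let A : (E n × E m) →ₗ[ℝ] (E n × E m) :=
    ((H.toLinearMap.coprod (jacT c x).toLinearMap)).prod
      ((jac c x).toLinearMap ∘ₗ LinearMap.fst ℝ (E n) (E m))
  have hA : ∀ p, A p = (H p.1 + jacT c x p.2, jac c x p.1) := fun p => rfl
  have hinj : Function.Injective A := by
    rw [← LinearMap.ker_eq_bot, LinearMap.ker_eq_bot']
    rintro ⟨d, z⟩ hz
    rw [hA] at hz
    obtain ⟨h1, h2⟩ := Prod.mk.inj hz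
    simp only at h1 h2
    -- Pairing the first block with d removes Jᵀz since Jd = 0; positivity on the null space then
    -- forces d = 0.
    have h3 : inner ℝ d (H d) = 0 := by
      have : inner ℝ d (H d + jacT c x z) = 0 := by rw [h1, inner_zero_right]
      rwa [inner_add_right, inner_jacT, h2, inner_zero_left, add_zero] at this
    have h4 := hH d h2
    rw [h3] at h4
    have hd : d = 0 := by
      by_contra hd
      have := norm_pos_iff.2 hd
      nlinarith [mul_pos hμ (pow_pos this 2)]
    rw [hd, map_zero, zero_add] at h1
    have h5 := hlow z
    rw [h1, norm_zero] at h5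
    have hz0 : z = 0 := by
      by_contra hz
      nlinarith [norm_pos_iff.2 hz, mul_pos hσ (norm_pos_iff.2 hz)]
    rw [hd, hz0]; rfl
  have hbij : Function.Bijective A := ⟨hinj, LinearMap.injective_iff_surjective.1 hinj⟩
  obtain ⟨p, hp, hu⟩ := hbij.existsUnique (u, v)
  refine ⟨p, ?_, fun q hq => hu q ?_⟩
  · rw [hA] at hp; exact ⟨(Prod.mk.inj hp).1, (Prod.mk.inj hp).2⟩
  · change A q = _
    rw [hA, hq.1, hq.2]

end RASQP

namespace RASQP

/-! ### One SQP iteration -/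

/-- One accepted SQP iteration from `(x, lam)` for the objective `φ`, with `‖∇φ(x)‖ ≤ M`; the merit
parameter is `τp` before and `τ` after the iteration. -/
structure Step {n m : ℕ} (prm : Params) (κH μH M : ℝ) (c : E n → E m) (χ : Set (E n))
    (φ : E n → ℝ) (x : E n) (lam : E m) (H : E n →L[ℝ] E n) (τp : ℝ) (d : E n) (δ : E m)
    (ρ : E n) (r : E m) (τ : ℝ) : Prop where
  mem : x ∈ χ
  grad_le : ‖gradient φ x‖ ≤ M
  solve : SolvesSystem φ c x lam H d δ ρ r
  accept : (InexactII prm c x ρ r ∧ τ = meritUpdate prm φ c x H d r τp) ∨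
    (InexactI prm φ c x lam H τp d ρ r ∧ τ = τp)
  hess_le : ∀ u, ‖H u‖ ≤ κH * ‖u‖
  hess_pos : ∀ u, jac c x u = 0 → μH * ‖u‖ ^ 2 ≤ inner ℝ u (H u)

variable {n m : ℕ} {prm : Params} {κH μH M : ℝ} {c : E n → E m} {χ : Set (E n)}
  {σ κc κJ : ℝ} {φ : E n → ℝ} {x : E n} {lam : E m} {H : E n →L[ℝ] E n}
  {τp : ℝ} {d : E n} {δ : E m} {ρ : E n} {r : E m} {τ : ℝ}

theorem Step.constr_add (hs : Step prm κH μH M c χ φ x lam H τp d δ ρ r τ) :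
    c x + jac c x d = r := by
  rw [hs.solve.2]; abel

theorem Step.deltaL_eq (hs : Step prm κH μH M c χ φ x lam H τp d δ ρ r τ) (t : ℝ) :
    deltaL φ c x t d = -t * inner ℝ (gradient φ x) d + l1 (c x) - l1 r := by
  unfold deltaL; rw [hs.constr_add]

theorem le_curv (prm : Params) (H : E n →L[ℝ] E n) (d : E n) :
    prm.εd * ‖d‖ ^ 2 ≤ curv prm H d := le_max_right _ _

/-- The residuals of an accepted solution are bounded. -/
theorem exists_residual_bound (prm : Params) (κH μH : ℝ) (hM : 0 ≤ M)
    (hb : ConstraintBounds c χ σ κc κJ) :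
    ∃ K : ℝ, 0 ≤ K ∧ ∀ φ x lam H τp d δ ρ r τ,
      Step prm κH μH M c χ φ x lam H τp d δ ρ r τ → 0 ≤ τp → τp ≤ prm.τbar →
      ‖ρ‖ ≤ K ∧ ‖r‖ ≤ K := by
  obtain ⟨hσ1, -⟩ := prm.hεσ
  obtain ⟨hf1, hf2⟩ := prm.hεfeas
  obtain ⟨ho1, ho2⟩ := prm.hεopt
  obtain ⟨hd1, -⟩ := prm.hεd
  have hτ := prm.hτbar
  have hκ := prm.hκρ
  set c' := prm.εσ * (1 - prm.εfeas) * prm.εd with hc'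
  have hc'pos : 0 < c' := mul_pos (mul_pos hσ1 (by linarith)) hd1
  set K1 := prm.κρ * max (Real.sqrt n * κJ) M
  set K2 := Real.sqrt m * κc + prm.τbar * (M ^ 2 / (4 * c'))
  have hK1 : 0 ≤ K1 := mul_nonneg hκ.le (le_max_of_le_right hM)
  have hK2 : 0 ≤ K2 := add_nonneg (mul_nonneg (Real.sqrt_nonneg _) hb.kc_nonneg) (by positivity)
  refine ⟨κc + K1 + K2, by linarith [hb.kc_nonneg], ?_⟩
  intro φ x lam H τp d δ ρ r τ hs h0 h1
  have hcx := hb.constr x hs.mem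
  have hcn := norm_nonneg (c x)
  rcases hs.accept with ⟨⟨hr, hρ⟩, -⟩ | ⟨⟨hl, -, hρ⟩, -⟩
  · constructor <;> nlinarith
  · constructor
    -- The bound κ_T·min(‖T‖, ‖d‖) is of no use yet, as neither ‖T‖ nor ‖d‖ is known to be bounded.
    -- The third clause of conditions I replaces it.
    · have hfrob : frob (jac c x) ≤ Real.sqrt n * κJ :=
        (frob_le_sqrt_mul_norm _).trans
          (mul_le_mul_of_nonneg_left (hb.jac_le x hs.mem) (Real.sqrt_nonneg _))
      have : ‖ρ‖ ≤ K1 :=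
        hρ.trans (mul_le_mul_of_nonneg_left (max_le_max hfrob hs.grad_le) hκ.le)
      linarith [hb.kc_nonneg]
    · rw [hs.deltaL_eq] at hl
      have h2 : 0 ≤ prm.εσ * (1 - prm.εfeas) * max (l1 (c x)) (‖r‖ - l1 (c x)) :=
        mul_nonneg (mul_nonneg hσ1.le (by linarith)) (le_max_of_le_left (l1_nonneg _))
      have h3 : c' * τp * ‖d‖ ^ 2 ≤ prm.εσ * (1 - prm.εfeas) * τp * curv prm H d := by
        have h5 : 0 ≤ prm.εσ * (1 - prm.εfeas) * τp :=
          mul_nonneg (mul_nonneg hσ1.le (by linarith)) h0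
        have := mul_le_mul_of_nonneg_left (le_curv prm H d) h5
        calc _ = _ := by rw [hc']; ring
          _ ≤ _ := this
      have h4 : -inner ℝ (gradient φ x) d ≤ M * ‖d‖ :=
        (neg_le_abs _).trans ((abs_real_inner_le_norm _ _).trans
          (mul_le_mul_of_nonneg_right hs.grad_le (norm_nonneg _)))
      -- The curvature term in conditions I makes the bound on ‖r‖ a concave quadratic in ‖d‖; its
      -- maximum removes the unknown direction.
      have h6 : M * ‖d‖ - c' * ‖d‖ ^ 2 ≤ M ^ 2 / (4 * c') := by
        rw [le_div_iff₀ (by positivity)]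
        nlinarith [sq_nonneg (M - 2 * c' * ‖d‖)]
      have h7 : τp * (M * ‖d‖ - c' * ‖d‖ ^ 2) ≤ prm.τbar * (M ^ 2 / (4 * c')) :=
        (mul_le_mul_of_nonneg_left h6 h0).trans
          (mul_le_mul_of_nonneg_right h1 (by positivity))
      have h8 := mul_le_mul_of_nonneg_left h4 h0
      have h9 : l1 (c x) ≤ Real.sqrt m * κc :=
        (l1_le_sqrt_mul_norm _).trans (mul_le_mul_of_nonneg_left hcx (Real.sqrt_nonneg _))
      have h10 := norm_le_l1 r
      have : ‖r‖ ≤ K2 := by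
        simp only [K2]
        nlinarith
      linarith [hb.kc_nonneg]

/-- Null space and range space components of the search direction. -/
theorem Step.exists_split (hs : Step prm κH μH M c χ φ x lam H τp d δ ρ r τ)
    (hb : ConstraintBounds c χ σ κc κJ) :
    ∃ u v, d = u + v ∧ jac c x u = 0 ∧ inner ℝ u v = 0 ∧ σ * ‖v‖ ≤ ‖c x‖ + ‖r‖ ∧
      inner ℝ u (H d) = inner ℝ u ρ - inner ℝ u (gradient φ x) := by
  obtain ⟨u, v, hd, hu, huv, hv⟩ := exists_null_add_range hb.pos (hb.lower x hs.mem) d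
  refine ⟨u, v, hd, hu, huv, hv.trans ?_, ?_⟩
  · rw [hs.solve.2, add_comm]
    exact (norm_add_le _ _).trans (by rw [norm_neg, add_comm])
  · have h : inner ℝ u (H d + jacT c x δ) = inner ℝ u (-gradLag φ c x lam + ρ) := by
      rw [hs.solve.1]
    simp only [gradLag, inner_add_right, inner_neg_right, inner_jacT, hu, inner_zero_left,
      add_zero] at h
    linarith

/-- The search direction and the new multiplier estimate are bounded. -/
theorem exists_direction_bound (prm : Params) (hκH : 0 < κH) (hμH : 0 < μH) (hM : 0 ≤ M)
    (hb : ConstraintBounds c χ σ κc κJ) :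
    ∃ K : ℝ, 0 ≤ K ∧ ∀ φ x lam H τp d δ ρ r τ,
      Step prm κH μH M c χ φ x lam H τp d δ ρ r τ → 0 ≤ τp → τp ≤ prm.τbar →
      ‖ρ‖ ≤ K ∧ ‖d‖ ≤ K ∧ ‖lam + δ‖ ≤ K := by
  obtain ⟨K, hK, hres⟩ := exists_residual_bound prm κH μH hM hb
  have hσ := hb.pos
  have hkc := hb.kc_nonneg
  -- The three constants bound, in turn, the range component, the null space component (by
  -- coercivity, after testing with u), and λ + δ, for which Jᵀ(λ + δ) = -g - Hd + ρ.
  set Kv := (κc + K) / σ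
  set Ku := (M + K + κH * Kv) / μH
  set Kl := (M + κH * (Ku + Kv) + K) / σ
  have hKv : 0 ≤ Kv := by positivity
  have hKu : 0 ≤ Ku := by positivity
  have hKl : 0 ≤ Kl := by positivity
  refine ⟨K + (Ku + Kv) + Kl, by positivity, ?_⟩
  intro φ x lam H τp d δ ρ r τ hs h0 h1
  obtain ⟨hρ, hr⟩ := hres _ _ _ _ _ _ _ _ _ _ hs h0 h1
  obtain ⟨u, v, hd, hu, huv, hv, huH⟩ := hs.exists_split hb
  have hv' : ‖v‖ ≤ Kv := by
    rw [le_div_iff₀ hσ]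
    linarith [hb.constr x hs.mem]
  have hu' : ‖u‖ ≤ Ku := by
    rw [le_div_iff₀ hμH]
    rw [hd, map_add, inner_add_right] at huH
    have e1 := hs.hess_pos u hu
    have e2 : inner ℝ u ρ ≤ ‖u‖ * K :=
      (real_inner_le_norm _ _).trans (mul_le_mul_of_nonneg_left hρ (norm_nonneg _))
    have e3 : -inner ℝ u (gradient φ x) ≤ ‖u‖ * M :=
      (neg_le_abs _).trans ((abs_real_inner_le_norm _ _).trans
        (mul_le_mul_of_nonneg_left hs.grad_le (norm_nonneg _)))
    have e4 : -inner ℝ u (H v) ≤ ‖u‖ * (κH * Kv) :=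
      (neg_le_abs _).trans ((abs_real_inner_le_norm _ _).trans
        (mul_le_mul_of_nonneg_left ((hs.hess_le v).trans
          (mul_le_mul_of_nonneg_left hv' hκH.le)) (norm_nonneg _)))
    rcases (norm_nonneg u).eq_or_lt with h | h
    · rw [← h, zero_mul]; positivity
    · refine le_of_mul_le_mul_left ?_ h
      nlinarith
  have hd' : ‖d‖ ≤ Ku + Kv := by
    rw [hd]; exact (norm_add_le _ _).trans (add_le_add hu' hv')
  have hl : ‖lam + δ‖ ≤ Kl := by
    rw [le_div_iff₀ hσ, mul_comm]
    refine (hb.lower x hs.mem _).trans ?_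
    have e : jacT c x (lam + δ) = -gradient φ x - H d + ρ := by
      have := hs.solve.1
      rw [map_add, ← sub_eq_zero]
      unfold gradLag at this
      rw [← sub_eq_zero] at this
      rw [← this]; abel
    rw [e]
    have e1 := hs.grad_le
    have e2 := (hs.hess_le d).trans (mul_le_mul_of_nonneg_left hd' hκH.le)
    have e3 := norm_add_le (-gradient φ x - H d) ρ
    have e4 := norm_sub_le (-gradient φ x) (H d)
    rw [norm_neg] at e4
    linarith
  exact ⟨by linarith, by linarith, by linarith⟩

/-- A form of the residual bound common to both acceptance tests: conditions II control ρ by ‖c‖ and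
conditions I by ‖d‖. -/
theorem Step.norm_residual_le (hs : Step prm κH μH M c χ φ x lam H τp d δ ρ r τ) :
    ‖ρ‖ ≤ ‖c x‖ + ‖d‖ := by
  obtain ⟨ho1, ho2⟩ := prm.hεopt
  obtain ⟨hT1, hT2⟩ := prm.hκT
  have h1 := norm_nonneg (c x)
  have h2 := norm_nonneg d
  rcases hs.accept with ⟨⟨hr, hρ⟩, -⟩ | ⟨⟨-, hT, -⟩, -⟩
  · nlinarith
  · have : ‖ρ‖ ≤ Real.sqrt (‖ρ‖ ^ 2 + ‖r‖ ^ 2) :=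
      Real.le_sqrt_of_sq_le (by nlinarith [sq_nonneg ‖r‖])
    have h3 : prm.κT * min (kktErr φ c x lam) ‖d‖ ≤ prm.κT * ‖d‖ :=
      mul_le_mul_of_nonneg_left (min_le_right _ _) hT1.le
    nlinarith

/-- Under conditions II the reduction in linearized constraint violation is proportional to the
constraint violation. -/
theorem l1_sub_l1_ge (h : InexactII prm c x ρ r) :
    (1 - Real.sqrt m * prm.εfeas) * l1 (c x) ≤ l1 (c x) - l1 r := by
  have h1 := l1_le_sqrt_mul_norm r
  have h2 := mul_le_mul_of_nonneg_left h.1 (Real.sqrt_nonneg (m : ℝ))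
  have h3 := mul_le_mul_of_nonneg_left (norm_le_l1 (c x))
    (mul_nonneg (Real.sqrt_nonneg (m : ℝ)) prm.hεfeas.1.le)
  nlinarith

/-- Under conditions II, `gᵀd + max {dᵀHd, ε_d‖d‖²}` is at most a multiple of the constraint
violation. -/
theorem exists_model_bound (prm : Params) (hκH : 0 < κH) (hμH : 0 < μH) (hM : 0 ≤ M)
    (hεd : prm.εd ≤ μH) (hb : ConstraintBounds c χ σ κc κJ) :
    ∃ K : ℝ, 0 < K ∧ ∀ φ x lam H τp d δ ρ r τ,
      Step prm κH μH M c χ φ x lam H τp d δ ρ r τ → 0 ≤ τp → τp ≤ prm.τbar →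
      InexactII prm c x ρ r →
      inner ℝ (gradient φ x) d + curv prm H d ≤ K * l1 (c x) := by
  obtain ⟨K, hK, hdir⟩ := exists_direction_bound prm hκH hμH hM hb
  have hσ := hb.pos
  obtain ⟨hf1, hf2⟩ := prm.hεfeas
  obtain ⟨ho1, ho2⟩ := prm.hεopt
  obtain ⟨hd1, hd2⟩ := prm.hεd
  refine ⟨(M + (2 * κH + 1) * K + 1) * (2 / σ) + K, by positivity, ?_⟩
  intro φ x lam H τp d δ ρ r τ hs h0 h1 hII
  obtain ⟨hρK, hdK, -⟩ := hdir _ _ _ _ _ _ _ _ _ _ hs h0 h1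
  obtain ⟨u, v, hd, hu, huv, hv, huH⟩ := hs.exists_split hb
  have hcn := norm_nonneg (c x)
  have hv' : ‖v‖ ≤ 2 / σ * ‖c x‖ := by
    rw [div_mul_eq_mul_div, le_div_iff₀ hσ]
    have := hII.1
    nlinarith
  have hpy : ‖d‖ ^ 2 = ‖u‖ ^ 2 + ‖v‖ ^ 2 := by
    rw [hd, norm_add_sq_real, huv]; ring
  have hun : ‖u‖ ≤ ‖d‖ := by
    refine (sq_le_sq₀ (norm_nonneg _) (norm_nonneg _)).1 ?_
    nlinarith [sq_nonneg ‖v‖]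
  have hvn : ‖v‖ ≤ ‖d‖ := by
    refine (sq_le_sq₀ (norm_nonneg _) (norm_nonneg _)).1 ?_
    nlinarith [sq_nonneg ‖u‖]
  have hgv : inner ℝ (gradient φ x) v ≤ M * ‖v‖ :=
    (real_inner_le_norm _ _).trans (mul_le_mul_of_nonneg_right hs.grad_le (norm_nonneg _))
  have hur : inner ℝ u ρ ≤ K * ‖c x‖ := by
    refine (real_inner_le_norm _ _).trans ?_
    refine mul_le_mul (hun.trans hdK) ?_ (norm_nonneg _) hK
    have := hII.2
    nlinarith
  -- The tangential term uᵀg is the dangerous one, as it need not vanish with the constraint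
  -- violation. It cancels against uᵀHd = uᵀρ - uᵀg, leaving only terms linear in ‖v‖ and ‖c‖, which
  -- are O(‖c‖) under conditions II.
  have hgd : inner ℝ (gradient φ x) d = inner ℝ (gradient φ x) v + inner ℝ u (gradient φ x) := by
    conv_lhs => rw [hd]
    rw [inner_add_right, real_inner_comm u]; ring
  have hvH : inner ℝ v (H d) ≤ ‖v‖ * (κH * K) :=
    (real_inner_le_norm _ _).trans (mul_le_mul_of_nonneg_left
      ((hs.hess_le d).trans (mul_le_mul_of_nonneg_left hdK hκH.le)) (norm_nonneg _))
  have huv' : -inner ℝ u (H v) ≤ ‖v‖ * (κH * K) := by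
    refine (neg_le_abs _).trans ((abs_real_inner_le_norm _ _).trans ?_)
    have := mul_le_mul (hun.trans hdK) (hs.hess_le v) (norm_nonneg _) hK
    linarith
  have hcl := norm_le_l1 (c x)
  have hfin : M * ‖v‖ + K * ‖c x‖ + ‖v‖ * ((2 * κH + 1) * K) ≤
      ((M + (2 * κH + 1) * K + 1) * (2 / σ) + K) * l1 (c x) := by
    have e1 : (M + (2 * κH + 1) * K) * ‖v‖ ≤ (M + (2 * κH + 1) * K + 1) * (2 / σ * l1 (c x)) := by
      apply mul_le_mul _ (hv'.trans (mul_le_mul_of_nonneg_left hcl (by positivity)))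
        (norm_nonneg _) (by positivity)
      linarith
    have e2 := mul_le_mul_of_nonneg_left hcl hK
    nlinarith
  refine le_trans ?_ hfin
  have hvK : 0 ≤ ‖v‖ * K := mul_nonneg (norm_nonneg _) hK
  have hvK' : 0 ≤ ‖v‖ * (κH * K) := by positivity
  unfold curv
  rw [← max_add_add_left]
  refine max_le ?_ ?_
  · have hdd : inner ℝ d (H d) = inner ℝ u (H d) + inner ℝ v (H d) := by
      conv_lhs => rw [hd]
      rw [inner_add_left, ← hd]
    rw [hgd, hdd, huH]
    linarith
  · have e1 := hs.hess_pos u hu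
    have e2 : inner ℝ u (H d) = inner ℝ u (H u) + inner ℝ u (H v) := by
      conv_lhs => rw [hd]
      rw [map_add, inner_add_right]
    -- The assumption ε_d ≤ μ_H enters here: it lets uᵀHu absorb the tangential part of ε_d‖d‖².
    have e3 : prm.εd * ‖u‖ ^ 2 ≤ μH * ‖u‖ ^ 2 := mul_le_mul_of_nonneg_right hεd (sq_nonneg _)
    have e4 : prm.εd * ‖v‖ ^ 2 ≤ ‖v‖ * K := by
      have : ‖v‖ ^ 2 ≤ ‖v‖ * K := by
        rw [sq]; exact mul_le_mul_of_nonneg_left (hvn.trans hdK) (norm_nonneg _)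
      nlinarith [sq_nonneg ‖v‖]
    rw [hgd, hpy]
    linarith

/-! ### Merit parameter and model reduction. -/

/-- The merit parameter does not increase, and stays above a positive constant. -/
theorem exists_merit_lower_bound (prm : Params) (hκH : 0 < κH) (hμH : 0 < μH) (hM : 0 ≤ M)
    (hεd : prm.εd ≤ μH) (hεfeas : Real.sqrt m * prm.εfeas < 1)
    (hb : ConstraintBounds c χ σ κc κJ) :
    ∃ t : ℝ, 0 < t ∧ t ≤ prm.τbar ∧ ∀ φ x lam H τp d δ ρ r τ,
      Step prm κH μH M c χ φ x lam H τp d δ ρ r τ → t ≤ τp → τp ≤ prm.τbar →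
      t ≤ τ ∧ τ ≤ τp := by
  obtain ⟨K, hK, hq⟩ := exists_model_bound prm hκH hμH hM hεd hb
  obtain ⟨hσ1, hσ2⟩ := prm.hεσ
  obtain ⟨hτ1, hτ2⟩ := prm.hετ
  set s := 1 - Real.sqrt m * prm.εfeas with hs'
  have hspos : 0 < s := by linarith
  set t0 := (1 - prm.ετ) * ((1 - prm.εσ) * s / K) with ht0
  have h1τ : 0 < 1 - prm.ετ := by linarith
  have h1σ : 0 < 1 - prm.εσ := by linarith
  have ht0pos : 0 < t0 := by positivity
  -- The value t0 bounds every reduced parameter (1 - ε_τ)τ^trial from below. The minimum with τ̄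
  -- makes the threshold valid at the start of an inner loop, where the parameter is τ̄.
  refine ⟨min prm.τbar t0, lt_min prm.hτbar ht0pos, min_le_left _ _, ?_⟩
  intro φ x lam H τp d δ ρ r τ hs h0 h1
  have hp : 0 ≤ τp := (lt_min prm.hτbar ht0pos).le.trans h0
  rcases hs.accept with ⟨hII, rfl⟩ | ⟨-, rfl⟩
  · have hqb := hq _ _ _ _ _ _ _ _ _ _ hs hp h1 hII
    have hl := l1_sub_l1_ge hII
    unfold meritUpdate
    simp only
    split_ifs with hq0 hle
    · exact ⟨h0, le_rfl⟩
    · exact ⟨h0, le_rfl⟩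
    · push Not at hq0 hle
      set q := inner ℝ (gradient φ x) d + curv prm H d
      have hfrac : (1 - prm.εσ) * s / K ≤ (1 - prm.εσ) * (l1 (c x) - l1 r) / q := by
        rw [div_le_div_iff₀ hK hq0]
        calc (1 - prm.εσ) * s * q ≤ (1 - prm.εσ) * s * (K * l1 (c x)) := by gcongr
          _ = (1 - prm.εσ) * (s * l1 (c x)) * K := by ring
          _ ≤ _ := by gcongr
      have hfrac0 : 0 ≤ (1 - prm.εσ) * (l1 (c x) - l1 r) / q :=
        le_trans (by positivity) hfrac
      refine ⟨(min_le_right _ _).trans (mul_le_mul_of_nonneg_left hfrac h1τ.le), ?_⟩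
      nlinarith
  · exact ⟨h0, le_rfl⟩

/-- The model reduction at the new merit parameter dominates `‖c(x)‖ + ‖d‖²`. -/
theorem exists_deltaL_lower_bound (prm : Params) (hεfeas : Real.sqrt m * prm.εfeas < 1)
    {t : ℝ} (ht : 0 < t) :
    ∃ κ : ℝ, 0 < κ ∧ ∀ (φ : E n → ℝ) x lam H τp d δ ρ r τ,
      Step prm κH μH M c χ φ x lam H τp d δ ρ r τ → t ≤ τ →
      κ * (‖c x‖ + ‖d‖ ^ 2) ≤ deltaL φ c x τ d := by
  obtain ⟨hσ1, hσ2⟩ := prm.hεσ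
  obtain ⟨hf1, hf2⟩ := prm.hεfeas
  obtain ⟨hd1, hd2⟩ := prm.hεd
  set s := 1 - Real.sqrt m * prm.εfeas with hs'
  have hspos : 0 < s := by linarith
  have h1f : 0 < 1 - prm.εfeas := by linarith
  -- The first pair of entries serves conditions II and the second pair conditions I.
  set κ := min (min (t * prm.εd) (prm.εσ * s))
    (min (prm.εσ * (1 - prm.εfeas)) (prm.εσ * (1 - prm.εfeas) * (t * prm.εd))) with hκ
  have k1 : κ ≤ t * prm.εd := (min_le_left _ _).trans (min_le_left _ _)
  have k2 : κ ≤ prm.εσ * s := (min_le_left _ _).trans (min_le_right _ _)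
  have k3 : κ ≤ prm.εσ * (1 - prm.εfeas) := (min_le_right _ _).trans (min_le_left _ _)
  have k4 : κ ≤ prm.εσ * (1 - prm.εfeas) * (t * prm.εd) :=
    (min_le_right _ _).trans (min_le_right _ _)
  have hκpos : 0 < κ := by
    refine lt_min (lt_min ?_ ?_) (lt_min ?_ ?_) <;> positivity
  refine ⟨κ, hκpos, ?_⟩
  intro φ x lam H τp d δ ρ r τ hs hτ
  have hcl := norm_le_l1 (c x)
  have hd0 := sq_nonneg ‖d‖
  have hw : t * prm.εd * ‖d‖ ^ 2 ≤ τ * curv prm H d := by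
    rw [mul_assoc]
    exact mul_le_mul hτ (le_curv prm H d) (by positivity) (ht.le.trans hτ)
  have hc1 : κ * ‖c x‖ ≤ κ * l1 (c x) := mul_le_mul_of_nonneg_left hcl hκpos.le
  rcases hs.accept with ⟨hII, hτe⟩ | ⟨⟨hI, -, -⟩, rfl⟩
  · rw [hs.deltaL_eq]
    have hl := l1_sub_l1_ge hII
    -- All branches of the update guarantee τq ≤ (1 - ε_σ)(‖c‖₁ - ‖r‖₁). The remaining fraction ε_σ
    -- of the linearized reduction becomes the lower bound in ‖c‖.
    have key : τ * curv prm H d + prm.εσ * (l1 (c x) - l1 r) ≤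
        -τ * inner ℝ (gradient φ x) d + l1 (c x) - l1 r := by
      have hl0 : 0 ≤ l1 (c x) - l1 r := le_trans (mul_nonneg hspos.le (l1_nonneg _)) hl
      have hq : τ * (inner ℝ (gradient φ x) d + curv prm H d) ≤
          (1 - prm.εσ) * (l1 (c x) - l1 r) := by
        have hr0 : 0 ≤ (1 - prm.εσ) * (l1 (c x) - l1 r) := mul_nonneg (by linarith) hl0
        unfold meritUpdate at hτe
        simp only at hτe
        split_ifs at hτe with hq0 hle
        · exact (mul_nonpos_of_nonneg_of_nonpos (ht.le.trans hτ) hq0).trans hr0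
        · push Not at hq0
          rw [← le_div_iff₀ hq0, hτe]; exact hle
        · push Not at hq0
          rw [← le_div_iff₀ hq0, hτe]
          have := div_nonneg hr0 hq0.le
          have h2 := prm.hετ.1
          nlinarith
      linarith
    have e1 := mul_le_mul_of_nonneg_right k1 hd0
    have e2 := mul_le_mul_of_nonneg_right k2 (l1_nonneg (c x))
    have e3 := mul_le_mul_of_nonneg_left hl hσ1.le
    linarith
  · refine le_trans ?_ hI
    have e1 := mul_le_mul_of_nonneg_right k4 hd0
    have e2 := mul_le_mul_of_nonneg_right k3 (l1_nonneg (c x))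
    have e3 : prm.εσ * (1 - prm.εfeas) * l1 (c x) ≤
        prm.εσ * (1 - prm.εfeas) * max (l1 (c x)) (‖r‖ - l1 (c x)) :=
      mul_le_mul_of_nonneg_left (le_max_left _ _) (by positivity)
    have e4 := mul_le_mul_of_nonneg_left hw (mul_pos hσ1 h1f).le
    linarith

/-! ### Taylor estimates along a step. -/

/-- First-order Taylor estimate on a convex set where the derivative is Lipschitz. -/
theorem norm_taylor_le {V W : Type*} [NormedAddCommGroup V] [NormedSpace ℝ V]
    [NormedAddCommGroup W] [NormedSpace ℝ W] {g : V → W} {s : Set V} {L : ℝ} (hL : 0 ≤ L)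
    (hs : Convex ℝ s) (hg : Differentiable ℝ g) {x y : V} (hx : x ∈ s) (hy : y ∈ s)
    (hlip : ∀ z ∈ s, ‖fderiv ℝ g z - fderiv ℝ g x‖ ≤ L * ‖z - x‖) :
    ‖g y - g x - fderiv ℝ g x (y - x)‖ ≤ L * ‖y - x‖ ^ 2 := by
  -- The mean value inequality on the segment, with the derivative increment bounded by L‖y - x‖
  -- throughout, gives L instead of L/2. The factor is immaterial.
  have h := (convex_segment x y).norm_image_sub_le_of_norm_hasFDerivWithin_le'
    (f := g) (f' := fderiv ℝ g) (φ := fderiv ℝ g x) (C := L * ‖y - x‖)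
    (fun z _ => (hg z).hasFDerivAt.hasFDerivWithinAt)
    (fun z hz => (hlip z (hs.segment_subset hx hy hz)).trans (by
      gcongr
      obtain ⟨t, ht, rfl⟩ := (segment_eq_image' ℝ x y ▸ hz : z ∈ _ '' _)
      rw [add_sub_cancel_left, norm_smul, Real.norm_eq_abs, abs_of_nonneg ht.1]
      exact mul_le_of_le_one_left (norm_nonneg _) ht.2))
    (left_mem_segment ℝ x y) (right_mem_segment ℝ x y)
  rw [sq, ← mul_assoc]; exact h

theorem norm_fderiv_sub_eq {φ : E n → ℝ} (y z : E n) :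
    ‖fderiv ℝ φ y - fderiv ℝ φ z‖ = ‖gradient φ y - gradient φ z‖ := by
  unfold gradient
  rw [← map_sub, LinearIsometryEquiv.norm_map]

theorem fderiv_apply_eq_inner {φ : E n → ℝ} (x d : E n) :
    fderiv ℝ φ x d = inner ℝ (gradient φ x) d := by
  unfold gradient
  simp

/-- The merit function decreases sufficiently for all small step sizes. -/
theorem exists_armijo_threshold (prm : Params) {D : Set (E n)} (hc : ConstraintAssumptions c χ D)
    (L : ℝ≥0) {κ : ℝ} (hκ : 0 < κ) :
    ∃ α₀ : ℝ, 0 < α₀ ∧ ∀ (φ : E n → ℝ) x τ d α, ContDiff ℝ 1 φ →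
      LipschitzOnWith L (gradient φ) D → x ∈ χ → 0 ≤ τ → τ ≤ prm.τbar →
      κ * ‖d‖ ^ 2 ≤ deltaL φ c x τ d → 0 ≤ α → α ≤ 1 → α ≤ α₀ → x + α • d ∈ D →
      Armijo prm φ c x τ d α := by
  obtain ⟨LJ, hLJ⟩ := hc.lipschitz
  obtain ⟨hη1, hη2⟩ := prm.hη
  have hτ := prm.hτbar
  -- The summand 1 only ensures that Λ is positive, so that dividing by it is safe.
  set Λ : ℝ := prm.τbar * L + Real.sqrt m * LJ + 1 with hΛ
  have hΛpos : 0 < Λ := by positivity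
  have h1η : 0 < 1 - prm.η := by linarith
  refine ⟨(1 - prm.η) * κ / Λ, by positivity, ?_⟩
  intro φ x τ d α hφ hL hx h0 h1 hdl hα0 hα1 hα hD
  have hxD := hc.subset hx
  have t1 := norm_taylor_le (g := φ) (L := L) L.2 hc.convexD (hφ.differentiable (by norm_num))
    hxD hD (fun z hz => by
      rw [norm_fderiv_sub_eq]
      exact hL.norm_sub_le hz hxD)
  have t2 := norm_taylor_le (g := c) (L := LJ) LJ.2 hc.convexD
    (hc.smooth.differentiable (by norm_num)) hxD hD (fun z hz => hLJ.norm_sub_le hz hxD)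
  rw [add_sub_cancel_left] at t1 t2
  rw [map_smul, norm_smul, Real.norm_eq_abs, Real.norm_eq_abs, abs_of_nonneg hα0] at t1
  rw [map_smul, norm_smul, Real.norm_eq_abs, abs_of_nonneg hα0] at t2
  rw [fderiv_apply_eq_inner, smul_eq_mul] at t1
  have f1 := (le_abs_self _).trans t1
  set R := c (x + α • d) - c x - α • fderiv ℝ c x d with hR
  have f2 : l1 (c (x + α • d)) ≤ (1 - α) * l1 (c x) + α * l1 (c x + jac c x d) + l1 R := by
    -- The linearization c + αJd is a convex combination of c and c + Jd, so convexity of the ℓ₁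
    -- norm produces exactly the model reduction times α.
    have e : c (x + α • d) = ((1 - α) • c x + α • (c x + jac c x d)) + R := by
      rw [hR]; unfold jac; module
    calc l1 (c (x + α • d)) = _ := congrArg l1 e
      _ ≤ l1 ((1 - α) • c x + α • (c x + jac c x d)) + l1 R := l1_add_le _ _
      _ ≤ l1 ((1 - α) • c x) + l1 (α • (c x + jac c x d)) + l1 R := by
          gcongr; exact l1_add_le _ _
      _ = _ := by rw [l1_smul, l1_smul, abs_of_nonneg hα0, abs_of_nonneg (by linarith)]
  have f3 : l1 R ≤ Real.sqrt m * (LJ * (α * ‖d‖) ^ 2) :=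
    (l1_le_sqrt_mul_norm R).trans (mul_le_mul_of_nonneg_left t2 (Real.sqrt_nonneg _))
  have f4 : τ * (L * (α * ‖d‖) ^ 2) ≤ prm.τbar * (L * (α * ‖d‖) ^ 2) := by gcongr
  -- The second-order remainder is absorbed by the unused fraction 1 - η of the predicted reduction;
  -- this step fixes the threshold (1 - η)κ/Λ.
  have f5 : Λ * (α * ‖d‖) ^ 2 ≤ (1 - prm.η) * α * deltaL φ c x τ d := by
    rw [le_div_iff₀ hΛpos] at hα
    calc Λ * (α * ‖d‖) ^ 2 = (α * Λ) * (α * ‖d‖ ^ 2) := by ring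
      _ ≤ ((1 - prm.η) * κ) * (α * ‖d‖ ^ 2) := by gcongr
      _ = (1 - prm.η) * α * (κ * ‖d‖ ^ 2) := by ring
      _ ≤ _ := by gcongr
  have f6 := mul_le_mul_of_nonneg_left f1 h0
  have f7 : 0 ≤ (α * ‖d‖) ^ 2 := sq_nonneg _
  unfold Armijo merit
  unfold deltaL at f5 ⊢
  rw [hΛ] at f5
  nlinarith

/-- Change of the gradient of the Lagrangian along a step. -/
theorem Step.norm_gradLag_next_le (hs : Step prm κH μH M c χ φ x lam H τp d δ ρ r τ)
    {D : Set (E n)} {L LJ : ℝ≥0} (hκH : 0 ≤ κH) (hL : LipschitzOnWith L (gradient φ) D)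
    (hLJ : LipschitzOnWith LJ (jac c) D)
    (hx : x ∈ D) {α : ℝ} (h0 : 0 ≤ α) (h1 : α ≤ 1) (hx' : x + α • d ∈ D) {Λ : ℝ}
    (hΛ : ‖lam + α • δ‖ ≤ Λ) :
    ‖gradLag φ c (x + α • d) (lam + α • δ)‖ ≤
      (1 - α) * ‖gradLag φ c x lam‖ + α * ((κH + 1 + L + LJ * Λ) * (‖c x‖ + ‖d‖)) := by
  have hΛ0 : 0 ≤ Λ := (norm_nonneg _).trans hΛ
  -- Substituting Jᵀδ from the linear system damps the old Lagrangian gradient by 1 - α. What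
  -- remains is α(-Hd + ρ) and the changes of g and Jᵀ, all of size α(‖c‖ + ‖d‖).
  have e : gradLag φ c (x + α • d) (lam + α • δ) = (1 - α) • gradLag φ c x lam + α • (-H d + ρ)
      + (gradient φ (x + α • d) - gradient φ x)
      + (jacT c (x + α • d) - jacT c x) (lam + α • δ) := by
    have h := hs.solve.1
    have h' : jacT c x δ = -H d + ρ - gradLag φ c x lam := by
      rw [← sub_eq_zero] at h ⊢
      rw [← h]; abel
    have h2 : (jacT c x) (lam + α • δ) = jacT c x lam + α • (-H d + ρ - gradLag φ c x lam) := by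
      rw [map_add, map_smul, h']
    rw [sub_apply, h2]
    have h3 : gradient φ x = gradLag φ c x lam - jacT c x lam := by unfold gradLag; abel
    rw [h3]
    conv_lhs => unfold gradLag
    module
  have n1 : ‖gradient φ (x + α • d) - gradient φ x‖ ≤ L * (α * ‖d‖) := by
    have := hL.norm_sub_le hx' hx
    rwa [add_sub_cancel_left, norm_smul, Real.norm_eq_abs, abs_of_nonneg h0] at this
  have n2 : ‖(jacT c (x + α • d) - jacT c x) (lam + α • δ)‖ ≤ LJ * (α * ‖d‖) * Λ := by
    have := hLJ.norm_sub_le hx' hx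
    rw [add_sub_cancel_left, norm_smul, Real.norm_eq_abs, abs_of_nonneg h0] at this
    refine (ContinuousLinearMap.le_opNorm _ _).trans ?_
    have h4 : ‖jacT c (x + α • d) - jacT c x‖ = ‖jac c (x + α • d) - jac c x‖ := by
      unfold jacT; rw [← map_sub, LinearIsometryEquiv.norm_map]
    rw [h4]
    exact mul_le_mul this hΛ (norm_nonneg _) (by positivity)
  have n3 : ‖α • (-H d + ρ)‖ ≤ α * (κH * ‖d‖ + (‖c x‖ + ‖d‖)) := by
    rw [norm_smul, Real.norm_eq_abs, abs_of_nonneg h0]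
    refine mul_le_mul_of_nonneg_left ((norm_add_le _ _).trans ?_) h0
    rw [norm_neg]
    exact add_le_add (hs.hess_le d) hs.norm_residual_le
  have n4 : ‖(1 - α) • gradLag φ c x lam‖ = (1 - α) * ‖gradLag φ c x lam‖ := by
    rw [norm_smul, Real.norm_eq_abs, abs_of_nonneg (by linarith)]
  rw [e]
  refine (norm_add₃_le.trans (add_le_add_left (add_le_add_left (norm_add_le _ _) _) _)).trans ?_
  rw [n4]
  have hcn := norm_nonneg (c x)
  have hdn := norm_nonneg d
  have : 0 ≤ α * (κH + L + LJ * Λ) * ‖c x‖ := by positivity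
  nlinarith

end RASQP

namespace RASQP

variable {n m : ℕ} {prm : Params} {κH μH M : ℝ} {L : ℝ≥0} {χ D : Set (E n)}
  {σ κc κJ : ℝ}

/-! ### Runs of the inner loop -/

/-- Constants that are valid for every SQP iteration. -/
structure StepConstants (prm : Params) (κH μH M : ℝ) (L : ℝ≥0) (c : E n → E m)
    (χ D : Set (E n)) (K t κ α₀ : ℝ) : Prop where
  K_nonneg : 0 ≤ K
  t_pos : 0 < t
  t_le : t ≤ prm.τbar
  κ_pos : 0 < κ
  α₀_pos : 0 < α₀
  mult_le : ∀ φ x lam H τp d δ ρ r τ, Step prm κH μH M c χ φ x lam H τp d δ ρ r τ → 0 ≤ τp →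
    τp ≤ prm.τbar → ‖lam + δ‖ ≤ K
  merit : ∀ φ x lam H τp d δ ρ r τ, Step prm κH μH M c χ φ x lam H τp d δ ρ r τ → t ≤ τp →
    τp ≤ prm.τbar → t ≤ τ ∧ τ ≤ τp
  model : ∀ φ x lam H τp d δ ρ r τ, Step prm κH μH M c χ φ x lam H τp d δ ρ r τ → t ≤ τ →
    κ * (‖c x‖ + ‖d‖ ^ 2) ≤ deltaL φ c x τ d
  armijo : ∀ (φ : E n → ℝ) x τ d α, ContDiff ℝ 1 φ →
    LipschitzOnWith L (gradient φ) D → x ∈ χ → 0 ≤ τ → τ ≤ prm.τbar →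
    κ * ‖d‖ ^ 2 ≤ deltaL φ c x τ d → 0 ≤ α → α ≤ 1 → α ≤ α₀ → x + α • d ∈ D →
    Armijo prm φ c x τ d α

/-- The constants are chosen in a fixed order: t from the trial values of the merit parameter, κ
from t, and α₀ from κ. -/
theorem exists_stepConstants {c : E n → E m} (hc : ConstraintAssumptions c χ D) (prm : Params)
    (hκH : 0 < κH) (hμH : 0 < μH) (hεd : prm.εd ≤ μH)
    (hεfeas : Real.sqrt m * prm.εfeas < 1) (hM : 0 ≤ M) (L : ℝ≥0) :
    ∃ K t κ α₀, StepConstants prm κH μH M L c χ D K t κ α₀ := by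
  obtain ⟨σ, κc, κJ, hb⟩ := exists_constraintBounds hc
  obtain ⟨K, hK, hdir⟩ := exists_direction_bound prm hκH hμH hM hb
  obtain ⟨t, ht, htb, hmerit⟩ := exists_merit_lower_bound prm hκH hμH hM hεd hεfeas hb
  obtain ⟨κ, hκ, hmodel⟩ :=
    exists_deltaL_lower_bound (κH := κH) (μH := μH) (M := M) (c := c) (χ := χ) prm hεfeas ht
  obtain ⟨α₀, hα₀, harm⟩ := exists_armijo_threshold prm hc L hκ
  exact ⟨K, t, κ, α₀, hK, ht, htb, hκ, hα₀,
    fun φ x lam H τp d δ ρ r τ hs h0 h1 => (hdir φ x lam H τp d δ ρ r τ hs h0 h1).2.2,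
    hmerit, hmodel, harm⟩

/-- A run whose subsampled objectives are uniformly smooth. -/
structure SmoothRun (prm : Params) (κH μH M : ℝ) (L : ℝ≥0) (χ D : Set (E n))
    (I : Input n m) (tr : Trace n m) : Prop where
  run : IsRun prm I tr
  asm : RunAssumptions prm κH μH χ D I tr
  smooth : ∀ k, ContDiff ℝ 1 (I.Φ k)
  sub : ∀ k, SubsampledSmooth L M χ D (I.Φ k)
  par : ∀ k, 0 ≤ I.γ k ∧ I.γ k < 1 ∧ 0 ≤ I.ε k

variable {I : Input n m} {tr : Trace n m} {k j : ℕ} {K t κ α₀ : ℝ}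

theorem Reached.prev (h : Reached I tr k (j + 1)) : Active I tr k j ∧ tr.ls k j ≠ ⊤ := by
  cases h with
  | inner _ _ h1 h2 h3 => exact ⟨⟨h1, h2⟩, h3⟩

theorem Reached.of_le {i : ℕ} (h : Reached I tr k j) (hij : i ≤ j) : Reached I tr k i := by
  induction j with
  | zero => rwa [Nat.le_zero.1 hij]
  | succ j ih =>
    rcases Nat.le_succ_iff.1 hij with h1 | rfl
    · exact ih h.prev.1.1 h1
    · exact h

theorem Reached.active_of_lt {i : ℕ} (h : Reached I tr k j) (hij : i < j) : Active I tr k i :=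
  (h.of_le hij).prev.1

namespace SmoothRun

/-- Exact solutions satisfy conditions II with ρ = 0 and r = 0, so only two acceptance alternatives
remain. -/
theorem step (hR : SmoothRun prm κH μH M L χ D I tr) (h : Active I tr k j) :
    Step prm κH μH M I.c χ (I.Φ k) (tr.x k j) (tr.lam k j) (tr.H k j) (tauPrev prm tr k j)
      (tr.d k j) (tr.δ k j) (tr.ρ k j) (tr.r k j) (tr.τ k j) where
  mem := hR.asm.iterates k j h.1
  grad_le := (hR.sub k).2 _ (hR.asm.iterates k j h.1)
  solve := hR.run.solve k j h
  accept := by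
    rcases hR.run.accept k j h with ⟨⟨h1, h2⟩ | h1, h3⟩ | h1
    · refine Or.inl ⟨⟨?_, ?_⟩, h3⟩
      · rw [h2, norm_zero]; exact mul_nonneg prm.hεfeas.1.le (norm_nonneg _)
      · rw [h1, norm_zero]; exact mul_nonneg prm.hεopt.1.le (norm_nonneg _)
    · exact Or.inl ⟨h1, h3⟩
    · exact Or.inr h1
  hess_le u := (norm_apply_le_frob _ u).trans
    (mul_le_mul_of_nonneg_right (hR.asm.hessBound k j h) (norm_nonneg _))
  hess_pos := hR.asm.hessPos k j h

/-- The interval from t to τ̄ is invariant under the merit update, and the reset value τ̄ lies in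
it; hence t works in all outer iterations at once. -/
theorem tauPrev_mem (hR : SmoothRun prm κH μH M L χ D I tr)
    (hs : StepConstants prm κH μH M L I.c χ D K t κ α₀) (h : Reached I tr k j) :
    t ≤ tauPrev prm tr k j ∧ tauPrev prm tr k j ≤ prm.τbar := by
  induction j with
  | zero => exact ⟨hs.t_le, le_rfl⟩
  | succ j ih =>
    have hact := h.prev.1
    obtain ⟨h1, h2⟩ := ih hact.1
    obtain ⟨h3, h4⟩ := hs.merit _ _ _ _ _ _ _ _ _ _ (hR.step hact) h1 h2
    exact ⟨h3, h4.trans h2⟩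

theorem tau_mem (hR : SmoothRun prm κH μH M L χ D I tr)
    (hs : StepConstants prm κH μH M L I.c χ D K t κ α₀) (h : Active I tr k j) :
    t ≤ tr.τ k j ∧ tr.τ k j ≤ tauPrev prm tr k j :=
  hs.merit _ _ _ _ _ _ _ _ _ _ (hR.step h) (hR.tauPrev_mem hs h.1).1 (hR.tauPrev_mem hs h.1).2

theorem model_le (hR : SmoothRun prm κH μH M L χ D I tr)
    (hs : StepConstants prm κH μH M L I.c χ D K t κ α₀) (h : Active I tr k j) :
    κ * (‖I.c (tr.x k j)‖ + ‖tr.d k j‖ ^ 2) ≤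
      deltaL (I.Φ k) I.c (tr.x k j) (tr.τ k j) (tr.d k j) :=
  hs.model _ _ _ _ _ _ _ _ _ _ (hR.step h) (hR.tau_mem hs h).1

theorem armijo_of_le (hR : SmoothRun prm κH μH M L χ D I tr)
    (hs : StepConstants prm κH μH M L I.c χ D K t κ α₀) (h : Active I tr k j) {i : ℕ}
    (hi : (i : ℕ∞) ≤ tr.ls k j) (hα : prm.εα ^ i ≤ α₀) :
    Armijo prm (I.Φ k) I.c (tr.x k j) (tr.τ k j) (tr.d k j) (prm.εα ^ i) := by
  obtain ⟨h1, h2⟩ := hR.tau_mem hs h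
  refine hs.armijo _ _ _ _ _ (hR.smooth k) (hR.sub k).1 (hR.asm.iterates k j h.1)
    (hs.t_pos.le.trans h1) (h2.trans (hR.tauPrev_mem hs h.1).2) ?_ (pow_nonneg prm.hεα.1.le _)
    (pow_le_one₀ prm.hεα.1.le prm.hεα.2.le) hα (hR.asm.trials k j h i hi)
  refine le_trans ?_ (hR.model_le hs h)
  exact mul_le_mul_of_nonneg_left (by linarith [norm_nonneg (I.c (tr.x k j))]) hs.κ_pos.le

/-- If no step were accepted, all trial points would lie in D, and the Armijo condition would hold
as soon as a power of ε_α falls below α₀. -/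
theorem ls_ne_top (hR : SmoothRun prm κH μH M L χ D I tr)
    (hs : StepConstants prm κH μH M L I.c χ D K t κ α₀) (h : Active I tr k j) :
    tr.ls k j ≠ ⊤ := by
  intro htop
  obtain ⟨i, hi⟩ := exists_pow_lt_of_lt_one hs.α₀_pos prm.hεα.2
  refine (hR.run.search k j h i).1 ?_ (hR.armijo_of_le hs h ?_ hi.le)
  · rw [htop]; exact ENat.natCast_lt_top i
  · rw [htop]; exact le_top

/-- An SQP iteration makes a step whose size is bounded away from zero. -/
theorem exists_stepSize (hR : SmoothRun prm κH μH M L χ D I tr)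
    (hs : StepConstants prm κH μH M L I.c χ D K t κ α₀) (h : Active I tr k j) :
    ∃ α, min 1 (prm.εα * α₀) ≤ α ∧ α ≤ 1 ∧ tr.x k (j + 1) = tr.x k j + α • tr.d k j ∧
      tr.lam k (j + 1) = tr.lam k j + α • tr.δ k j ∧
      Armijo prm (I.Φ k) I.c (tr.x k j) (tr.τ k j) (tr.d k j) α := by
  obtain ⟨i, hi⟩ := ENat.ne_top_iff_exists.1 (hR.ls_ne_top hs h)
  obtain ⟨h1, h2⟩ := hR.run.update k j h i hi.symm
  refine ⟨prm.εα ^ i, ?_, pow_le_one₀ prm.hεα.1.le prm.hεα.2.le, h1, h2,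
    (hR.run.search k j h i).2 hi.symm⟩
  -- Either the full step is taken, or the preceding trial size was rejected and therefore exceeds
  -- α₀, which leaves at least ε_α α₀.
  cases i with
  | zero => simp
  | succ i =>
    refine (min_le_right _ _).trans ?_
    rw [pow_succ']
    refine mul_le_mul_of_nonneg_left ?_ prm.hεα.1.le
    by_contra! hlt
    have hlt' : (i : ℕ∞) < tr.ls k j := by
      rw [← hi]; exact_mod_cast Nat.lt_succ_self i
    exact (hR.run.search k j h i).1 hlt' (hR.armijo_of_le hs h hlt'.le hlt.le)

theorem reached_succ (hR : SmoothRun prm κH μH M L χ D I tr)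
    (hs : StepConstants prm κH μH M L I.c χ D K t κ α₀) (h : Active I tr k j) :
    Reached I tr k (j + 1) := Reached.inner k j h.1 h.2 (hR.ls_ne_top hs h)

/-- The new multiplier is a convex combination of the old one and λ + δ, and the latter is bounded
by K whatever λ is. Thus multipliers cannot drift within an inner loop. -/
theorem norm_lam_le (hR : SmoothRun prm κH μH M L χ D I tr)
    (hs : StepConstants prm κH μH M L I.c χ D K t κ α₀) (h : Reached I tr k j) :
    ‖tr.lam k j‖ ≤ max ‖tr.lam k 0‖ K := by
  induction j with
  | zero => exact le_max_left _ _
  | succ j ih =>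
    have hact := h.prev.1
    obtain ⟨α, hα0, hα1, -, hlam, -⟩ := hR.exists_stepSize hs hact
    have hα : 0 ≤ α := le_trans
      (le_min zero_le_one (mul_nonneg prm.hεα.1.le hs.α₀_pos.le)) hα0
    obtain ⟨ht1, ht2⟩ := hR.tauPrev_mem hs hact.1
    have hK := hs.mult_le _ _ _ _ _ _ _ _ _ _ (hR.step hact) (hs.t_pos.le.trans ht1) ht2
    have e : tr.lam k (j + 1) = (1 - α) • tr.lam k j + α • (tr.lam k j + tr.δ k j) := by
      rw [hlam]; module
    rw [e]
    have h1 := ih hact.1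
    have h2 := hK.trans (le_max_right ‖tr.lam k 0‖ K)
    calc _ ≤ (1 - α) * ‖tr.lam k j‖ + α * ‖tr.lam k j + tr.δ k j‖ := by
          refine (norm_add_le _ _).trans (le_of_eq ?_)
          rw [norm_smul, norm_smul, Real.norm_eq_abs, Real.norm_eq_abs, abs_of_nonneg hα,
            abs_of_nonneg (by linarith)]
      _ ≤ (1 - α) * max ‖tr.lam k 0‖ K + α * max ‖tr.lam k 0‖ K := by
          gcongr
      _ = _ := by ring

end SmoothRun

/-! ### Summability of the squared KKT residuals. -/

theorem abs_sub_le_of_grad_le {φ : E n → ℝ} (hφ : ContDiff ℝ 1 φ) (hχ : Convex ℝ χ)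
    (hM : ∀ x ∈ χ, ‖gradient φ x‖ ≤ M) {x y : E n} (hx : x ∈ χ) (hy : y ∈ χ) :
    |φ y - φ x| ≤ M * ‖y - x‖ := by
  have := hχ.norm_image_sub_le_of_norm_fderiv_le (f := φ) (C := M)
    (fun z _ => hφ.differentiable (by norm_num) z)
    (fun z hz => by
      have h2 : ‖fderiv ℝ φ z‖ = ‖gradient φ z‖ := by
        unfold gradient; rw [LinearIsometryEquiv.norm_map]
      rw [h2]; exact hM z hz) hx hy
  exact this

namespace SmoothRun

/-- The merit function decrease bounds the sum of the constraint violations and of the squared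
step lengths. -/
theorem sum_step_le (hR : SmoothRun prm κH μH M L χ D I tr) (hM : 0 ≤ M)
    (hs : StepConstants prm κH μH M L I.c χ D K t κ α₀) (hc : ConstraintAssumptions I.c χ D)
    (hb : ConstraintBounds I.c χ σ κc κJ) (h : Reached I tr k j) :
    ∑ i ∈ Finset.range j, prm.η * min 1 (prm.εα * α₀) * κ *
      (‖I.c (tr.x k i)‖ + ‖tr.d k i‖ ^ 2) ≤
        prm.τbar * (M * Metric.diam χ) + Real.sqrt m * κc := by
  have hα₀ : 0 ≤ min 1 (prm.εα * α₀) :=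
    le_min zero_le_one (mul_nonneg prm.hεα.1.le hs.α₀_pos.le)
  have h0 : tr.x k 0 ∈ χ := hR.asm.iterates k 0 (h.of_le (Nat.zero_le _))
  -- Shifting the objective by a lower bound on χ makes it nonnegative, so that lowering the merit
  -- parameter can only lower the potential. This choice makes the initial potential independent of
  -- the sampled objective.
  set lo := I.Φ k (tr.x k 0) - M * Metric.diam χ
  have hlo : ∀ x ∈ χ, 0 ≤ I.Φ k x - lo := by
    intro x hx
    have h1 := abs_sub_le_of_grad_le (hR.smooth k) hc.convex (hR.sub k).2 h0 hx
    have h2 : M * ‖x - tr.x k 0‖ ≤ M * Metric.diam χ := by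
      rw [← dist_eq_norm]
      exact mul_le_mul_of_nonneg_left (Metric.dist_le_diam_of_mem hc.bounded hx h0) hM
    have h3 := neg_abs_le (I.Φ k x - I.Φ k (tr.x k 0))
    simp only [lo]
    linarith
  have key : ∀ j, Reached I tr k j →
      tauPrev prm tr k j * (I.Φ k (tr.x k j) - lo) + l1 (I.c (tr.x k j)) +
        ∑ i ∈ Finset.range j, prm.η * min 1 (prm.εα * α₀) * κ *
          (‖I.c (tr.x k i)‖ + ‖tr.d k i‖ ^ 2) ≤
        prm.τbar * (M * Metric.diam χ) + Real.sqrt m * κc := by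
    intro j
    induction j with
    | zero =>
      intro _
      simp only [tauPrev, Finset.range_zero, Finset.sum_empty, add_zero]
      have e : I.Φ k (tr.x k 0) - lo = M * Metric.diam χ := by simp [lo]
      rw [e]
      have := (l1_le_sqrt_mul_norm (I.c (tr.x k 0))).trans
        (mul_le_mul_of_nonneg_left (hb.constr _ h0) (Real.sqrt_nonneg _))
      linarith
    | succ j ih =>
      intro hj
      have hact := hj.prev.1
      have hi := ih hact.1
      obtain ⟨α, hα1, hα2, hx, -, harm⟩ := hR.exists_stepSize hs hact
      have hmod := hR.model_le hs hact
      obtain ⟨ht1, ht2⟩ := hR.tau_mem hs hact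
      rw [Finset.sum_range_succ]
      simp only [tauPrev]
      unfold Armijo merit at harm
      rw [← hx] at harm
      have e1 := mul_le_mul_of_nonneg_right ht2 (hlo _ (hR.asm.iterates k j hact.1))
      have e2 : prm.η * min 1 (prm.εα * α₀) * κ * (‖I.c (tr.x k j)‖ + ‖tr.d k j‖ ^ 2) ≤
          prm.η * α * deltaL (I.Φ k) I.c (tr.x k j) (tr.τ k j) (tr.d k j) := by
        rw [mul_assoc]
        exact mul_le_mul (mul_le_mul_of_nonneg_left hα1 prm.hη.1.le) hmod
          (mul_nonneg hs.κ_pos.le (by positivity)) (mul_nonneg prm.hη.1.le (hα₀.trans hα1))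
      linarith
  have h1 := key j h
  have h2 : 0 ≤ tauPrev prm tr k j * (I.Φ k (tr.x k j) - lo) :=
    mul_nonneg (hs.t_pos.le.trans (hR.tauPrev_mem hs h).1) (hlo _ (hR.asm.iterates k j h))
  have h3 := l1_nonneg (I.c (tr.x k j))
  linarith

end SmoothRun

/-- Convexity of the square turns the damped recursion into a telescoping one: the squares drop by
αₘa² up to the perturbation b². -/
theorem sq_add_mul_sq_le {a a' b α αm : ℝ} (ha' : 0 ≤ a') (hα : 0 ≤ α) (hm : αm ≤ α)
    (h1 : α ≤ 1) (h : a' ≤ (1 - α) * a + α * b) : a' ^ 2 + αm * a ^ 2 ≤ a ^ 2 + b ^ 2 := by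
  have h3 : a' ^ 2 ≤ ((1 - α) * a + α * b) ^ 2 := pow_le_pow_left₀ ha' h 2
  have h4 : ((1 - α) * a + α * b) ^ 2 = (1 - α) * a ^ 2 + α * b ^ 2
      - α * (1 - α) * (a - b) ^ 2 := by ring
  have h5 : αm * a ^ 2 ≤ α * a ^ 2 := mul_le_mul_of_nonneg_right hm (sq_nonneg _)
  have h6 : α * b ^ 2 ≤ b ^ 2 := mul_le_of_le_one_left (sq_nonneg _) h1
  have h7 : 0 ≤ α * (1 - α) * (a - b) ^ 2 :=
    mul_nonneg (mul_nonneg hα (by linarith)) (sq_nonneg _)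
  linarith

/-- The merit function controls ‖c‖ to first order but ‖d‖ only to second order. Boundedness of c
makes that enough for (‖c‖ + ‖d‖)². -/
theorem add_sq_le_of_le {p q κ : ℝ} (hp : 0 ≤ p) (h : p ≤ κ) :
    (p + q) ^ 2 ≤ 2 * (κ + 1) * (p + q ^ 2) := by
  have h1 : p ^ 2 ≤ κ * p := by
    rw [sq]; exact mul_le_mul_of_nonneg_right h hp
  have h2 : 0 ≤ κ * q ^ 2 := mul_nonneg (hp.trans h) (sq_nonneg _)
  have h3 : 0 ≤ (p - q) ^ 2 := sq_nonneg _
  nlinarith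

/-- The squared KKT residuals of an inner loop are summable, with a bound that depends on the
run only through a bound on the initial dual variable. -/
theorem exists_sum_sq_bound {c : E n → E m} (hc : ConstraintAssumptions c χ D) (prm : Params)
    (hκH : 0 < κH) (hM : 0 ≤ M) (hs : StepConstants prm κH μH M L c χ D K t κ α₀) (Λ : ℝ) :
    ∃ C : ℝ, 0 < C ∧ ∀ (I : Input n m) (tr : Trace n m), I.c = c →
      SmoothRun prm κH μH M L χ D I tr → ∀ k, ‖tr.lam k 0‖ ≤ Λ → ∀ J, Reached I tr k J →
      ∑ j ∈ Finset.range J, subErr I tr k j ^ 2 ≤ C := by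
  obtain ⟨σ, κc, κJ, hb⟩ := exists_constraintBounds hc
  obtain ⟨LJ, hLJ⟩ := hc.lipschitz
  set Λ' := max Λ K
  have hΛ' : 0 ≤ Λ' := le_max_of_le_right hs.K_nonneg
  set αm := min 1 (prm.εα * α₀) with hαm
  have hαmpos : 0 < αm := lt_min one_pos (mul_pos prm.hεα.1 hs.α₀_pos)
  set s := prm.η * αm * κ with hs'
  have hspos : 0 < s := mul_pos (mul_pos prm.hη.1 hαmpos) hs.κ_pos
  set W := prm.τbar * (M * Metric.diam χ) + Real.sqrt m * κc with hW
  have hkc := hb.kc_nonneg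
  have hW0 : 0 ≤ W := add_nonneg
    (mul_nonneg prm.hτbar.le (mul_nonneg hM Metric.diam_nonneg)) (by positivity)
  set B := κH + 1 + L + LJ * Λ' with hB
  have hB0 : 0 ≤ B := by positivity
  set A := M + κJ * Λ' with hA
  have hA0 : 0 ≤ A := add_nonneg hM (mul_nonneg hb.kJ_nonneg hΛ')
  set Q := B ^ 2 * (2 * (κc + 1)) with hQ
  have hQ0 : 0 ≤ Q := by positivity
  -- The first term bounds the squared Lagrangian gradients and the second the squared constraint
  -- violations; the last makes the constant positive.
  refine ⟨(A ^ 2 + Q * (W / s)) / αm + κc * (W / s) + 1, by positivity, ?_⟩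
  rintro I tr rfl hR k hlam J hJ
  have hsum : ∑ j ∈ Finset.range J, (‖I.c (tr.x k j)‖ + ‖tr.d k j‖ ^ 2) ≤ W / s := by
    rw [le_div_iff₀ hspos, mul_comm, Finset.mul_sum]
    exact hR.sum_step_le hM hs hc hb hJ
  have hlamj : ∀ j, Reached I tr k j → ‖tr.lam k j‖ ≤ Λ' := fun j hj =>
    (hR.norm_lam_le hs hj).trans (max_le_max hlam le_rfl)
  set a : ℕ → ℝ := fun j => ‖gradLag (I.Φ k) I.c (tr.x k j) (tr.lam k j)‖ with ha
  have hrec : ∀ j, Active I tr k j → a (j + 1) ^ 2 + αm * a j ^ 2 ≤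
      a j ^ 2 + Q * (‖I.c (tr.x k j)‖ + ‖tr.d k j‖ ^ 2) := by
    intro j hact
    obtain ⟨α, hα1, hα2, hx, hl, -⟩ := hR.exists_stepSize hs hact
    have hα0 : 0 ≤ α := hαmpos.le.trans hα1
    have hreach := hR.reached_succ hs hact
    have hχ := hR.asm.iterates k j hact.1
    have hχ' := hR.asm.iterates k (j + 1) hreach
    have hl' := hlamj _ hreach
    rw [hl] at hl'
    rw [hx] at hχ'
    have h1 := (hR.step hact).norm_gradLag_next_le hκH.le (hR.sub k).1 hLJ (hc.subset hχ) hα0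
      hα2 (hc.subset hχ') hl'
    rw [← hx, ← hl, ← hB] at h1
    change a (j + 1) ≤ (1 - α) * a j + α * (B * (‖I.c (tr.x k j)‖ + ‖tr.d k j‖)) at h1
    have hcj := hb.constr _ hχ
    have hcn := norm_nonneg (I.c (tr.x k j))
    have haj1 : 0 ≤ a (j + 1) := norm_nonneg _
    set b := B * (‖I.c (tr.x k j)‖ + ‖tr.d k j‖) with hb'
    have h2 : b ^ 2 ≤ Q * (‖I.c (tr.x k j)‖ + ‖tr.d k j‖ ^ 2) := by
      rw [hb', hQ, mul_pow, mul_assoc]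
      exact mul_le_mul_of_nonneg_left (add_sq_le_of_le hcn hcj) (sq_nonneg _)
    have h3 := sq_add_mul_sq_le haj1 hα0 hα1 hα2 h1
    linarith
  have htel : ∀ j, Reached I tr k j → a j ^ 2 + αm * ∑ i ∈ Finset.range j, a i ^ 2 ≤
      a 0 ^ 2 + Q * ∑ i ∈ Finset.range j, (‖I.c (tr.x k i)‖ + ‖tr.d k i‖ ^ 2) := by
    intro j
    induction j with
    | zero => intro _; simp
    | succ j ih =>
      intro hj
      have h1 := ih hj.prev.1.1
      have h2 := hrec j hj.prev.1
      rw [Finset.sum_range_succ, Finset.sum_range_succ]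
      linarith
  have h0 : Reached I tr k 0 := hJ.of_le (Nat.zero_le _)
  have ha0 : a 0 ≤ A := by
    have hχ := hR.asm.iterates k 0 h0
    exact (hb.norm_gradLag_le hχ ((hR.sub k).2 _ hχ) _).trans
      (by rw [hA]; gcongr; exacts [hb.kJ_nonneg, hlamj 0 h0])
  have h1 := htel J hJ
  have h2 : a 0 ^ 2 ≤ A ^ 2 := pow_le_pow_left₀ (norm_nonneg _) ha0 2
  have h3 := mul_le_mul_of_nonneg_left hsum hQ0
  have h4 : ∑ i ∈ Finset.range J, a i ^ 2 ≤ (A ^ 2 + Q * (W / s)) / αm := by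
    rw [le_div_iff₀ hαmpos]
    nlinarith [sq_nonneg (a J)]
  -- The constraint part needs no recursion: ‖c‖² ≤ κ_c‖c‖, and ‖c‖ is already summable.
  have h5 : ∑ j ∈ Finset.range J, ‖I.c (tr.x k j)‖ ^ 2 ≤ κc * (W / s) := by
    refine le_trans ?_ (mul_le_mul_of_nonneg_left hsum hkc)
    rw [Finset.mul_sum]
    refine Finset.sum_le_sum fun j hj => ?_
    have hact := hJ.active_of_lt (Finset.mem_range.1 hj)
    have hcj := hb.constr _ (hR.asm.iterates k j hact.1)
    have hcn := norm_nonneg (I.c (tr.x k j))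
    nlinarith [mul_nonneg hkc (sq_nonneg ‖tr.d k j‖)]
  have h6 : ∑ j ∈ Finset.range J, subErr I tr k j ^ 2 =
      ∑ i ∈ Finset.range J, a i ^ 2 + ∑ j ∈ Finset.range J, ‖I.c (tr.x k j)‖ ^ 2 := by
    rw [← Finset.sum_add_distrib]
    exact Finset.sum_congr rfl fun j _ => kktErr_sq _ _ _ _
  rw [h6]
  linarith

theorem le_div_sq_of_sum_sq_le {C e : ℝ} {J : ℕ} {f : ℕ → ℝ} (he : 0 < e)
    (h : ∑ j ∈ Finset.range J, f j ^ 2 ≤ C) (hf : ∀ j < J, e < f j) : (J : ℝ) ≤ C / e ^ 2 := by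
  rw [le_div_iff₀ (by positivity)]
  refine le_trans ?_ h
  have : ∑ _j ∈ Finset.range J, e ^ 2 ≤ ∑ j ∈ Finset.range J, f j ^ 2 :=
    Finset.sum_le_sum fun j hj =>
      pow_le_pow_left₀ he.le (hf j (Finset.mem_range.1 hj)).le 2
  simpa using this

/-! ### Well-posedness and uniform bounds over all outer iterations. -/

theorem SmoothRun.wellPosed (hR : SmoothRun prm κH μH M L χ D I tr)
    (hc : ConstraintAssumptions I.c χ D) (hκH : 0 < κH) (hμH : 0 < μH) (hM : 0 ≤ M)
    (hs : StepConstants prm κH μH M L I.c χ D K t κ α₀) : WellPosed I tr where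
  solvable k j h u v := by
    obtain ⟨σ, κc, κJ, hb⟩ := exists_constraintBounds hc
    exact existsUnique_kkt hb.pos (hb.lower _ (hR.asm.iterates k j h.1)) hμH
      (hR.asm.hessPos k j h) u v
  merit_pos k j h := hs.t_pos.trans_le (hR.tau_mem hs h).1
  search_stops k j h := hR.ls_ne_top hs h
  terminates k h0 hpos := by
    by_contra! hno
    -- For termination of a single loop the constant may depend on that loop's initial multiplier,
    -- so no assumption on the dual initialization is needed.
    obtain ⟨C, hC, hsum⟩ := exists_sum_sq_bound hc prm hκH hM hs ‖tr.lam k 0‖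
    have hall : ∀ j, Reached I tr k j := by
      intro j
      induction j with
      | zero => exact h0
      | succ j ih => exact hR.reached_succ hs ⟨ih, hno j ih⟩
    obtain ⟨hγ, -, hε⟩ := hR.par k
    have hT : 0 ≤ subErr I tr k 0 := kktErr_nonneg _ _ _ _
    set e := I.γ k * subErr I tr k 0 + I.ε k with he
    have he0 : 0 < e := by
      rcases hpos with h | h
      -- When only γ_k is positive, the threshold is positive because a zero initial residual would
      -- pass the test at once.
      · have : 0 < subErr I tr k 0 := by
          refine lt_of_le_of_ne hT fun h' => hno 0 h0 ?_
          unfold Term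
          rw [← h']
          simpa using hε
        positivity
      · positivity
    have hlt : ∀ j, e < subErr I tr k j := fun j => not_le.1 (hno j (hall j))
    obtain ⟨J, hJ⟩ := exists_nat_gt (C / e ^ 2)
    have := le_div_sq_of_sum_sq_le he0 (hsum I tr rfl hR k le_rfl J (hall J))
      (fun j _ => hlt j)
    linarith

/-- The least-squares multiplier does at least as well as the zero multiplier, whose Lagrangian
gradient is ∇φ(x). Hence Jᵀλ is bounded by 2M. -/
theorem ConstraintBounds.norm_lam_le_of_dualStd {c : E n → E m}
    (hb : ConstraintBounds c χ σ κc κJ) {φ : E n → ℝ} {x : E n} (hx : x ∈ χ) (hM : ‖gradient φ x‖ ≤ M) {prev lam : E m}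
    (h : DualStd φ c x prev lam) : ‖lam‖ ≤ max ‖prev‖ (2 * M / σ) := by
  rcases h with rfl | h
  · exact le_max_left _ _
  · refine le_max_of_le_right ?_
    have h1 := norm_gradLag_le_of_leastSquares h 0
    have h2 : ‖gradLag φ c x 0‖ ≤ M := by simpa [gradLag] using hM
    refine (hb.norm_le_of_gradLag hx hM lam).trans ?_
    have := hb.pos
    gcongr
    linarith

/-- If only the two basic dual initializations are used, the initial dual variables of all outer
iterations are bounded. -/
theorem SmoothRun.norm_lam_le_of_stdDualRun (hR : SmoothRun prm κH μH M L χ D I tr)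
    (hs : StepConstants prm κH μH M L I.c χ D K t κ α₀)
    (hb : ConstraintBounds I.c χ σ κc κJ) (hstd : StdDualRun I tr) (h : Reached I tr k j) :
    ‖tr.lam k j‖ ≤ max (max ‖I.lam0‖ (2 * M / σ)) K := by
  induction h with
  | start =>
    have hx := hR.asm.iterates 0 0 Reached.start
    have h1 := hstd.1
    rw [← hR.run.start.1] at h1
    exact (hb.norm_lam_le_of_dualStd hx ((hR.sub 0).2 _ hx) h1).trans (le_max_left _ _)
  | inner k j h1 h2 h3 ih =>
    have hact : Active I tr k j := ⟨h1, h2⟩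
    obtain ⟨α, hα0, hα1, -, hlam, -⟩ := hR.exists_stepSize hs hact
    have hα : 0 ≤ α := le_trans
      (le_min zero_le_one (mul_nonneg prm.hεα.1.le hs.α₀_pos.le)) hα0
    obtain ⟨ht1, ht2⟩ := hR.tauPrev_mem hs hact.1
    have hK := (hs.mult_le _ _ _ _ _ _ _ _ _ _ (hR.step hact) (hs.t_pos.le.trans ht1) ht2).trans
      (le_max_right (max ‖I.lam0‖ (2 * M / σ)) K)
    have e : tr.lam k (j + 1) = (1 - α) • tr.lam k j + α • (tr.lam k j + tr.δ k j) := by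
      rw [hlam]; module
    rw [e]
    refine (convex_closedBall (0 : E m) (max (max ‖I.lam0‖ (2 * M / σ)) K) ?_ ?_
      (by linarith : 0 ≤ 1 - α) hα (by ring) |> mem_closedBall_zero_iff.1)
    · exact mem_closedBall_zero_iff.2 ih
    · exact mem_closedBall_zero_iff.2 hK
  | outer k j h1 h2 ih =>
    have hx := hR.asm.iterates k j h1
    have h3 := hstd.2 k j h1 h2
    refine (hb.norm_lam_le_of_dualStd hx ((hR.sub (k + 1)).2 _ hx) h3).trans ?_
    refine max_le ih ?_
    exact (le_max_right _ _).trans (le_max_left _ _)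

/-- If the termination parameters are bounded, the initial KKT residuals of all inner loops are
bounded. -/
theorem SmoothRun.subErr_zero_le (hR : SmoothRun prm κH μH M L χ D I tr)
    (hb : ConstraintBounds I.c χ σ κc κJ) {γbar εbar : ℝ} (hγ : γbar < 1)
    (hpar : ∀ k, I.γ k ≤ γbar ∧ I.ε k ≤ εbar) (h : Reached I tr k 0) :
    subErr I tr k 0 ≤
      max (M + κJ * ‖I.lam0‖ + κc) ((εbar + 2 * M) / (1 - γbar)) := by
  set B := max (M + κJ * ‖I.lam0‖ + κc) ((εbar + 2 * M) / (1 - γbar)) with hB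
  -- B is preserved by one outer iteration: the stopping test leaves at most γ̄B + ε̄, and changing
  -- the sampled objective adds at most 2M.
  have hB2 : εbar + 2 * M + γbar * B ≤ B := by
    have h1 : (εbar + 2 * M) / (1 - γbar) ≤ B := le_max_right _ _
    rw [div_le_iff₀ (by linarith)] at h1
    linarith
  induction k with
  | zero =>
    have hx := hR.asm.iterates 0 0 h
    have h1 := kktErr_le_of_dualInit hR.run.start.2
    rw [← hR.run.start.1] at h1
    refine (h1.trans ?_).trans (le_max_left _ _)
    exact (kktErr_le_add _ _ _ _).trans (add_le_add
      (hb.norm_gradLag_le hx ((hR.sub 0).2 _ hx) _) (hb.constr _ hx))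
  | succ k ih =>
    cases h with
    | outer _ j h1 h2 =>
      have hx := hR.asm.iterates k j h1
      have h3 := ih (h1.of_le (Nat.zero_le _))
      obtain ⟨h4, h5⟩ := hR.run.next k j h1 h2
      have h6 := kktErr_le_of_dualInit h5
      have h7 := kktErr_le_add_norm_sub (I.Φ (k + 1)) (I.Φ k) I.c (tr.x k j) (tr.lam k j)
      have h8 := norm_sub_le (gradient (I.Φ (k + 1)) (tr.x k j)) (gradient (I.Φ k) (tr.x k j))
      have h9 := (hR.sub (k + 1)).2 _ hx
      have h10 := (hR.sub k).2 _ hx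
      have h11 : subErr I tr (k + 1) 0 ≤ subErr I tr k j + 2 * M := by
        unfold subErr
        rw [h4]
        linarith
      unfold Term at h2
      obtain ⟨h12, h13⟩ := hpar k
      have h14 := (hR.par k).1
      have h15 : I.γ k * subErr I tr k 0 ≤ γbar * B :=
        mul_le_mul h12 h3 (kktErr_nonneg _ _ _ _) (h14.trans h12)
      linarith

/-- Well-posedness and sublinear convergence of the inner loops of all runs whose subsampled
objectives are uniformly smooth. -/
theorem exists_sublinear_constant {c : E n → E m} (hc : ConstraintAssumptions c χ D)
    (prm : Params) (hκH : 0 < κH) (hμH : 0 < μH) (hεd : prm.εd ≤ μH)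
    (hεfeas : Real.sqrt m * prm.εfeas < 1) (lam0 : E m) (L : ℝ≥0) (hM : 0 ≤ M)
    {γbar : ℝ} (εbar : ℝ) (hγ : γbar < 1) :
    ∃ C : ℝ, 0 < C ∧ ∀ (I : Input n m) (tr : Trace n m), I.c = c → I.lam0 = lam0 →
      SmoothRun prm κH μH M L χ D I tr →
      WellPosed I tr ∧
        ((StdDualRun I tr ∨ ∀ k, I.γ k ≤ γbar ∧ I.ε k ≤ εbar) → Sublinear C I tr) := by
  obtain ⟨K, t, κ, α₀, hs⟩ := exists_stepConstants hc prm hκH hμH hεd hεfeas hM L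
  obtain ⟨σ, κc, κJ, hb⟩ := exists_constraintBounds hc
  -- Λ₁ bounds the multipliers directly when only the two basic initializations occur. Λ₂ covers
  -- arbitrary initializations, by bounding the initial residual and recovering λ from it.
  set Λ₁ := max (max ‖lam0‖ (2 * M / σ)) K
  set Λ₂ := (M + max (M + κJ * ‖lam0‖ + κc) ((εbar + 2 * M) / (1 - γbar))) / σ
  obtain ⟨C, hC, hsum⟩ := exists_sum_sq_bound hc prm hκH hM hs (max Λ₁ Λ₂)
  refine ⟨C, hC, ?_⟩
  rintro I tr rfl rfl hR
  refine ⟨hR.wellPosed hc hκH hμH hM hs, fun hcase k e he J hJ hlt => ?_⟩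
  refine le_div_sq_of_sum_sq_le he (hsum I tr rfl hR k ?_ J hJ) hlt
  have h0 : Reached I tr k 0 := hJ.of_le (Nat.zero_le _)
  rcases hcase with hstd | hpar
  · exact (hR.norm_lam_le_of_stdDualRun hs hb hstd h0).trans (le_max_left _ _)
  · refine le_max_of_le_right ?_
    have hx := hR.asm.iterates k 0 h0
    refine (hb.norm_le_of_gradLag hx ((hR.sub k).2 _ hx) _).trans ?_
    have h1 := hR.subErr_zero_le hb hγ hpar h0
    have h2 := norm_gradLag_le_kktErr (I.Φ k) I.c (tr.x k 0) (tr.lam k 0)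
    have := hb.pos
    simp only [Λ₂]
    gcongr
    exact h2.trans h1

end RASQP

namespace RASQP

variable {n m : ℕ} {prm : Params} {κH μH M : ℝ} {L : ℝ≥0} {χ D : Set (E n)}
  {I : Input n m} {tr : Trace n m} {k j : ℕ}

/-! ### The outer loop -/

theorem innerCount_spec (h : ∃ j, Reached I tr k j ∧ Term I tr k j) :
    Reached I tr k (innerCount I tr k) ∧ Term I tr k (innerCount I tr k) :=
  Nat.sInf_mem (s := {j | Reached I tr k j ∧ Term I tr k j}) h

/-- All inner loops stop if the tolerances of the reached outer iterations are positive. -/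
theorem WellPosed.allTerminate_of_reached (h : WellPosed I tr)
    (hε : ∀ k, Reached I tr k 0 → 0 < I.ε k) : AllTerminate I tr := by
  have hr : ∀ k, Reached I tr k 0 := by
    intro k
    induction k with
    | zero => exact Reached.start
    | succ k ih =>
      obtain ⟨j, hj, hj'⟩ := h.terminates k ih (Or.inr (hε k ih))
      exact Reached.outer k j hj hj'
  exact fun k => h.terminates k (hr k) (Or.inr (hε k (hr k)))

theorem AllTerminate.reached_innerCount (h : AllTerminate I tr) (k : ℕ) :
    Reached I tr k (innerCount I tr k) := (innerCount_spec (h k)).1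

theorem AllTerminate.reached_zero (h : AllTerminate I tr) (k : ℕ) : Reached I tr k 0 :=
  (h.reached_innerCount k).of_le (Nat.zero_le _)

theorem AllTerminate.x_succ (h : AllTerminate I tr) (hrun : IsRun prm I tr) (k : ℕ) :
    tr.x (k + 1) 0 = tr.x k (innerCount I tr k) :=
  (hrun.next k _ (innerCount_spec (h k)).1 (innerCount_spec (h k)).2).1

/-- The initial error is taken at the multiplier before reinitialization. Consecutive outer
iterations therefore share the same primal-dual pair, and the errors chain without loss. -/
theorem AllTerminate.startErr_succ (h : AllTerminate I tr) (hrun : IsRun prm I tr)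
    (f : E n → ℝ) (k : ℕ) : startErr f I tr (k + 1) = endErr f I tr k := by
  unfold startErr endErr
  rw [h.x_succ hrun]
  rfl

theorem AllTerminate.dualInit (h : AllTerminate I tr) (hrun : IsRun prm I tr) (k : ℕ) :
    DualInit (I.Φ k) I.c (tr.x k 0) (prevLam I tr k) (tr.lam k 0) := by
  cases k with
  | zero => rw [hrun.start.1]; exact hrun.start.2
  | succ k =>
    rw [h.x_succ hrun]
    exact (hrun.next k _ (innerCount_spec (h k)).1 (innerCount_spec (h k)).2).2

theorem startErr_zero (hrun : IsRun prm I tr) (f : E n → ℝ) :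
    startErr f I tr 0 = kktErr f I.c I.x0 I.lam0 := by
  unfold startErr
  rw [hrun.start.1]
  rfl

theorem startErr_nonneg (f : E n → ℝ) (I : Input n m) (tr : Trace n m) (k : ℕ) :
    0 ≤ startErr f I tr k := kktErr_nonneg _ _ _ _

/-- One outer iteration: the KKT residual of the true problem at the end in terms of the residual
at the beginning, the tolerance, and the gradient errors. -/
theorem AllTerminate.endErr_le (h : AllTerminate I tr) (hrun : IsRun prm I tr) (f : E n → ℝ)
    (hγ : 0 ≤ I.γ k) :
    endErr f I tr k ≤
      I.γ k * (startErr f I tr k + ‖gradient f (tr.x k 0) - gradient (I.Φ k) (tr.x k 0)‖)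
        + I.ε k + ‖gradient f (tr.x k (innerCount I tr k)) -
          gradient (I.Φ k) (tr.x k (innerCount I tr k))‖ := by
  have h1 := kktErr_le_of_dualInit (h.dualInit hrun k)
  have h2 := kktErr_le_add_norm_sub (I.Φ k) f I.c (tr.x k 0) (prevLam I tr k)
  rw [norm_sub_rev] at h2
  have h3 : subErr I tr k 0 ≤ startErr f I tr k +
      ‖gradient f (tr.x k 0) - gradient (I.Φ k) (tr.x k 0)‖ := h1.trans h2
  have h4 := (innerCount_spec (h k)).2
  unfold Term at h4
  have h5 := kktErr_le_add_norm_sub f (I.Φ k) I.c (tr.x k (innerCount I tr k))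
    (tr.lam k (innerCount I tr k))
  have h6 := mul_le_mul_of_nonneg_left h3 hγ
  unfold endErr
  unfold subErr at h4 h6
  linarith

/-- Before the test passes, the subsampled residual exceeds ε_k, so the sublinear rate applies with
any accuracy up to ε_k. -/
theorem AllTerminate.innerCount_le (h : AllTerminate I tr) {C e : ℝ} (hC : Sublinear C I tr)
    (hγ : 0 ≤ I.γ k) (he : 0 < e) (hε : e ≤ I.ε k) :
    (innerCount I tr k : ℝ) ≤ C / e ^ 2 := by
  have hN := h.reached_innerCount k
  refine hC k e he _ hN fun j hj => ?_
  have h1 := (hN.active_of_lt hj).2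
  unfold Term at h1
  push Not at h1
  have h2 : 0 ≤ I.γ k * subErr I tr k 0 := mul_nonneg hγ (kktErr_nonneg _ _ _ _)
  linarith

/-! ### Geometric sequences -/

/-- A perturbed linear recursion whose factor is smaller than the rate of the perturbation. -/
theorem le_mul_pow_of_recursion {u : ℕ → ℝ} {q β A : ℝ} (hq : 0 ≤ q) (hqβ : q < β)
    (h : ∀ k, u (k + 1) ≤ q * u k + A * β ^ k) (k : ℕ) :
    u k ≤ max (u 0) (A / (β - q)) * β ^ k := by
  have hβ : 0 < β := hq.trans_lt hqβ
  set B := max (u 0) (A / (β - q))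
  have hB : A ≤ B * (β - q) := by
    rw [← div_le_iff₀ (by linarith)]; exact le_max_right _ _
  induction k with
  | zero =>
    rw [pow_zero, mul_one]
    exact le_max_left _ _
  | succ k ih =>
    have hp : 0 < β ^ k := pow_pos hβ k
    calc u (k + 1) ≤ q * u k + A * β ^ k := h k
      _ ≤ q * (B * β ^ k) + B * (β - q) * β ^ k := by gcongr
      _ = B * β ^ (k + 1) := by ring

/-- A growing geometric sum is a constant multiple of its last term; this is why the total work is
of the order of the last outer iteration's bound. -/
theorem sum_inv_pow_le {β : ℝ} (h0 : 0 < β) (h1 : β < 1) {p : ℕ} (hp : p ≠ 0) (K : ℕ) :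
    ∑ k ∈ Finset.range (K + 1), ((β ^ k)⁻¹) ^ p ≤ (1 - β ^ p)⁻¹ * ((β ^ K)⁻¹) ^ p := by
  have hb : 0 < β ^ p := pow_pos h0 p
  have hlt : β ^ p < 1 := pow_lt_one₀ h0.le h1 hp
  have hg : 0 < 1 - β ^ p := by linarith
  induction K with
  | zero => simpa using (one_le_inv₀ hg).2 (by linarith)
  | succ K ih =>
    rw [Finset.sum_range_succ]
    refine (add_le_add_left ih _).trans ?_
    have e : ((β ^ K)⁻¹) ^ p = β ^ p * ((β ^ (K + 1))⁻¹) ^ p := by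
      rw [← mul_pow, pow_succ, mul_inv]
      field_simp
    rw [e]
    apply le_of_eq
    field_simp
    ring

/-- The first index at which a geometric sequence falls below `e`. -/
theorem exists_stop_index {β B e : ℝ} (h0 : 0 < β) (h1 : β < 1) (he : 0 < e) (he1 : e ≤ 1) :
    ∃ K : ℕ, B * β ^ (K + 1) ≤ e ∧ (β ^ K)⁻¹ ≤ max B 1 / e := by
  have hex : ∃ K : ℕ, B * β ^ (K + 1) ≤ e := by
    have : Filter.Tendsto (fun K : ℕ => B * β ^ (K + 1)) Filter.atTop (nhds (B * 0)) :=
      ((tendsto_pow_atTop_nhds_zero_of_lt_one h0.le h1).comp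
        (Filter.tendsto_add_atTop_nat 1)).const_mul B
    rw [mul_zero] at this
    exact ((this.eventually (gt_mem_nhds he)).exists).imp fun _ h => h.le
  classical
  refine ⟨Nat.find hex, Nat.find_spec hex, ?_⟩
  -- Minimality keeps βᴷ from being too small. At index 0 there is no predecessor, and e ≤ 1 is used
  -- instead.
  rcases hK : Nat.find hex with _ | K
  · rw [pow_zero, inv_one, le_div_iff₀ he, one_mul]
    exact he1.trans (le_max_right _ _)
  · have := Nat.find_min hex (m := K) (by omega)
    push Not at this
    have hp : 0 < β ^ (K + 1) := pow_pos h0 _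
    rw [inv_le_iff_one_le_mul₀ hp, mul_comm, mul_div_assoc', le_div_iff₀ he, one_mul]
    refine this.le.trans ?_
    rw [mul_comm]
    exact mul_le_mul_of_nonneg_left (le_max_left _ _) hp.le

theorem sum_inv_pow_le_div {β B e : ℝ} (h0 : 0 < β) (h1 : β < 1) {p : ℕ} (hp : p ≠ 0)
    {K : ℕ} (hK : (β ^ K)⁻¹ ≤ B / e) :
    ∑ k ∈ Finset.range (K + 1), ((β ^ k)⁻¹) ^ p ≤ (1 - β ^ p)⁻¹ * B ^ p / e ^ p := by
  refine (sum_inv_pow_le h0 h1 hp K).trans ?_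
  have hlt : β ^ p < 1 := pow_lt_one₀ h0.le h1 hp
  rw [mul_div_assoc, ← div_pow]
  have : 0 ≤ (1 - β ^ p)⁻¹ := inv_nonneg.2 (by linarith)
  gcongr

/-! ### The finite-sum problem -/

theorem contDiff_sampleMean {ι : Type*} {F : E n → ι → ℝ}
    (hF : ∀ ξ, ContDiff ℝ 1 (fun x => F x ξ)) (S : Finset ι) : ContDiff ℝ 1 (sampleMean F S) :=
  (ContDiff.sum fun ξ _ => hF ξ).div_const _

theorem continuous_gradient {φ : E n → ℝ} (h : ContDiff ℝ 1 φ) : Continuous (gradient φ) :=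
  (InnerProductSpace.toDual ℝ (E n)).symm.continuous.comp (h.continuous_fderiv (by norm_num))

theorem exists_gradient_bound {φ : E n → ℝ} (h : ContDiff ℝ 1 φ) (hχ : IsCompact χ) :
    ∃ M : ℝ, ∀ x ∈ χ, ‖gradient φ x‖ ≤ M :=
  hχ.exists_bound_of_continuousOn (continuous_gradient h).continuousOn

/-- Common smoothness constants of all subsampled objectives of a finite-sum problem. -/
theorem exists_subsampledSmooth {ι : Type*} [Finite ι] {F : E n → ι → ℝ}
    (hF : ∀ ξ, ContDiff ℝ 1 (fun x => F x ξ)) (hχ : IsCompact χ) (D : Set (E n)) :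
    ∃ (L : ℝ≥0) (M : ℝ), 0 ≤ M ∧ ∀ S : Finset ι,
      (∃ L' : ℝ≥0, LipschitzOnWith L' (gradient (sampleMean F S)) D) →
      SubsampledSmooth L M χ D (sampleMean F S) := by
  have := Fintype.ofFinite ι
  have h1 : ∀ S : Finset ι, ∃ L : ℝ≥0,
      (∃ L' : ℝ≥0, LipschitzOnWith L' (gradient (sampleMean F S)) D) →
      LipschitzOnWith L (gradient (sampleMean F S)) D := by
    intro S
    by_cases h : ∃ L' : ℝ≥0, LipschitzOnWith L' (gradient (sampleMean F S)) D
    · exact h.imp fun _ h' _ => h'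
    -- Subsets whose gradient is not Lipschitz on D receive the dummy constant 0. There are finitely
    -- many subsets, so summing all constants gives a common one.
    · exact ⟨0, fun h' => absurd h' h⟩
  choose Lf hLf using h1
  choose Mf hMf using fun S : Finset ι =>
    exists_gradient_bound (contDiff_sampleMean hF S) hχ
  refine ⟨∑ S, Lf S, ∑ S, |Mf S|, Finset.sum_nonneg fun _ _ => abs_nonneg _, fun S hS => ⟨?_, ?_⟩⟩
  · exact (hLf S hS).weaken (Finset.single_le_sum (f := Lf) (fun _ _ => zero_le)
      (Finset.mem_univ S))
  · intro x hx
    refine ((hMf S x hx).trans (le_abs_self _)).trans ?_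
    exact Finset.single_le_sum (f := fun S => |Mf S|) (fun _ _ => abs_nonneg _)
      (Finset.mem_univ S)

theorem finSum_sublinear {c : E n → E m} (hc : ConstraintAssumptions c χ D)
    (prm : Params) (hκH : 0 < κH) (hμH : 0 < μH) (hεd : prm.εd ≤ μH)
    (hεfeas : Real.sqrt m * prm.εfeas < 1) (x0 : E n) (lam0 : E m)
    {ι : Type*} [Finite ι] {F : E n → ι → ℝ} (hF : ∀ ξ, ContDiff ℝ 1 (fun x => F x ξ))
    (γbar εbar : ℝ) (hγ : γbar < 1) :
    ∃ C : ℝ, 0 < C ∧ ∀ (S : ℕ → Finset ι) (γ ε : ℕ → ℝ) (tr : Trace n m),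
      let I : Input n m := ⟨c, fun k => sampleMean F (S k), γ, ε, x0, lam0⟩
      (∀ k, ∃ L : NNReal, LipschitzOnWith L (gradient (sampleMean F (S k))) D) →
      (∀ k, 0 ≤ γ k ∧ γ k < 1 ∧ 0 ≤ ε k) →
      IsRun prm I tr → RunAssumptions prm κH μH χ D I tr →
      WellPosed I tr ∧
      ((StdDualRun I tr ∨ ∀ k, γ k ≤ γbar ∧ ε k ≤ εbar) → Sublinear C I tr) := by
  have hK : IsCompact χ := Metric.isCompact_of_isClosed_isBounded hc.closed hc.bounded
  obtain ⟨L, M, hM, hsub⟩ := exists_subsampledSmooth hF hK D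
  obtain ⟨C, hC, hmain⟩ := exists_sublinear_constant hc prm hκH hμH hεd hεfeas lam0 L hM εbar hγ
  refine ⟨C, hC, ?_⟩
  intro S γ ε tr I hL hpar hrun hasm
  refine hmain I tr rfl rfl ?_
  exact ⟨hrun, hasm, fun k => contDiff_sampleMean hF _, fun k => hsub _ (hL k), hpar⟩

/-- The tolerance has the floor ω̂βᵏ, which bounds N_k by a multiple of β⁻²ᵏ, while the norm test
makes the residual decay like βᵏ. The stopping index balances both. -/
theorem finSum_complexity {c : E n → E m} (hc : ConstraintAssumptions c χ D)
    (prm : Params) (hκH : 0 < κH) (hμH : 0 < μH) (hεd : prm.εd ≤ μH)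
    (hεfeas : Real.sqrt m * prm.εfeas < 1) (x0 : E n) (lam0 : E m)
    {ι : Type*} [Fintype ι] {F : E n → ι → ℝ} (hF : ∀ ξ, ContDiff ℝ 1 (fun x => F x ξ))
    {θ θh a β ω ωh γbar : ℝ} (hθ : 0 ≤ θ) (hθh : 0 ≤ θh) (ha : 0 ≤ a) (hβ0 : 0 < β)
    (hβ1 : β < 1) (hω : 0 < ω) (hωh : 0 < ωh) (hγ0 : 0 ≤ γbar)
    (hrate : γbar + θ * (ω + θh + γbar) < β) :
    ∃ C : ℝ, 0 < C ∧ ∀ (S : ℕ → Finset ι) (γ : ℕ → ℝ) (tr : Trace n m),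
      let I : Input n m := ⟨c, fun k => sampleMean F (S k), γ,
        fun k => ω * ‖gradient (finObj F) (tr.x k 0)
            - gradient (sampleMean F (S k)) (tr.x k 0)‖ + ωh * β ^ k, x0, lam0⟩
      (∀ k, ∃ L : NNReal, LipschitzOnWith L (gradient (sampleMean F (S k))) D) →
      (∀ k, 0 ≤ γ k ∧ γ k ≤ γbar) →
      IsRun prm I tr → RunAssumptions prm κH μH χ D I tr →
      (∀ k, FinNormTest (finObj F) θ θh a β I tr k) →
      AllTerminate I tr ∧
      ∀ e : ℝ, 0 < e → e ≤ 1 → ∃ K : ℕ,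
        endErr (finObj F) I tr K ≤ e ∧
        ∑ k ∈ Finset.range (K + 1), (innerCount I tr k : ℝ) ≤ C / e ^ 2 ∧
        ∑ k ∈ Finset.range (K + 1), ((S k).card : ℝ) * innerCount I tr k ≤
          C * Fintype.card ι / e ^ 2 := by
  have hq0 : 0 ≤ γbar + θ * (ω + θh + γbar) := by positivity
  have hγ1 : γbar < 1 := by
    have : 0 ≤ θ * (ω + θh + γbar) := by positivity
    linarith
  have hK : IsCompact χ := Metric.isCompact_of_isClosed_isBounded hc.closed hc.bounded
  obtain ⟨L, M, hM, hsub⟩ := exists_subsampledSmooth hF hK D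
  obtain ⟨Mf, hMf⟩ := exists_gradient_bound (contDiff_sampleMean hF Finset.univ) hK
  -- The tolerances are bounded by ω(M_f + M) + ω̂, where M_f and M bound the true and sampled
  -- gradients on χ. This places the run in the case of bounded termination parameters.
  obtain ⟨C₁, hC₁, hmain⟩ := exists_sublinear_constant hc prm hκH hμH hεd hεfeas lam0 L hM
    (ω * (Mf + M) + ωh) hγ1
  set A := (ω + θh + γbar) * a + ωh with hA
  set B := max (kktErr (finObj F) c x0 lam0) (A / (β - (γbar + θ * (ω + θh + γbar)))) with hB
  set G := C₁ / ωh ^ 2 * ((1 - β ^ 2)⁻¹ * (max B 1) ^ 2) with hG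
  have hβ2 : 0 < 1 - β ^ 2 := by nlinarith
  have hB1 : 0 < max B 1 := lt_max_of_lt_right one_pos
  have hGpos : 0 < G := by positivity
  refine ⟨G, hGpos, ?_⟩
  intro S γ tr I hL hγ hrun hasm htest
  have hp : ∀ k, 0 < ωh * β ^ k := fun k => mul_pos hωh (pow_pos hβ0 k)
  have hεlow : ∀ k, ωh * β ^ k ≤ I.ε k := fun k =>
    le_add_of_nonneg_left (mul_nonneg hω.le (norm_nonneg _))
  have hR : SmoothRun prm κH μH M L χ D I tr :=
    ⟨hrun, hasm, fun k => contDiff_sampleMean hF _, fun k => hsub _ (hL k),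
      fun k => ⟨(hγ k).1, (hγ k).2.trans_lt hγ1, (hp k).le.trans (hεlow k)⟩⟩
  obtain ⟨hwp, hsl⟩ := hmain I tr rfl rfl hR
  have hterm : AllTerminate I tr := hwp.allTerminate_of_reached fun k _ => (hp k).trans_le (hεlow k)
  have hsub' : Sublinear C₁ I tr := by
    refine hsl (Or.inr fun k => ⟨(hγ k).2, ?_⟩)
    have hx := hasm.iterates k 0 (hterm.reached_zero k)
    have h1 := norm_sub_le (gradient (finObj F) (tr.x k 0))
      (gradient (sampleMean F (S k)) (tr.x k 0))
    have h2 := (hR.sub k).2 _ hx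
    have h3 : ‖gradient (finObj F) (tr.x k 0)‖ ≤ Mf := hMf _ hx
    have h4 : β ^ k ≤ 1 := pow_le_one₀ hβ0.le hβ1.le
    change ω * _ + ωh * β ^ k ≤ _
    have h5 := mul_le_mul_of_nonneg_left (h1.trans (add_le_add h3 h2)) hω.le
    have h6 := mul_le_mul_of_nonneg_left h4 hωh.le
    linarith
  have hrec : ∀ k, startErr (finObj F) I tr (k + 1) ≤
      (γbar + θ * (ω + θh + γbar)) * startErr (finObj F) I tr k + A * β ^ k := by
    intro k
    rw [hterm.startErr_succ hrun]
    have hE := startErr_nonneg (finObj F) I tr k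
    have hbk := pow_pos hβ0 k
    obtain ⟨t1, t2⟩ := htest k
    set Ek := startErr (finObj F) I tr k
    have hs0 : 0 ≤ θ * Ek + a * β ^ k := by positivity
    -- Bounding the root of the norm test by a sum makes the recursion linear in the error, with
    -- factor γ + θ(ω + θ̂ + γ).
    have hsq : θ ^ 2 * Ek ^ 2 + a ^ 2 * β ^ (2 * k) ≤ (θ * Ek + a * β ^ k) ^ 2 := by
      have : 0 ≤ 2 * (θ * Ek) * (a * β ^ k) := by positivity
      rw [pow_mul']
      nlinarith
    have h1 : ‖gradient (finObj F) (tr.x k 0) - gradient (I.Φ k) (tr.x k 0)‖ ≤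
        θ * Ek + a * β ^ k :=
      (sq_le_sq₀ (norm_nonneg _) hs0).1 (t1.trans hsq)
    have h2 : ‖gradient (finObj F) (tr.x k (innerCount I tr k)) -
        gradient (I.Φ k) (tr.x k (innerCount I tr k))‖ ≤ θh * (θ * Ek + a * β ^ k) := by
      refine (sq_le_sq₀ (norm_nonneg _) (mul_nonneg hθh hs0)).1 (t2.trans ?_)
      rw [mul_pow]
      exact mul_le_mul_of_nonneg_left hsq (sq_nonneg _)
    have h3 := hterm.endErr_le hrun (finObj F) (k := k) (hγ k).1
    have h4 : I.γ k * (Ek + ‖gradient (finObj F) (tr.x k 0) - gradient (I.Φ k) (tr.x k 0)‖) ≤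
        γbar * (Ek + (θ * Ek + a * β ^ k)) :=
      mul_le_mul (hγ k).2 (by linarith) (by positivity) hγ0
    have h5 : I.ε k ≤ ω * (θ * Ek + a * β ^ k) + ωh * β ^ k :=
      add_le_add_left (mul_le_mul_of_nonneg_left h1 hω.le) _
    rw [hA]
    linarith
  have hlin := le_mul_pow_of_recursion hq0 hrate hrec
  rw [startErr_zero hrun] at hlin
  have hcount : ∀ k, (innerCount I tr k : ℝ) ≤ C₁ / ωh ^ 2 * ((β ^ k)⁻¹) ^ 2 := by
    intro k
    refine (hterm.innerCount_le hsub' (hγ k).1 (hp k) (hεlow k)).trans (le_of_eq ?_)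
    have := pow_pos hβ0 k
    field_simp
  refine ⟨hterm, fun e he he1 => ?_⟩
  obtain ⟨K, hK1, hK2⟩ := exists_stop_index (B := B) hβ0 hβ1 he he1
  have hsum : ∑ k ∈ Finset.range (K + 1), (innerCount I tr k : ℝ) ≤ G / e ^ 2 := by
    refine (Finset.sum_le_sum fun k _ => hcount k).trans ?_
    rw [← Finset.mul_sum, hG, mul_div_assoc]
    exact mul_le_mul_of_nonneg_left (sum_inv_pow_le_div hβ0 hβ1 two_ne_zero hK2) (by positivity)
  refine ⟨K, ?_, hsum, ?_⟩
  · rw [← hterm.startErr_succ hrun]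
    exact (hlin (K + 1)).trans hK1
  · calc ∑ k ∈ Finset.range (K + 1), ((S k).card : ℝ) * innerCount I tr k
        ≤ ∑ k ∈ Finset.range (K + 1), (Fintype.card ι : ℝ) * innerCount I tr k := by
          refine Finset.sum_le_sum fun k _ => ?_
          gcongr
          exact_mod_cast Finset.card_le_univ _
      _ ≤ Fintype.card ι * (G / e ^ 2) := by
          rw [← Finset.mul_sum]; gcongr
      _ = _ := by ring

end RASQP

namespace RASQP

variable {n m : ℕ} {Ξ : Type*} [MeasurableSpace Ξ] {P : Measure Ξ} {F : E n → Ξ → ℝ}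
  {χ : Set (E n)} {ω₁ ω₂ εG κG : ℝ}

/-! ### Gradients of random functions -/

/-- Each coordinate is the pointwise limit of difference quotients with steps 1/(k + 1), which are
measurable because F(x, ·) is. -/
theorem measurable_gradient (hs : ∀ ξ, ContDiff ℝ 1 (fun x => F x ξ))
    (hm : ∀ x, Measurable (F x)) (x : E n) :
    Measurable (fun ξ => gradient (fun y => F y ξ) x) := by
  have hcoord : ∀ i, Measurable fun ξ => gradient (fun y => F y ξ) x i := by
    intro i
    refine measurable_of_tendsto_metrizable (f := fun (k : ℕ) ξ =>
      ((k : ℝ) + 1) * (F (x + ((k : ℝ) + 1)⁻¹ • EuclideanSpace.single i (1 : ℝ)) ξ - F x ξ))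
      (fun k => ((hm _).sub (hm _)).const_mul _) ?_
    rw [tendsto_pi_nhds]
    intro ξ
    have hd := ((hs ξ).differentiable (by norm_num) x).hasFDerivAt
    have hline := hd.hasLineDerivAt (EuclideanSpace.single i (1 : ℝ))
    have hslope := hline.tendsto_slope_zero
    have hseq : Filter.Tendsto (fun k : ℕ => ((k : ℝ) + 1)⁻¹) Filter.atTop
        (nhdsWithin 0 {0}ᶜ) := by
      refine tendsto_nhdsWithin_iff.2 ⟨?_, Filter.Eventually.of_forall fun k => ?_⟩
      · simpa [one_div] using tendsto_one_div_add_atTop_nhds_zero_nat (𝕜 := ℝ)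
      · have : ((k : ℝ) + 1)⁻¹ ≠ 0 := by positivity
        simpa using this
    have h := hslope.comp hseq
    have e : fderiv ℝ (fun y => F y ξ) x (EuclideanSpace.single i (1 : ℝ)) =
        gradient (fun y => F y ξ) x i := by
      rw [fderiv_apply_eq_inner, EuclideanSpace.inner_single_right]
      simp
    rw [e] at h
    refine h.congr fun k => ?_
    simp
  have e : (fun ξ => gradient (fun y => F y ξ) x) = fun ξ =>
      ∑ i, gradient (fun y => F y ξ) x i • EuclideanSpace.single i (1 : ℝ) := by
    funext ξ
    ext j
    simp [Finset.sum_apply, Pi.single_apply]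
  rw [e]
  exact Finset.measurable_sum _ fun i _ => (hcoord i).smul_const _

/-- Continuity in x and measurability in ξ give joint measurability, which is needed because the
gradient is evaluated at a random iterate. -/
theorem measurable_uncurry_gradient (hs : ∀ ξ, ContDiff ℝ 1 (fun x => F x ξ))
    (hm : ∀ x, Measurable (F x)) :
    Measurable (fun p : E n × Ξ => gradient (fun y => F y p.2) p.1) :=
  measurable_uncurry_of_continuous_of_measurable
    (u := fun (x : E n) (ξ : Ξ) => gradient (fun y => F y ξ) x)
    (fun ξ => continuous_gradient (hs ξ)) (measurable_gradient hs hm)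

theorem contDiff_empMean {Ξ : Type*} {F : E n → Ξ → ℝ}
    (hs : ∀ ξ, ContDiff ℝ 1 (fun x => F x ξ)) (N : ℕ) (s : Fin N → Ξ) :
    ContDiff ℝ 1 (empMean F N s) :=
  (ContDiff.sum fun i _ => hs (s i)).div_const _

theorem gradient_empMean {Ξ : Type*} {F : E n → Ξ → ℝ}
    (hs : ∀ ξ, ContDiff ℝ 1 (fun x => F x ξ)) (N : ℕ) (s : Fin N → Ξ)
    (x : E n) : gradient (empMean F N s) x =
      (N : ℝ)⁻¹ • ∑ i, gradient (fun y => F y (s i)) x := by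
  have h : HasFDerivAt (empMean F N s)
      ((N : ℝ)⁻¹ • ∑ i, fderiv ℝ (fun y => F y (s i)) x) x := by
    have h1 : HasFDerivAt (fun y => ∑ i, F y (s i)) (∑ i, fderiv ℝ (fun y => F y (s i)) x) x :=
      HasFDerivAt.fun_sum fun i _ => ((hs (s i)).differentiable (by norm_num) x).hasFDerivAt
    have h2 := h1.const_smul (N : ℝ)⁻¹
    refine h2.congr_of_eventuallyEq (Filter.Eventually.of_forall fun y => ?_)
    simp [empMean, div_eq_inv_mul]
  unfold gradient
  rw [h.fderiv]
  simp [map_sum]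

theorem measurable_gradient_empMean (hs : ∀ ξ, ContDiff ℝ 1 (fun x => F x ξ))
    (hm : ∀ x, Measurable (F x)) (N : ℕ) :
    Measurable fun p : E n × (Fin N → Ξ) => gradient (empMean F N p.2) p.1 := by
  simp_rw [gradient_empMean hs]
  have : Measurable fun p : E n × (Fin N → Ξ) => ∑ i, gradient (fun y => F y (p.2 i)) p.1 :=
    Finset.measurable_sum _ fun i _ => (measurable_uncurry_gradient hs hm).comp
    (measurable_fst.prodMk ((measurable_pi_apply i).comp measurable_snd))
  exact this.const_smul (N : ℝ)⁻¹

/-! ### Second moments of sample means -/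

theorem enorm_sq_eq_ofReal {V : Type*} [SeminormedAddCommGroup V] (v : V) :
    ‖v‖ₑ ^ 2 = ENNReal.ofReal (‖v‖ ^ 2) := by
  rw [ENNReal.ofReal_pow (norm_nonneg _), ofReal_norm]

/-- The second moment of a sum of i.i.d. centered random vectors. -/
theorem integral_norm_sq_sum_pi [IsProbabilityMeasure P] {Z : Ξ → E n} (hZ : MemLp Z 2 P)
    (h0 : ∫ ξ, Z ξ ∂P = 0) (N : ℕ) :
    ∫ s : Fin N → Ξ, ‖∑ i, Z (s i)‖ ^ 2 ∂(Measure.pi fun _ => P) =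
      N * ∫ ξ, ‖Z ξ‖ ^ 2 ∂P := by
  have hint : Integrable Z P := hZ.integrable (by norm_num)
  have hc : ∀ l, MemLp (fun ξ => Z ξ l) 2 P := fun l =>
    hZ.continuousLinearMap_comp (EuclideanSpace.proj (𝕜 := ℝ) l)
  have hc0 : ∀ l, ∫ ξ, Z ξ l ∂P = 0 := by
    intro l
    have := (EuclideanSpace.proj (𝕜 := ℝ) l : E n →L[ℝ] ℝ).integral_comp_comm hint
    rw [h0, map_zero] at this
    exact this
  set ν : Measure (Fin N → Ξ) := Measure.pi fun _ => P with hν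
  have hY : ∀ l (i : Fin N), MemLp (fun s : Fin N → Ξ => Z (s i) l) 2 ν := fun l i =>
    (hc l).comp_measurePreserving (measurePreserving_eval (fun _ : Fin N => P) i)
  have hev : ∀ (i : Fin N) (g : Ξ → ℝ), AEStronglyMeasurable g P →
      ∫ s, g (s i) ∂ν = ∫ ξ, g ξ ∂P := by
    intro i g hg
    have hmp := measurePreserving_eval (fun _ : Fin N => P) i
    have := integral_map (μ := ν) (φ := Function.eval i) hmp.measurable.aemeasurable
      (f := g) (by rw [hmp.map_eq]; exact hg)
    rw [hmp.map_eq] at this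
    exact this.symm
  -- Coordinatewise the claim is additivity of the variance for pairwise independent real variables.
  have hl : ∀ l, ∫ s, (∑ i, Z (s i) l) ^ 2 ∂ν = N * ∫ ξ, Z ξ l ^ 2 ∂P := by
    intro l
    have hind : iIndepFun (fun (i : Fin N) (s : Fin N → Ξ) => Z (s i) l) ν :=
      iIndepFun_pi fun _ => (hc l).aestronglyMeasurable.aemeasurable
    have hv := IndepFun.variance_sum (s := Finset.univ) (fun i _ => hY l i)
      (fun i _ j _ hij => hind.indepFun hij)
    have hm0 : ∀ i, ∫ s, Z (s i) l ∂ν = 0 := fun i => by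
      rw [hev i (fun ξ => Z ξ l) (hc l).aestronglyMeasurable, hc0]
    rw [variance_of_integral_eq_zero] at hv
    · simp only [Finset.sum_apply] at hv
      rw [hv]
      have : ∀ i : Fin N, Var[fun s : Fin N → Ξ => Z (s i) l; ν] = ∫ ξ, Z ξ l ^ 2 ∂P := by
        intro i
        rw [variance_of_integral_eq_zero (hY l i).aestronglyMeasurable.aemeasurable (hm0 i)]
        exact hev i (fun ξ => Z ξ l ^ 2) ((hc l).aestronglyMeasurable.pow 2)
      simp [this]
    · exact Finset.aemeasurable_sum _ fun i _ => (hY l i).aestronglyMeasurable.aemeasurable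
    · simp only [Finset.sum_apply]
      rw [integral_finsetSum _ fun i _ => (hY l i).integrable (by norm_num)]
      simp [hm0]
  have e1 : ∀ s : Fin N → Ξ, ‖∑ i, Z (s i)‖ ^ 2 = ∑ l, (∑ i, Z (s i) l) ^ 2 := by
    intro s
    rw [EuclideanSpace.norm_sq_eq]
    simp [Finset.sum_apply]
  have e2 : ∀ ξ, ‖Z ξ‖ ^ 2 = ∑ l, Z ξ l ^ 2 := by
    intro ξ
    rw [EuclideanSpace.norm_sq_eq]
    simp
  simp_rw [e1, e2]
  rw [integral_finsetSum, integral_finsetSum, Finset.mul_sum]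
  · exact Finset.sum_congr rfl fun l _ => hl l
  · exact fun l _ => (hc l).integrable_sq
  · intro l _
    exact (memLp_finsetSum Finset.univ fun i _ => hY l i).integrable_sq

/-- A mean-square bound gives a bound on the mean. -/
theorem lintegral_le_of_lintegral_sq_le {α : Type*} [MeasurableSpace α] {ν : Measure α}
    [IsProbabilityMeasure ν] {h : α → ℝ≥0∞} (hm : AEMeasurable h ν) {t : ℝ} (ht : 0 ≤ t)
    (hle : ∫⁻ s, h s ^ 2 ∂ν ≤ ENNReal.ofReal (t ^ 2)) : ∫⁻ s, h s ∂ν ≤ ENNReal.ofReal t := by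
  have h1 := ENNReal.lintegral_mul_le_Lp_mul_Lq ν Real.HolderConjugate.two_two hm
    (aemeasurable_const (b := (1 : ℝ≥0∞)))
  simp only [Pi.mul_apply, mul_one, ENNReal.one_rpow, lintegral_one, measure_univ] at h1
  refine h1.trans ?_
  have h2 : ∫⁻ s, h s ^ (2 : ℝ) ∂ν ≤ ENNReal.ofReal (t ^ 2) := by
    simpa [ENNReal.rpow_two] using hle
  calc (∫⁻ s, h s ^ (2 : ℝ) ∂ν) ^ (1 / 2 : ℝ) ≤ (ENNReal.ofReal (t ^ 2)) ^ (1 / 2 : ℝ) := by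
        gcongr
    _ = ENNReal.ofReal t := by
        rw [ENNReal.ofReal_rpow_of_nonneg (by positivity) (by norm_num), ← Real.sqrt_eq_rpow,
          Real.sqrt_sq ht]

/-! ### The relative gradient error -/

theorem enorm_gradient_sub_le_relErr {f φ : E n → ℝ} (hε : 0 < εG) {x : E n} (hx : x ∈ χ) :
    ‖gradient f x - gradient φ x‖ₑ ≤
      relErr f φ εG χ * ENNReal.ofReal (εG + ‖gradient f x‖) := by
  have hpos : 0 < εG + ‖gradient f x‖ := by positivity
  have h1 : ENNReal.ofReal (‖gradient f x - gradient φ x‖ / (εG + ‖gradient f x‖)) ≤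
      relErr f φ εG χ := by
    unfold relErr
    exact le_iSup₂ (f := fun x (_ : x ∈ χ) => ENNReal.ofReal
      (‖gradient f x - gradient φ x‖ / (εG + ‖gradient f x‖))) x hx
  calc ‖gradient f x - gradient φ x‖ₑ
      = ENNReal.ofReal (‖gradient f x - gradient φ x‖ / (εG + ‖gradient f x‖)) *
          ENNReal.ofReal (εG + ‖gradient f x‖) := by
        rw [← ENNReal.ofReal_mul (by positivity), div_mul_cancel₀ _ hpos.ne',
          ofReal_norm]
    _ ≤ _ := by gcongr

/-- Continuity of both gradients reduces the uncountable supremum to one over a dense sequence in χ.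
-/
theorem measurable_relErr (hs : ∀ ξ, ContDiff ℝ 1 (fun x => F x ξ))
    (hm : ∀ x, Measurable (F x)) {f : E n → ℝ} (hf : ContDiff ℝ 1 f) (hε : 0 < εG) (N : ℕ) :
    Measurable fun s : Fin N → Ξ => relErr f (empMean F N s) εG χ := by
  rcases isEmpty_or_nonempty χ with he | hne
  · have : χ = ∅ := Set.isEmpty_coe_sort.1 he
    simp [relErr, this]
  have hcont : ∀ s : Fin N → Ξ, Continuous fun x : χ => ENNReal.ofReal
      (‖gradient f x - gradient (empMean F N s) x‖ / (εG + ‖gradient f x‖)) := by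
    intro s
    have h1 := continuous_gradient hf
    have h2 := continuous_gradient (contDiff_empMean hs N s)
    refine ENNReal.continuous_ofReal.comp (Continuous.div ?_ ?_ fun x => ?_)
    · exact ((h1.comp continuous_subtype_val).sub (h2.comp continuous_subtype_val)).norm
    · exact continuous_const.add (h1.comp continuous_subtype_val).norm
    · positivity
  have e : (fun s : Fin N → Ξ => relErr f (empMean F N s) εG χ) = fun s =>
      ⨆ i : ℕ, ENNReal.ofReal
        (‖gradient f (TopologicalSpace.denseSeq χ i) -
          gradient (empMean F N s) (TopologicalSpace.denseSeq χ i)‖ /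
            (εG + ‖gradient f (TopologicalSpace.denseSeq χ i)‖)) := by
    funext s
    unfold relErr
    rw [iSup_subtype']
    rw [← (TopologicalSpace.denseRange_denseSeq χ).ciSup' (hcont s)]
    exact iSup_range' (fun x : χ => ENNReal.ofReal
      (‖gradient f x - gradient (empMean F N s) x‖ / (εG + ‖gradient f x‖))) _
  rw [e]
  refine Measurable.iSup fun i => ENNReal.measurable_ofReal.comp (Measurable.div_const ?_ _)
  exact (measurable_const.sub ((measurable_gradient_empMean hs hm N).comp
    (measurable_const.prodMk measurable_id))).norm

/-! ### Consequences of the assumptions on the expectation problem -/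

theorem ExpAssumptions.memLp [IsProbabilityMeasure P] (h : ExpAssumptions P F χ ω₁ ω₂ εG κG)
    {x : E n} (hx : x ∈ χ) :
    MemLp (fun ξ => gradient (fun y => F y ξ) x - gradient (expObj P F) x) 2 P := by
  have hm : AEStronglyMeasurable
      (fun ξ => gradient (fun y => F y ξ) x - gradient (expObj P F) x) P :=
    ((measurable_gradient h.smoothF h.measurableF x).sub_const _).aestronglyMeasurable
  rw [memLp_two_iff_integrable_sq_norm hm]
  refine ⟨(hm.norm.pow 2), ?_⟩
  unfold HasFiniteIntegral
  refine lt_of_le_of_lt ?_ (ENNReal.ofReal_lt_top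
    (r := ω₁ ^ 2 * ‖gradient (expObj P F) x‖ ^ 2 + ω₂ ^ 2))
  refine le_trans (le_of_eq ?_) (h.gradErr x hx)
  refine lintegral_congr fun ξ => ?_
  rw [enorm_sq_eq_ofReal, norm_sub_rev, Real.enorm_eq_ofReal (by positivity)]

theorem ExpAssumptions.integrable_gradient [IsProbabilityMeasure P]
    (h : ExpAssumptions P F χ ω₁ ω₂ εG κG) {x : E n} (hx : x ∈ χ) :
    Integrable (fun ξ => gradient (fun y => F y ξ) x) P := by
  have := ((h.memLp hx).integrable (by norm_num)).add
    (integrable_const (gradient (expObj P F) x))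
  exact this.congr (Filter.Eventually.of_forall fun ξ => by simp)

/-- This crude O(1/N) bound, obtained from the uniform error, precedes the exact variance formula:
it identifies the mean of the sample gradients. -/
theorem ExpAssumptions.meanSqErr_le [IsProbabilityMeasure P]
    (h : ExpAssumptions P F χ ω₁ ω₂ εG κG) (hε : 0 < εG) {x : E n} (hx : x ∈ χ)
    {N : ℕ} (hN : 0 < N) :
    meanSqErr P F N x ≤
      ENNReal.ofReal (κG ^ 2 / N * (εG + ‖gradient (expObj P F) x‖) ^ 2) := by
  unfold meanSqErr
  calc _ ≤ ∫⁻ s : Fin N → Ξ, relErr (expObj P F) (empMean F N s) εG χ ^ 2 *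
        ENNReal.ofReal ((εG + ‖gradient (expObj P F) x‖) ^ 2) ∂(Measure.pi fun _ => P) := by
        refine lintegral_mono fun s => ?_
        rw [ENNReal.ofReal_pow (by positivity), ← mul_pow]
        exact pow_le_pow_left' (enorm_gradient_sub_le_relErr hε hx) 2
    _ = (∫⁻ s : Fin N → Ξ, relErr (expObj P F) (empMean F N s) εG χ ^ 2
          ∂(Measure.pi fun _ => P)) *
        ENNReal.ofReal ((εG + ‖gradient (expObj P F) x‖) ^ 2) :=
        lintegral_mul_const' _ _ ENNReal.ofReal_ne_top
    _ ≤ ENNReal.ofReal (κG ^ 2 / N) *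
        ENNReal.ofReal ((εG + ‖gradient (expObj P F) x‖) ^ 2) := by
        gcongr; exact h.clt N hN
    _ = _ := by rw [← ENNReal.ofReal_mul (by positivity)]

/-- Differentiation under the expectation. -/
theorem ExpAssumptions.integral_gradient [IsProbabilityMeasure P]
    (h : ExpAssumptions P F χ ω₁ ω₂ εG κG) (hε : 0 < εG) {x : E n} (hx : x ∈ χ) :
    ∫ ξ, gradient (fun y => F y ξ) x ∂P = gradient (expObj P F) x := by
  set g := gradient (expObj P F) x with hg
  set mean := ∫ ξ, gradient (fun y => F y ξ) x ∂P
  have hint := h.integrable_gradient hx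
  set B := εG + ‖g‖
  have hB : 0 ≤ B := by positivity
  -- No domination argument is involved. The sample gradient has the same mean for every N, and its
  -- mean distance to ∇f is O(1/√N), so the two vectors coincide in the limit.
  have key : ∀ N : ℕ, 0 < N → ‖g - mean‖ ≤ |κG| * B * (Real.sqrt N)⁻¹ := by
    intro N hN
    set ν : Measure (Fin N → Ξ) := Measure.pi fun _ => P
    have hNpos : (0 : ℝ) < N := by exact_mod_cast hN
    have hmp := fun i => measurePreserving_eval (fun _ : Fin N => P) i
    have hinti : ∀ i : Fin N, Integrable (fun s : Fin N → Ξ =>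
        gradient (fun y => F y (s i)) x) ν := fun i => (hmp i).integrable_comp_of_integrable hint
    have hmean : ∫ s, gradient (empMean F N s) x ∂ν = mean := by
      simp_rw [gradient_empMean h.smoothF]
      rw [integral_smul, integral_finsetSum _ fun i _ => hinti i]
      have : ∀ i : Fin N, ∫ s, gradient (fun y => F y (s i)) x ∂ν = mean := by
        intro i
        have := integral_map (μ := ν) (φ := Function.eval i) (hmp i).measurable.aemeasurable
          (f := fun ξ => gradient (fun y => F y ξ) x)
          (by rw [(hmp i).map_eq]; exact hint.aestronglyMeasurable)
        rw [(hmp i).map_eq] at this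
        exact this.symm
      simp only [this, Finset.sum_const, Finset.card_univ, Fintype.card_fin]
      rw [← Nat.cast_smul_eq_nsmul ℝ, smul_smul, inv_mul_cancel₀ hNpos.ne', one_smul]
    have hintE : Integrable (fun s : Fin N → Ξ => gradient (empMean F N s) x) ν := by
      simp_rw [gradient_empMean h.smoothF]
      exact (integrable_finsetSum _ fun i _ => hinti i).smul (N : ℝ)⁻¹
    have e : g - mean = ∫ s, (g - gradient (empMean F N s) x) ∂ν := by
      rw [integral_sub (integrable_const _) hintE, hmean]
      simp
    have h1 := enorm_integral_le_lintegral_enorm (μ := ν)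
      fun s : Fin N → Ξ => g - gradient (empMean F N s) x
    rw [← e] at h1
    have hm : Measurable fun s : Fin N → Ξ => ‖g - gradient (empMean F N s) x‖ₑ :=
      (measurable_const.sub ((measurable_gradient_empMean h.smoothF h.measurableF N).comp
        (measurable_const.prodMk measurable_id))).enorm
    have ht : 0 ≤ |κG| * B * (Real.sqrt N)⁻¹ := by positivity
    have h2 := lintegral_le_of_lintegral_sq_le hm.aemeasurable ht (by
      refine (h.meanSqErr_le hε hx hN).trans (ENNReal.ofReal_le_ofReal (le_of_eq ?_))
      rw [mul_pow, mul_pow, sq_abs, inv_pow, Real.sq_sqrt hNpos.le]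
      ring)
    have h3 := h1.trans h2
    rw [← ofReal_norm] at h3
    exact (ENNReal.ofReal_le_ofReal_iff ht).1 h3
  have hlim : Filter.Tendsto (fun N : ℕ => |κG| * B * (Real.sqrt N)⁻¹) Filter.atTop
      (nhds (|κG| * B * 0)) := by
    refine Filter.Tendsto.const_mul _ ?_
    exact tendsto_inv_atTop_zero.comp
      (Real.tendsto_sqrt_atTop.comp tendsto_natCast_atTop_atTop)
  rw [mul_zero] at hlim
  have h0 : ‖g - mean‖ ≤ 0 := ge_of_tendsto hlim
    ((Filter.eventually_gt_atTop 0).mono fun N hN => key N hN)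
  exact (sub_eq_zero.1 (norm_le_zero_iff.1 h0)).symm

theorem ExpAssumptions.gradVar_eq [IsProbabilityMeasure P]
    (h : ExpAssumptions P F χ ω₁ ω₂ εG κG) (hε : 0 < εG) {x : E n} (hx : x ∈ χ) :
    gradVar P F x =
      ∫ ξ, ‖gradient (fun y => F y ξ) x - gradient (expObj P F) x‖ ^ 2 ∂P := by
  unfold gradVar
  rw [h.integral_gradient hε hx]

theorem ExpAssumptions.gradVar_le [IsProbabilityMeasure P]
    (h : ExpAssumptions P F χ ω₁ ω₂ εG κG) (hε : 0 < εG) {x : E n} (hx : x ∈ χ) :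
    gradVar P F x ≤ ω₁ ^ 2 * ‖gradient (expObj P F) x‖ ^ 2 + ω₂ ^ 2 := by
  have h1 := h.gradErr x hx
  rw [h.gradVar_eq hε hx]
  refine (ENNReal.ofReal_le_ofReal_iff (by positivity)).1 (le_trans (le_of_eq ?_) h1)
  rw [ofReal_integral_eq_lintegral_ofReal (h.memLp hx).norm.integrable_sq
    (Filter.Eventually.of_forall fun _ => by positivity)]
  refine lintegral_congr fun ξ => ?_
  rw [enorm_sq_eq_ofReal, norm_sub_rev]

/-- The mean-square error of a sample gradient. -/
theorem ExpAssumptions.meanSqErr_eq [IsProbabilityMeasure P]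
    (h : ExpAssumptions P F χ ω₁ ω₂ εG κG) (hε : 0 < εG) {x : E n} (hx : x ∈ χ)
    {N : ℕ} (hN : 0 < N) : meanSqErr P F N x = ENNReal.ofReal (gradVar P F x / N) := by
  have hNpos : (0 : ℝ) < N := by exact_mod_cast hN
  set g := gradient (expObj P F) x with hg
  set Z : Ξ → E n := fun ξ => gradient (fun y => F y ξ) x - g with hZ
  have hmem : MemLp Z 2 P := h.memLp hx
  have h0 : ∫ ξ, Z ξ ∂P = 0 := by
    simp only [hZ]
    rw [integral_sub (h.integrable_gradient hx) (integrable_const _),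
      h.integral_gradient hε hx]
    simp [hg]
  set ν : Measure (Fin N → Ξ) := Measure.pi fun _ => P with hν
  have hsum := integral_norm_sq_sum_pi hmem h0 N
  have e : ∀ s : Fin N → Ξ, ‖g - gradient (empMean F N s) x‖ ^ 2 =
      ((N : ℝ)⁻¹) ^ 2 * ‖∑ i, Z (s i)‖ ^ 2 := by
    intro s
    have : gradient (empMean F N s) x - g = (N : ℝ)⁻¹ • ∑ i, Z (s i) := by
      simp only [hZ]
      rw [gradient_empMean h.smoothF, Finset.sum_sub_distrib, smul_sub, Finset.sum_const,
        Finset.card_univ, Fintype.card_fin, ← Nat.cast_smul_eq_nsmul ℝ, smul_smul,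
        inv_mul_cancel₀ hNpos.ne', one_smul]
    rw [norm_sub_rev, this, norm_smul, mul_pow, Real.norm_eq_abs, sq_abs]
  have hint : Integrable (fun s : Fin N → Ξ => ‖∑ i, Z (s i)‖ ^ 2) ν := by
    have : MemLp (fun s : Fin N → Ξ => ∑ i, Z (s i)) 2 ν :=
      memLp_finsetSum Finset.univ fun i _ =>
        hmem.comp_measurePreserving (measurePreserving_eval (fun _ : Fin N => P) i)
    exact this.norm.integrable_sq
  unfold meanSqErr
  simp_rw [enorm_sq_eq_ofReal]
  rw [← hg, ← ofReal_integral_eq_lintegral_ofReal _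
    (Filter.Eventually.of_forall fun _ => by positivity)]
  · congr 1
    simp_rw [e]
    rw [integral_const_mul, hsum, h.gradVar_eq hε hx]
    field_simp
    rfl
  · simp_rw [e]
    exact hint.const_mul _

end RASQP

namespace RASQP

variable {n m : ℕ} {Ξ : Type*} [MeasurableSpace Ξ] {P : Measure Ξ} {F : E n → Ξ → ℝ}
  {prm : Params} {κH μH M : ℝ} {L : ℝ≥0} {χ D : Set (E n)} {c : E n → E m}
  {ω₁ ω₂ εG κG κσ : ℝ}

/-! ### The expectation problem: sample paths -/

theorem SubsampledSmooth.max_zero {φ : E n → ℝ} (h : SubsampledSmooth L M χ D φ) :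
    SubsampledSmooth L (max M 0) χ D φ :=
  ⟨h.1, fun x hx => (h.2 x hx).trans (le_max_left _ _)⟩

theorem exp_sublinear (hc : ConstraintAssumptions c χ D) (prm : Params) (hκH : 0 < κH)
    (hμH : 0 < μH) (hεd : prm.εd ≤ μH) (hεfeas : Real.sqrt m * prm.εfeas < 1) (x0 : E n)
    (lam0 : E m) {Ξ : Type*} {F : E n → Ξ → ℝ} (hF : ∀ ξ, ContDiff ℝ 1 (fun x => F x ξ)) (L : ℝ≥0) (M : ℝ)
    (γbar εbar : ℝ) (hγ : γbar < 1) :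
    ∃ C : ℝ, 0 < C ∧ ∀ (b : ℕ → ℕ) (s : ℕ → ℕ → Ξ) (γ ε : ℕ → ℝ) (tr : Trace n m),
      let I : Input n m := ⟨c, fun k => empMean F (b k) (fun i => s k i), γ, ε, x0, lam0⟩
      (∀ k, SubsampledSmooth L M χ D (I.Φ k)) →
      (∀ k, 0 ≤ γ k ∧ γ k < 1 ∧ 0 ≤ ε k) →
      IsRun prm I tr → RunAssumptions prm κH μH χ D I tr →
      WellPosed I tr ∧
      ((StdDualRun I tr ∨ ∀ k, γ k ≤ γbar ∧ ε k ≤ εbar) → Sublinear C I tr) := by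
  obtain ⟨C, hC, hmain⟩ := exists_sublinear_constant hc prm hκH hμH hεd hεfeas lam0 L
    (le_max_right M 0) εbar hγ
  refine ⟨C, hC, ?_⟩
  intro b s γ ε tr I hsub hpar hrun hasm
  exact hmain I tr rfl rfl ⟨hrun, hasm, fun k => contDiff_empMean hF _ _,
    fun k => (hsub k).max_zero, hpar⟩

/-- Properties of a sample path of the algorithm for the expectation problem. -/
structure PathBounds (f : E n → ℝ) (χ : Set (E n)) (θ β ω γbar a B : ℝ) (b0 : ℕ) (b : ℕ → ℕ)
    (V : ℕ → ℝ) (I : Input n m) (tr : Trace n m) : Prop where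
  allTerminate : AllTerminate I tr
  mem : ∀ k, tr.x k 0 ∈ χ
  mem_end : ∀ k, tr.x k (innerCount I tr k) ∈ χ
  batch_pos : ∀ k, 0 < b k
  sqrt_le : ∀ k, Real.sqrt (V k / b k) ≤ θ * startErr f I tr k + a * β ^ k
  batch_le : ∀ k, (b k : ℝ) ≤ (1 + b0) * ((β ^ k)⁻¹) ^ 2
  innerCount_le : ∀ k, (innerCount I tr k : ℝ) ≤ B * ((β ^ k)⁻¹) ^ 2
  start : startErr f I tr 0 = kktErr f I.c I.x0 I.lam0
  succ : ∀ k, startErr f I tr (k + 1) = endErr f I tr k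
  recursion : ∀ k, startErr f I tr (k + 1) ≤ (γbar + ω * θ) * startErr f I tr k + ω * a * β ^ k
    + γbar * ‖gradient f (tr.x k 0) - gradient (I.Φ k) (tr.x k 0)‖
    + ‖gradient f (tr.x k (innerCount I tr k)) - gradient (I.Φ k) (tr.x k (innerCount I tr k))‖

/-- Everything here holds for a single realization; only the gradient errors at the two ends of an
inner loop are left to be averaged. The exact formula V/N for the mean-square error is used twice:
at the accepted batch size and at the size one smaller. -/
theorem exists_pathBounds [IsProbabilityMeasure P] (hc : ConstraintAssumptions c χ D)
    (prm : Params) (hκH : 0 < κH) (hμH : 0 < μH) (hεd : prm.εd ≤ μH)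
    (hεfeas : Real.sqrt m * prm.εfeas < 1) (x0 : E n) (lam0 : E m) (L : ℝ≥0) (M : ℝ)
    (hεG : 0 < εG) (hκG : 0 < κG) (hκσ : 0 < κσ) (hexp : ExpAssumptions P F χ ω₁ ω₂ εG κG)
    {θ β ω γbar κg : ℝ} {b0 : ℕ} (hθ : 0 ≤ θ) (hβ0 : 0 < β) (hβ1 : β < 1) (hω : 0 < ω)
    (hγ1 : γbar < 1) (hb0 : 0 < b0) :
    ∃ B : ℝ, 0 < B ∧ ∀ (b : ℕ → ℕ) (s : ℕ → ℕ → Ξ) (γ : ℕ → ℝ) (tr : Trace n m),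
      let f := expObj P F
      let a := Real.sqrt ((ω₁ ^ 2 * κg ^ 2 + ω₂ ^ 2) / b0)
      let I : Input n m := ⟨c, fun k => empMean F (b k) (fun i => s k i), γ,
        fun k => ω * Real.sqrt (gradVar P F (tr.x k 0) / b k), x0, lam0⟩
      (∀ k, 0 ≤ γ k ∧ γ k ≤ γbar) → IsRun prm I tr → RunAssumptions prm κH μH χ D I tr →
      (∀ k, SubsampledSmooth L M χ D (I.Φ k)) →
      (∀ k, ‖gradient f (tr.x k 0)‖ ≤ κg) →
      (∀ k, κG ^ 2 * κσ ^ 2 ≤ gradVar P F (tr.x k 0)) →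
      b 0 = b0 →
      (∀ k, 1 ≤ k → IsLeast {N : ℕ | 0 < N ∧ meanSqErr P F N (tr.x k 0) ≤
        ENNReal.ofReal (θ ^ 2 * startErr f I tr k ^ 2 + a ^ 2 * β ^ (2 * k))} (b k)) →
      PathBounds f χ θ β ω γbar a B b0 b (fun k => gradVar P F (tr.x k 0)) I tr := by
  set D2 := ω₁ ^ 2 * κg ^ 2 + ω₂ ^ 2 with hD2
  have hD20 : 0 ≤ D2 := by positivity
  obtain ⟨C₁, hC₁, hmain⟩ := exp_sublinear (F := F) hc prm hκH hμH hεd hεfeas x0 lam0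
    hexp.smoothF L M γbar (ω * Real.sqrt D2) hγ1
  refine ⟨C₁ / (ω ^ 2 * (κG ^ 2 * κσ ^ 2)) * (1 + b0), by positivity, ?_⟩
  intro b s γ tr f a I hγ hrun hasm hsub hgrad hvar hb hleast
  have hb0' : (0 : ℝ) < b0 := by exact_mod_cast hb0
  have hbpos : ∀ k, 0 < b k := by
    intro k
    rcases Nat.eq_zero_or_pos k with rfl | hk
    · rw [hb]; exact hb0
    · exact (hleast k hk).1.1
  have hbR : ∀ k, (1 : ℝ) ≤ b k := fun k => by exact_mod_cast hbpos k
  have hvpos : 0 < κG ^ 2 * κσ ^ 2 := by positivity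
  have hVpos : ∀ k, 0 < gradVar P F (tr.x k 0) := fun k => hvpos.trans_le (hvar k)
  have hεpos : ∀ k, 0 < I.ε k := fun k =>
    mul_pos hω (Real.sqrt_pos.2 (div_pos (hVpos k) (by linarith [hbR k])))
  obtain ⟨hwp, hsl⟩ := hmain b s γ I.ε tr hsub
    (fun k => ⟨(hγ k).1, (hγ k).2.trans_lt hγ1, (hεpos k).le⟩) hrun hasm
  have hterm : AllTerminate I tr := hwp.allTerminate_of_reached fun k _ => hεpos k
  have hmem : ∀ k, tr.x k 0 ∈ χ := fun k => hasm.iterates k 0 (hterm.reached_zero k)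
  have hVle : ∀ k, gradVar P F (tr.x k 0) ≤ D2 := by
    intro k
    refine (hexp.gradVar_le hεG (hmem k)).trans ?_
    have := pow_le_pow_left₀ (norm_nonneg _) (hgrad k) 2
    rw [hD2]
    gcongr
  have hsublin : Sublinear C₁ I tr := by
    refine hsl (Or.inr fun k => ⟨(hγ k).2, mul_le_mul_of_nonneg_left
      (Real.sqrt_le_sqrt ?_) hω.le⟩)
    exact (div_le_self (hVpos k).le (hbR k)).trans (hVle k)
  have ha2 : a ^ 2 = D2 / b0 := Real.sq_sqrt (by positivity)
  have ha0 : 0 ≤ a := Real.sqrt_nonneg _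
  have hR0 : ∀ k, 0 ≤ θ ^ 2 * startErr f I tr k ^ 2 + a ^ 2 * β ^ (2 * k) := fun k => by
    positivity
  have hVb : ∀ k, gradVar P F (tr.x k 0) / b k ≤
      θ ^ 2 * startErr f I tr k ^ 2 + a ^ 2 * β ^ (2 * k) := by
    intro k
    -- The initial batch size is prescribed, not selected by the norm test. The definition of a
    -- makes the bound hold for k = 0 as well.
    rcases Nat.eq_zero_or_pos k with rfl | hk
    · rw [hb, ha2]
      have h1 : gradVar P F (tr.x 0 0) / b0 ≤ D2 / b0 := by
        have := hVle 0
        gcongr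
      have h2 : 0 ≤ θ ^ 2 * startErr f I tr 0 ^ 2 := by positivity
      simpa using h1.trans (by linarith)
    · have h1 := (hleast k hk).1.2
      rw [hexp.meanSqErr_eq hεG (hmem k) (hbpos k)] at h1
      exact (ENNReal.ofReal_le_ofReal_iff (hR0 k)).1 h1
  have hsqrt : ∀ k, Real.sqrt (gradVar P F (tr.x k 0) / b k) ≤
      θ * startErr f I tr k + a * β ^ k := by
    intro k
    have hE := startErr_nonneg f I tr k
    have hbk := pow_pos hβ0 k
    refine Real.sqrt_le_iff.2 ⟨by positivity, (hVb k).trans ?_⟩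
    have : 0 ≤ 2 * (θ * startErr f I tr k) * (a * β ^ k) := by positivity
    rw [pow_mul']
    nlinarith
  have hinv : ∀ k, 1 ≤ ((β ^ k)⁻¹) ^ 2 := fun k =>
    one_le_pow₀ ((one_le_inv₀ (pow_pos hβ0 k)).2 (pow_le_one₀ hβ0.le hβ1.le))
  have hbatch : ∀ k, (b k : ℝ) ≤ (1 + b0) * ((β ^ k)⁻¹) ^ 2 := by
    intro k
    have hi := hinv k
    rcases Nat.eq_zero_or_pos k with rfl | hk
    · rw [hb]; simp
    · rcases Nat.lt_or_ge 1 (b k) with h2 | h2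
      -- The size N = b_k - 1 fails the norm test, which gives N < b₀β⁻²ᵏ. For b_k = 1 there is no
      -- smaller admissible size, and the bound is trivial.
      · obtain ⟨N, hN⟩ : ∃ N, b k = N + 1 := ⟨b k - 1, by omega⟩
        have hNpos : 0 < N := by omega
        have hNR : (0 : ℝ) < N := by exact_mod_cast hNpos
        have hnot : N ∉ {N : ℕ | 0 < N ∧ meanSqErr P F N (tr.x k 0) ≤
            ENNReal.ofReal (θ ^ 2 * startErr f I tr k ^ 2 + a ^ 2 * β ^ (2 * k))} := by
          intro hmemN
          have := (hleast k hk).2 hmemN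
          omega
        have h3 : θ ^ 2 * startErr f I tr k ^ 2 + a ^ 2 * β ^ (2 * k) <
            gradVar P F (tr.x k 0) / N := by
          by_contra! h
          refine hnot ⟨hNpos, ?_⟩
          rw [hexp.meanSqErr_eq hεG (hmem k) hNpos]
          exact ENNReal.ofReal_le_ofReal h
        have h4 : a ^ 2 * β ^ (2 * k) < D2 / N := by
          have h5 : 0 ≤ θ ^ 2 * startErr f I tr k ^ 2 := by positivity
          have h6 : gradVar P F (tr.x k 0) / N ≤ D2 / N := by
            have := hVle k
            gcongr
          linarith
        have hD2pos : 0 < D2 := (hVpos k).trans_le (hVle k)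
        have hβk : 0 < β ^ k := pow_pos hβ0 k
        rw [ha2, pow_mul', lt_div_iff₀ hNR] at h4
        have h7 : (N : ℝ) ≤ b0 * ((β ^ k)⁻¹) ^ 2 := by
          rw [inv_pow, ← div_eq_mul_inv, le_div_iff₀ (by positivity)]
          have h8 : D2 * (N * (β ^ k) ^ 2) < D2 * b0 := by
            calc D2 * (N * (β ^ k) ^ 2) = (D2 / b0 * (β ^ k) ^ 2 * N) * b0 := by
                  field_simp
              _ < D2 * b0 := by gcongr
          exact (lt_of_mul_lt_mul_left h8 hD2pos.le).le
        rw [hN]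
        push_cast
        linarith
      · have h3 : b k = 1 := le_antisymm h2 (hbpos k)
        rw [h3]
        push_cast
        nlinarith
  refine ⟨hterm, hmem, fun k => hasm.iterates k _ (hterm.reached_innerCount k), hbpos, hsqrt,
    hbatch, ?_, startErr_zero hrun f, hterm.startErr_succ hrun f, ?_⟩
  · intro k
    have hbk0 : (0 : ℝ) < b k := by linarith [hbR k]
    have hVk := hVpos k
    have h1 := hterm.innerCount_le hsublin (hγ k).1 (hεpos k) le_rfl
    -- Since V_k is bounded below, ε_k⁻² is at most a multiple of b_k, so the inner count inherits
    -- the growth rate of the batch size.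
    have h2 : I.ε k ^ 2 = ω ^ 2 * (gradVar P F (tr.x k 0) / b k) := by
      change (ω * Real.sqrt (gradVar P F (tr.x k 0) / b k)) ^ 2 = _
      rw [mul_pow, Real.sq_sqrt (by positivity)]
    rw [h2] at h1
    calc (innerCount I tr k : ℝ) ≤ C₁ / (ω ^ 2 * (gradVar P F (tr.x k 0) / b k)) := h1
      _ = C₁ / (ω ^ 2 * gradVar P F (tr.x k 0)) * b k := by field_simp
      _ ≤ C₁ / (ω ^ 2 * (κG ^ 2 * κσ ^ 2)) * ((1 + b0) * ((β ^ k)⁻¹) ^ 2) := by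
        gcongr
        · exact hvar k
        · exact hbatch k
      _ = _ := by ring
  · intro k
    rw [hterm.startErr_succ hrun f k]
    have h1 := hterm.endErr_le hrun f (hγ k).1
    have hE := startErr_nonneg f I tr k
    have h2 : I.γ k * (startErr f I tr k +
        ‖gradient f (tr.x k 0) - gradient (I.Φ k) (tr.x k 0)‖) ≤
        γbar * (startErr f I tr k + ‖gradient f (tr.x k 0) - gradient (I.Φ k) (tr.x k 0)‖) :=
      mul_le_mul_of_nonneg_right (hγ k).2 (by positivity)
    have h3 : I.ε k ≤ ω * (θ * startErr f I tr k + a * β ^ k) :=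
      mul_le_mul_of_nonneg_left (hsqrt k) hω.le
    linarith

/-! ### The expectation problem: conditioning on the past -/

section Sampling

variable {Ω : Type*} [mΩ : MeasurableSpace Ω] {μ : Measure Ω} [IsProbabilityMeasure μ]
  {𝓕 : Filtration ℕ mΩ} {ξ : ℕ → ℕ → Ω → Ξ} {b : ℕ → Ω → ℕ} {tr : Ω → Trace n m}
  {H : (N : ℕ) → E n → (Fin N → Ξ) → ℝ≥0∞}

/-- The batch size is random, so the type of the sample vector varies. Viewing it as the initial
segment of an infinite sequence gives one fixed measurable space, and countability of ℕ handles the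
size. -/
theorem measurable_sample_of_size
    (hH : ∀ N, Measurable fun p : E n × (Fin N → Ξ) => H N p.1 p.2) :
    Measurable fun q : (ℕ × E n) × (ℕ → Ξ) => H q.1.1 q.1.2 fun i => q.2 i := by
  have h1 : Measurable fun q : ℕ × (E n × (ℕ → Ξ)) => H q.1 q.2.1 fun i => q.2.2 i :=
    measurable_from_prod_countable_right fun N => (hH N).comp
      (measurable_fst.prodMk (measurable_pi_lambda _ fun i : Fin N =>
        (measurable_pi_apply (i : ℕ)).comp measurable_snd))
  exact h1.comp (MeasurableEquiv.prodAssoc (α := ℕ) (β := E n) (γ := ℕ → Ξ)).measurable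

theorem Sampling.measurable_ξ {Ω : Type*} [mΩ : MeasurableSpace Ω] {μ : Measure Ω}
    {𝓕 : Filtration ℕ mΩ} {ξ : ℕ → ℕ → Ω → Ξ} {b : ℕ → Ω → ℕ} {tr : Ω → Trace n m}
    (hS : Sampling μ P 𝓕 ξ b tr) (k i : ℕ) : Measurable (ξ k i) :=
  (hS.adapted k i).mono (𝓕.le _) le_rfl

theorem Sampling.measurable_sample {Ω : Type*} [mΩ : MeasurableSpace Ω] {μ : Measure Ω}
    {𝓕 : Filtration ℕ mΩ} {ξ : ℕ → ℕ → Ω → Ξ} {b : ℕ → Ω → ℕ} {tr : Ω → Trace n m}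
    (hS : Sampling μ P 𝓕 ξ b tr)
    (hH : ∀ N, Measurable fun p : E n × (Fin N → Ξ) => H N p.1 p.2) (k : ℕ) :
    Measurable fun w => H (b k w) ((tr w).x k 0) fun i => ξ k i w := by
  have hY : Measurable fun w => (b k w, (tr w).x k 0) :=
    ((hS.batch k).mono (𝓕.le _) le_rfl).prodMk ((hS.outer k).mono (𝓕.le _) le_rfl)
  have hSm : Measurable fun w => fun i => ξ k i w :=
    measurable_pi_lambda _ fun i => hS.measurable_ξ k i
  exact (measurable_sample_of_size hH).comp (hY.prodMk hSm)

/-- The samples can be integrated out, given the batch size and the iterate. -/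
theorem Sampling.lintegral_sample (hS : Sampling μ P 𝓕 ξ b tr)
    (hH : ∀ N, Measurable fun p : E n × (Fin N → Ξ) => H N p.1 p.2) (k : ℕ) :
    ∫⁻ w, H (b k w) ((tr w).x k 0) (fun i => ξ k i w) ∂μ =
      ∫⁻ w, ∫⁻ s, H (b k w) ((tr w).x k 0) s ∂(Measure.pi fun _ => P) ∂μ := by
  set Y : Ω → ℕ × E n := fun w => (b k w, (tr w).x k 0) with hYdef
  set S : Ω → ℕ → Ξ := fun w i => ξ k i w with hSdef
  have hY' : Measurable[𝓕 k] Y := (hS.batch k).prodMk (hS.outer k)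
  have hY : Measurable Y := hY'.mono (𝓕.le _) le_rfl
  have hSm : Measurable S := measurable_pi_lambda _ fun i => hS.measurable_ξ k i
  -- The pair of batch size and iterate is determined by the past, hence independent of the whole
  -- sample sequence; the joint law is then a product, and Tonelli's theorem applies.
  have hind : IndepFun Y S μ := by
    rw [IndepFun_iff_Indep]
    refine indep_of_indep_of_le_left (indep_of_indep_of_le_right (hS.indep_past k).symm ?_) ?_
    · rw [MeasurableSpace.pi, MeasurableSpace.comap_iSup]
      refine iSup_mono fun i => ?_
      rw [MeasurableSpace.comap_comp]
      exact le_rfl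
    · exact hY'.comap_le
  have hmap := (indepFun_iff_map_prod_eq_prod_map_map hY.aemeasurable hSm.aemeasurable).1 hind
  have hM := measurable_sample_of_size hH
  have hpi : ∀ N, Measure.map (fun w => fun i : Fin N => ξ k i w) μ =
      Measure.pi fun _ : Fin N => P := by
    intro N
    have h1 : iIndepFun (fun i : Fin N => ξ k i) μ :=
      (hS.iid k).precomp (g := fun i : Fin N => (i : ℕ)) Fin.val_injective
    rw [(iIndepFun_iff_map_fun_eq_pi_map (f := fun i : Fin N => ξ k i) fun i => (hS.measurable_ξ k i).aemeasurable).1 h1]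
    simp [hS.law]
  have : IsProbabilityMeasure (Measure.map S μ) :=
    Measure.isProbabilityMeasure_map hSm.aemeasurable
  calc ∫⁻ w, H (b k w) ((tr w).x k 0) (fun i => ξ k i w) ∂μ
      = ∫⁻ q, H q.1.1 q.1.2 (fun i => q.2 i) ∂(Measure.map (fun w => (Y w, S w)) μ) :=
        (lintegral_map hM (hY.prodMk hSm)).symm
    _ = ∫⁻ y, ∫⁻ s, H y.1 y.2 (fun i => s i) ∂(Measure.map S μ) ∂(Measure.map Y μ) := by
        rw [hmap, lintegral_prod _ hM.aemeasurable]
    _ = ∫⁻ w, ∫⁻ s, H (b k w) ((tr w).x k 0) (fun i => s i) ∂(Measure.map S μ) ∂μ :=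
        lintegral_map hM.lintegral_prod_right' hY
    _ = _ := by
        refine lintegral_congr fun w => ?_
        have hg : Measurable fun s : ℕ → Ξ => H (b k w) ((tr w).x k 0) fun i => s i :=
          hM.comp (measurable_const.prodMk measurable_id :
            Measurable fun s : ℕ → Ξ => (((b k w, (tr w).x k 0) : ℕ × E n), s))
        have hg' : Measurable (H (b k w) ((tr w).x k 0)) :=
          (hH (b k w)).comp (measurable_const.prodMk measurable_id :
            Measurable fun s : Fin (b k w) → Ξ => ((tr w).x k 0, s))
        rw [← hpi]
        exact (lintegral_map hg hSm).trans (lintegral_map hg'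
          (measurable_pi_lambda _ fun i => hS.measurable_ξ k i)).symm

end Sampling

/-- The real sequence that satisfies the recursion with equality dominates u. Finiteness of all
terms thus follows along with the rate. -/
theorem le_ofReal_of_recursion {u : ℕ → ℝ≥0∞} {u0 q β A : ℝ} (h0 : u 0 ≤ ENNReal.ofReal u0)
    (hu0 : 0 ≤ u0) (hq : 0 ≤ q) (hqβ : q < β) (hA : 0 ≤ A)
    (h : ∀ k, u (k + 1) ≤ ENNReal.ofReal q * u k + ENNReal.ofReal (A * β ^ k)) (k : ℕ) :
    u k ≤ ENNReal.ofReal (max u0 (A / (β - q)) * β ^ k) := by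
  have hβ : 0 < β := hq.trans_lt hqβ
  let v : ℕ → ℝ := fun k => Nat.rec u0 (fun k v => q * v + A * β ^ k) k
  have hv : ∀ k, 0 ≤ v k ∧ u k ≤ ENNReal.ofReal (v k) := by
    intro k
    induction k with
    | zero => exact ⟨hu0, h0⟩
    | succ k ih =>
      have h1 : 0 ≤ A * β ^ k := mul_nonneg hA (pow_pos hβ k).le
      have h2 : 0 ≤ q * v k := mul_nonneg hq ih.1
      refine ⟨add_nonneg h2 h1, (h k).trans ?_⟩
      change _ ≤ ENNReal.ofReal (q * v k + A * β ^ k)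
      rw [ENNReal.ofReal_add h2 h1, ENNReal.ofReal_mul hq]
      gcongr
      exact ih.2
  exact (hv k).2.trans (ENNReal.ofReal_le_ofReal
    (le_mul_pow_of_recursion (u := v) hq hqβ (fun _ => le_rfl) k))

end RASQP

namespace RASQP

variable {n m : ℕ} {Ξ : Type*} [MeasurableSpace Ξ] {P : Measure Ξ} {F : E n → Ξ → ℝ}
  {prm : Params} {κH μH M : ℝ} {L : ℝ≥0} {χ D : Set (E n)} {c : E n → E m}
  {ω₁ ω₂ εG κG κσ : ℝ}

/-! ### The expectation problem: total expected work -/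

section Expected

variable {Ω : Type*} [mΩ : MeasurableSpace Ω] {μ : Measure Ω} [IsProbabilityMeasure μ]
  {𝓕 : Filtration ℕ mΩ} {ξ : ℕ → ℕ → Ω → Ξ} {b : ℕ → Ω → ℕ} {tr : Ω → Trace n m}

/-- The expected gradient error of the samples at the initial point of an outer iteration. -/
theorem Sampling.lintegral_gradient_error_le [IsProbabilityMeasure P]
    (hS : Sampling μ P 𝓕 ξ b tr) (hexp : ExpAssumptions P F χ ω₁ ω₂ εG κG) (hεG : 0 < εG)
    {k : ℕ} (hx : ∀ᵐ w ∂μ, (tr w).x k 0 ∈ χ) (hb : ∀ᵐ w ∂μ, 0 < b k w) :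
    ∫⁻ w, ‖gradient (expObj P F) ((tr w).x k 0) -
        gradient (empMean F (b k w) fun i => ξ k i w) ((tr w).x k 0)‖ₑ ∂μ ≤
      ∫⁻ w, ENNReal.ofReal (Real.sqrt (gradVar P F ((tr w).x k 0) / b k w)) ∂μ := by
  have hH : ∀ N, Measurable fun p : E n × (Fin N → Ξ) =>
      ‖gradient (expObj P F) p.1 - gradient (empMean F N p.2) p.1‖ₑ := fun N =>
    (((continuous_gradient hexp.smooth).measurable.comp measurable_fst).sub
      (measurable_gradient_empMean hexp.smoothF hexp.measurableF N)).enorm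
  rw [hS.lintegral_sample (H := fun N x s =>
    ‖gradient (expObj P F) x - gradient (empMean F N s) x‖ₑ) hH k]
  refine lintegral_mono_ae ?_
  filter_upwards [hx, hb] with w hxw hbw
  have hV : 0 ≤ gradVar P F ((tr w).x k 0) / b k w :=
    div_nonneg (integral_nonneg fun _ => by positivity) (Nat.cast_nonneg _)
  refine lintegral_le_of_lintegral_sq_le ((hH (b k w)).comp (measurable_const.prodMk measurable_id :
    Measurable fun s : Fin (b k w) → Ξ => ((tr w).x k 0, s))).aemeasurable (Real.sqrt_nonneg _) ?_
  rw [Real.sq_sqrt hV]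
  exact (hexp.meanSqErr_eq hεG hxw hbw).le

/-- The expected uniform relative gradient error. -/
theorem Sampling.lintegral_relErr_le [IsProbabilityMeasure P]
    (hS : Sampling μ P 𝓕 ξ b tr) (hexp : ExpAssumptions P F χ ω₁ ω₂ εG κG) (hεG : 0 < εG)
    (hκG : 0 < κG) {k : ℕ} (hb : ∀ᵐ w ∂μ, 0 < b k w) :
    ∫⁻ w, relErr (expObj P F) (empMean F (b k w) fun i => ξ k i w) εG χ ∂μ ≤
      ∫⁻ w, ENNReal.ofReal (κG / Real.sqrt (b k w)) ∂μ := by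
  have hr : ∀ N, Measurable fun s : Fin N → Ξ => relErr (expObj P F) (empMean F N s) εG χ :=
    fun N => measurable_relErr hexp.smoothF hexp.measurableF hexp.smooth hεG N
  rw [hS.lintegral_sample (H := fun N _ s => relErr (expObj P F) (empMean F N s) εG χ)
    (fun N => (hr N).comp measurable_snd) k]
  refine lintegral_mono_ae ?_
  filter_upwards [hb] with w hbw
  refine lintegral_le_of_lintegral_sq_le (hr (b k w)).aemeasurable
    (div_nonneg hκG.le (Real.sqrt_nonneg _)) ?_
  rw [div_pow, Real.sq_sqrt (Nat.cast_nonneg _)]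
  exact hexp.clt _ hbw

/-- The expected KKT residuals decrease linearly, up to a geometric perturbation. -/
theorem Sampling.lintegral_endErr_le [IsProbabilityMeasure P]
    (hS : Sampling μ P 𝓕 ξ b tr) (hexp : ExpAssumptions P F χ ω₁ ω₂ εG κG) (hεG : 0 < εG)
    (hκG : 0 < κG) (hκσ : 0 < κσ) {θ β ω γbar κg a B : ℝ} {b0 : ℕ} (hθ : 0 ≤ θ) (hβ0 : 0 < β)
    (hω : 0 < ω) (hγ0 : 0 ≤ γbar) (hκg : 0 ≤ κg) (ha : 0 ≤ a) {I : Ω → Input n m}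
    (hΦ : ∀ w k, (I w).Φ k = empMean F (b k w) fun i => ξ k i w)
    (hpath : ∀ᵐ w ∂μ, PathBounds (expObj P F) χ θ β ω γbar a B b0 (fun k => b k w)
      (fun k => gradVar P F ((tr w).x k 0)) (I w) (tr w))
    (hrun : ∀ᵐ w ∂μ, IsRun prm (I w) (tr w))
    (hgrad : ∀ᵐ w ∂μ, ∀ k, ‖gradient (expObj P F) ((tr w).x k 0)‖ ≤ κg)
    (hvar : ∀ᵐ w ∂μ, ∀ k, κG ^ 2 * κσ ^ 2 ≤ gradVar P F ((tr w).x k 0)) (k : ℕ) :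
    ∫⁻ w, ENNReal.ofReal (startErr (expObj P F) (I w) (tr w) (k + 1)) ∂μ ≤
      ENNReal.ofReal (γbar + θ * (ω + (εG + κg) / κσ + γbar)) *
          ∫⁻ w, ENNReal.ofReal (startErr (expObj P F) (I w) (tr w) k) ∂μ +
        ENNReal.ofReal ((ω + (εG + κg) / κσ + γbar) * a * β ^ k) := by
  set f := expObj P F with hf
  have hβk : 0 < β ^ k := pow_pos hβ0 k
  set e := ∫⁻ w, ENNReal.ofReal (startErr f (I w) (tr w) k) ∂μ with he
  set Δ : Ω → ℝ≥0∞ := fun w => ‖gradient f ((tr w).x k 0) -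
        gradient (empMean F (b k w) fun i => ξ k i w) ((tr w).x k 0)‖ₑ with hΔ
  set G : Ω → ℝ≥0∞ := fun w => relErr f (empMean F (b k w) fun i => ξ k i w) εG χ with hG
  have hΔm : Measurable Δ := hS.measurable_sample (H := fun N x s =>
    ‖gradient f x - gradient (empMean F N s) x‖ₑ) (fun N =>
      (((continuous_gradient hexp.smooth).measurable.comp measurable_fst).sub
        (measurable_gradient_empMean hexp.smoothF hexp.measurableF N)).enorm) k
  have hGm : Measurable G := hS.measurable_sample
    (H := fun N _ s => relErr f (empMean F N s) εG χ) (fun N =>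
      (measurable_relErr hexp.smoothF hexp.measurableF hexp.smooth hεG N).comp measurable_snd) k
  have hlin : ∀ s t : ℝ, 0 ≤ s → 0 ≤ t →
      ∫⁻ w, ENNReal.ofReal (s * startErr f (I w) (tr w) k +
          t * (θ * startErr f (I w) (tr w) k + a * β ^ k)) ∂μ =
        ENNReal.ofReal (s + t * θ) * e + ENNReal.ofReal (t * a * β ^ k) := by
    intro s t hs ht
    have h1 : ∀ w, ENNReal.ofReal (s * startErr f (I w) (tr w) k +
          t * (θ * startErr f (I w) (tr w) k + a * β ^ k)) =
        ENNReal.ofReal (s + t * θ) * ENNReal.ofReal (startErr f (I w) (tr w) k) +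
          ENNReal.ofReal (t * a * β ^ k) := by
      intro w
      have hE := startErr_nonneg f (I w) (tr w) k
      rw [← ENNReal.ofReal_mul (by positivity), ← ENNReal.ofReal_add (by positivity)
        (by positivity)]
      congr 1; ring
    simp_rw [h1]
    rw [lintegral_add_right _ measurable_const, lintegral_const_mul' _ _ ENNReal.ofReal_ne_top]
    simp [he]
  have hb : ∀ᵐ w ∂μ, 0 < b k w := hpath.mono fun w h => h.batch_pos k
  have hΔle : ∫⁻ w, Δ w ∂μ ≤ ENNReal.ofReal θ * e + ENNReal.ofReal (a * β ^ k) := by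
    refine (hS.lintegral_gradient_error_le hexp hεG (hpath.mono fun w h => h.mem k) hb).trans ?_
    have := hlin 0 1 le_rfl zero_le_one
    simp only [zero_mul, zero_add, one_mul] at this
    rw [← this]
    exact lintegral_mono_ae (hpath.mono fun w h => ENNReal.ofReal_le_ofReal (h.sqrt_le k))
  -- The lower bound κ_Gκ_σ ≤ √V converts κ_G/√b into κ_σ⁻¹√(V/b), which the norm test controls.
  have hGle : ∫⁻ w, G w ∂μ ≤
      ENNReal.ofReal (κσ⁻¹ * θ) * e + ENNReal.ofReal (κσ⁻¹ * a * β ^ k) := by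
    refine (hS.lintegral_relErr_le hexp hεG hκG hb).trans ?_
    have := hlin 0 κσ⁻¹ le_rfl (inv_pos.2 hκσ).le
    simp only [zero_mul, zero_add] at this
    rw [← this]
    refine lintegral_mono_ae ?_
    filter_upwards [hpath, hvar, hb] with w hw hv hbw
    refine ENNReal.ofReal_le_ofReal (le_trans ?_
      (mul_le_mul_of_nonneg_left (hw.sqrt_le k) (inv_pos.2 hκσ).le))
    have hbR : (0 : ℝ) < b k w := by exact_mod_cast hbw
    have h1 : κG * κσ ≤ Real.sqrt (gradVar P F ((tr w).x k 0)) :=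
      Real.le_sqrt_of_sq_le (by rw [mul_pow]; exact hv k)
    rw [Real.sqrt_div' _ hbR.le, inv_mul_eq_div, div_div, mul_comm _ κσ, ← div_div]
    have h2 := Real.sqrt_pos.2 hbR
    gcongr
    rwa [le_div_iff₀ hκσ]
  have hpt : ∀ᵐ w ∂μ, ENNReal.ofReal (startErr f (I w) (tr w) (k + 1)) ≤
      ENNReal.ofReal (γbar * startErr f (I w) (tr w) k +
          ω * (θ * startErr f (I w) (tr w) k + a * β ^ k))
        + ENNReal.ofReal γbar * Δ w + G w * ENNReal.ofReal (εG + κg) := by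
    filter_upwards [hpath, hgrad, hrun] with w hw hg hr
    have hE := startErr_nonneg f (I w) (tr w) k
    have h1 := hw.recursion k
    -- The final iterate depends on the sample, so a pointwise second moment is unavailable and the
    -- supremum over χ is used. Since this iterate starts the next outer iteration, κ_g bounds the
    -- true gradient there.
    have h2 := enorm_gradient_sub_le_relErr (f := f)
      (φ := empMean F (b k w) fun i => ξ k i w) hεG (hw.mem_end k)
    have h3 : ‖gradient f ((tr w).x k (innerCount (I w) (tr w) k))‖ ≤ κg := by
      rw [← hw.allTerminate.x_succ hr]; exact hg (k + 1)
    have h4 : ‖gradient f ((tr w).x k (innerCount (I w) (tr w) k)) - gradient ((I w).Φ k)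
        ((tr w).x k (innerCount (I w) (tr w) k))‖ₑ ≤ G w * ENNReal.ofReal (εG + κg) := by
      rw [hΦ]
      refine h2.trans ?_
      gcongr
    refine (ENNReal.ofReal_le_ofReal h1).trans ?_
    rw [ENNReal.ofReal_add (by positivity) (norm_nonneg _), ofReal_norm,
      ENNReal.ofReal_add (by positivity) (by positivity), ENNReal.ofReal_mul hγ0, ofReal_norm]
    refine add_le_add (add_le_add (ENNReal.ofReal_le_ofReal (le_of_eq (by ring))) ?_) h4
    rw [hΦ]
  refine (lintegral_mono_ae hpt).trans ?_
  -- Splitting the integral this way asks for measurability of Δ and G only, not of the KKT errors.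
  rw [lintegral_add_right _ (hGm.mul_const _), lintegral_add_right _ (hΔm.const_mul _),
    hlin _ _ hγ0 hω.le,
    lintegral_const_mul _ hΔm, lintegral_mul_const _ hGm]
  have hκ : 0 ≤ εG + κg := by positivity
  calc _ ≤ ENNReal.ofReal (γbar + ω * θ) * e + ENNReal.ofReal (ω * a * β ^ k)
        + ENNReal.ofReal γbar * (ENNReal.ofReal θ * e + ENNReal.ofReal (a * β ^ k))
        + (ENNReal.ofReal (κσ⁻¹ * θ) * e + ENNReal.ofReal (κσ⁻¹ * a * β ^ k)) *
          ENNReal.ofReal (εG + κg) := by gcongr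
    _ = (ENNReal.ofReal (γbar + ω * θ) + ENNReal.ofReal γbar * ENNReal.ofReal θ +
          ENNReal.ofReal (κσ⁻¹ * θ) * ENNReal.ofReal (εG + κg)) * e +
        (ENNReal.ofReal (ω * a * β ^ k) + ENNReal.ofReal γbar * ENNReal.ofReal (a * β ^ k) +
          ENNReal.ofReal (κσ⁻¹ * a * β ^ k) * ENNReal.ofReal (εG + κg)) := by ring
    _ = _ := by
        rw [← ENNReal.ofReal_mul hγ0, ← ENNReal.ofReal_mul hγ0,
          ← ENNReal.ofReal_mul (by positivity), ← ENNReal.ofReal_mul (by positivity),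
          ← ENNReal.ofReal_add (by positivity) (by positivity),
          ← ENNReal.ofReal_add (by positivity) (by positivity),
          ← ENNReal.ofReal_add (by positivity) (by positivity),
          ← ENNReal.ofReal_add (by positivity) (by positivity)]
        congr 3 <;> ring

end Expected

theorem exp_complexity [IsProbabilityMeasure P] (hc : ConstraintAssumptions c χ D)
    (prm : Params) (hκH : 0 < κH) (hμH : 0 < μH) (hεd : prm.εd ≤ μH)
    (hεfeas : Real.sqrt m * prm.εfeas < 1) (x0 : E n) (lam0 : E m) (L : ℝ≥0) (M : ℝ)
    (hεG : 0 < εG) (hκG : 0 < κG) (hκσ : 0 < κσ) (hexp : ExpAssumptions P F χ ω₁ ω₂ εG κG)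
    {θ β ω γbar κg : ℝ} {b0 : ℕ} (hθ : 0 ≤ θ) (hβ0 : 0 < β) (hβ1 : β < 1) (hω : 0 < ω)
    (hγ0 : 0 ≤ γbar) (hκg : 0 ≤ κg) (hb0 : 0 < b0)
    (hrate : γbar + θ * (ω + (εG + κg) / κσ + γbar) < β) :
    ∃ C : ℝ, 0 < C ∧ ∀ (Ω : Type*) [mΩ : MeasurableSpace Ω] (μ : Measure Ω)
      [IsProbabilityMeasure μ] (𝓕 : Filtration ℕ mΩ)
      (ξ : ℕ → ℕ → Ω → Ξ) (b : ℕ → Ω → ℕ) (γ : ℕ → ℝ) (tr : Ω → Trace n m),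
      let f := expObj P F
      let a := Real.sqrt ((ω₁ ^ 2 * κg ^ 2 + ω₂ ^ 2) / b0)
      let I : Ω → Input n m := fun w =>
        ⟨c, fun k => empMean F (b k w) (fun i => ξ k i w), γ,
          fun k => ω * Real.sqrt (gradVar P F ((tr w).x k 0) / b k w), x0, lam0⟩
      Sampling μ P 𝓕 ξ b tr →
      (∀ k, 0 ≤ γ k ∧ γ k ≤ γbar) →
      (∀ᵐ w ∂μ, IsRun prm (I w) (tr w) ∧
        RunAssumptions prm κH μH χ D (I w) (tr w) ∧
        (∀ k, SubsampledSmooth L M χ D ((I w).Φ k)) ∧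
        (∀ k, ‖gradient f ((tr w).x k 0)‖ ≤ κg) ∧
        (∀ k, κG ^ 2 * κσ ^ 2 ≤ gradVar P F ((tr w).x k 0))) →
      (∀ᵐ w ∂μ, b 0 w = b0 ∧ ∀ k, 1 ≤ k →
        IsLeast {N : ℕ | 0 < N ∧ meanSqErr P F N ((tr w).x k 0) ≤
          ENNReal.ofReal (θ ^ 2 * startErr f (I w) (tr w) k ^ 2
            + a ^ 2 * β ^ (2 * k))} (b k w)) →
      (∀ᵐ w ∂μ, AllTerminate (I w) (tr w)) ∧
      ∀ e : ℝ, 0 < e → e ≤ 1 → ∃ K : ℕ,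
        ∫⁻ w, ENNReal.ofReal (endErr f (I w) (tr w) K) ∂μ ≤ ENNReal.ofReal e ∧
        ∑ k ∈ Finset.range (K + 1), ∫⁻ w, (innerCount (I w) (tr w) k : ENNReal) ∂μ ≤
          ENNReal.ofReal (C / e ^ 2) ∧
        ∑ k ∈ Finset.range (K + 1),
          ∫⁻ w, (b k w : ENNReal) * (innerCount (I w) (tr w) k : ENNReal) ∂μ ≤
          ENNReal.ofReal (C / e ^ 4) := by
  have hk0 : 0 ≤ (εG + κg) / κσ := by positivity
  have hq0 : 0 ≤ γbar + θ * (ω + (εG + κg) / κσ + γbar) := by positivity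
  have hγ1 : γbar < 1 := by
    have : 0 ≤ θ * (ω + (εG + κg) / κσ + γbar) := by positivity
    linarith
  obtain ⟨B, hB, hpathb⟩ := exists_pathBounds hc prm hκH hμH hεd hεfeas x0 lam0 L M hεG hκG hκσ
    hexp (κg := κg) hθ hβ0 hβ1 hω hγ1 hb0
  set u0 := kktErr (expObj P F) c x0 lam0 with hu0
  set A := (ω + (εG + κg) / κσ + γbar) * Real.sqrt ((ω₁ ^ 2 * κg ^ 2 + ω₂ ^ 2) / b0) with hA
  set B' := max u0 (A / (β - (γbar + θ * (ω + (εG + κg) / κσ + γbar)))) with hB'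
  have hA0 : 0 ≤ A := by positivity
  set C2 := B * ((1 - β ^ 2)⁻¹ * max B' 1 ^ 2) with hC2
  set C4 := (1 + b0) * B * ((1 - β ^ 4)⁻¹ * max B' 1 ^ 4) with hC4
  have hβ2 : 0 < 1 - β ^ 2 := sub_pos.2 (pow_lt_one₀ hβ0.le hβ1 (by norm_num))
  have hβ4 : 0 < 1 - β ^ 4 := sub_pos.2 (pow_lt_one₀ hβ0.le hβ1 (by norm_num))
  have hB1 : 0 < max B' 1 := lt_max_of_lt_right one_pos
  have hC2pos : 0 < C2 := by positivity
  have hC4pos : 0 < C4 := by positivity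
  -- One constant serves both bounds: C2 belongs to the linear systems and C4 to the gradient
  -- evaluations.
  refine ⟨C2 + C4, by positivity, ?_⟩
  intro Ω mΩ μ _ 𝓕 ξ b γ tr f a I hS hγ hall hbatch
  have hpath : ∀ᵐ w ∂μ, PathBounds f χ θ β ω γbar a B b0 (fun k => b k w)
      (fun k => gradVar P F ((tr w).x k 0)) (I w) (tr w) := by
    filter_upwards [hall, hbatch] with w h1 h2
    exact hpathb (fun k => b k w) (fun k i => ξ k i w) γ (tr w) hγ h1.1 h1.2.1 h1.2.2.1
      h1.2.2.2.1 h1.2.2.2.2 h2.1 h2.2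
  have ha : 0 ≤ a := Real.sqrt_nonneg _
  have hstart : ∫⁻ w, ENNReal.ofReal (startErr f (I w) (tr w) 0) ∂μ ≤ ENNReal.ofReal u0 := by
    calc _ ≤ ∫⁻ _, ENNReal.ofReal u0 ∂μ :=
          lintegral_mono_ae (hpath.mono fun w h => by rw [h.start])
      _ = _ := by simp
  have hlin := le_ofReal_of_recursion
    (u := fun k => ∫⁻ w, ENNReal.ofReal (startErr f (I w) (tr w) k) ∂μ) hstart
    (kktErr_nonneg _ _ _ _) hq0 hrate hA0
    (fun k => hS.lintegral_endErr_le hexp hεG hκG hκσ hθ hβ0 hω hγ0 hκg ha (fun _ _ => rfl) hpath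
      (hall.mono fun w h => h.1) (hall.mono fun w h => h.2.2.2.1)
      (hall.mono fun w h => h.2.2.2.2) k)
  have hcount : ∀ k, ∫⁻ w, (innerCount (I w) (tr w) k : ENNReal) ∂μ ≤
      ENNReal.ofReal (B * ((β ^ k)⁻¹) ^ 2) := by
    intro k
    calc _ ≤ ∫⁻ _, ENNReal.ofReal (B * ((β ^ k)⁻¹) ^ 2) ∂μ := by
          refine lintegral_mono_ae (hpath.mono fun w h => ?_)
          rw [← ENNReal.ofReal_natCast]
          exact ENNReal.ofReal_le_ofReal (h.innerCount_le k)
      _ = _ := by simp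
  have hwork : ∀ k, ∫⁻ w, (b k w : ENNReal) * (innerCount (I w) (tr w) k : ENNReal) ∂μ ≤
      ENNReal.ofReal ((1 + b0) * B * ((β ^ k)⁻¹) ^ 4) := by
    intro k
    have hβk : 0 < β ^ k := pow_pos hβ0 k
    calc _ ≤ ∫⁻ _, ENNReal.ofReal ((1 + b0) * B * ((β ^ k)⁻¹) ^ 4) ∂μ := by
          refine lintegral_mono_ae (hpath.mono fun w h => ?_)
          rw [← ENNReal.ofReal_natCast, ← ENNReal.ofReal_natCast,
            ← ENNReal.ofReal_mul (Nat.cast_nonneg _)]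
          refine ENNReal.ofReal_le_ofReal ?_
          calc _ ≤ ((1 + b0) * ((β ^ k)⁻¹) ^ 2) * (B * ((β ^ k)⁻¹) ^ 2) :=
                mul_le_mul (h.batch_le k) (h.innerCount_le k) (Nat.cast_nonneg _) (by positivity)
            _ = _ := by ring
      _ = _ := by simp
  refine ⟨hpath.mono fun w h => h.allTerminate, fun e he he1 => ?_⟩
  obtain ⟨K, hK1, hK2⟩ := exists_stop_index (B := B') hβ0 hβ1 he he1
  refine ⟨K, ?_, ?_, ?_⟩
  · calc _ = ∫⁻ w, ENNReal.ofReal (startErr f (I w) (tr w) (K + 1)) ∂μ :=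
          lintegral_congr_ae (hpath.mono fun w h => by simp only [h.succ K])
      _ ≤ _ := (hlin (K + 1)).trans (ENNReal.ofReal_le_ofReal hK1)
  · refine (Finset.sum_le_sum fun k _ => hcount k).trans ?_
    have hβk : ∀ k, 0 < β ^ k := fun k => pow_pos hβ0 k
    rw [← ENNReal.ofReal_sum_of_nonneg fun k _ => by have := hβk k; positivity]
    refine ENNReal.ofReal_le_ofReal ?_
    rw [← Finset.mul_sum]
    calc _ ≤ B * ((1 - β ^ 2)⁻¹ * max B' 1 ^ 2 / e ^ 2) := by
          gcongr
          exact sum_inv_pow_le_div hβ0 hβ1 two_ne_zero hK2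
      _ = C2 / e ^ 2 := by rw [hC2]; ring
      _ ≤ _ := by gcongr; linarith
  · refine (Finset.sum_le_sum fun k _ => hwork k).trans ?_
    have hβk : ∀ k, 0 < β ^ k := fun k => pow_pos hβ0 k
    rw [← ENNReal.ofReal_sum_of_nonneg fun k _ => by have := hβk k; positivity]
    refine ENNReal.ofReal_le_ofReal ?_
    rw [← Finset.mul_sum]
    calc _ ≤ (1 + b0) * B * ((1 - β ^ 4)⁻¹ * max B' 1 ^ 4 / e ^ 4) := by
          gcongr
          exact sum_inv_pow_le_div hβ0 hβ1 four_ne_zero hK2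
      _ = C4 / e ^ 4 := by rw [hC4]; ring
      _ ≤ _ := by gcongr; linarith

end RASQP

/-! ### The theorem for both problem classes. -/

theorem mainTheorem2 {n m : ℕ} (c : RASQP.E n → RASQP.E m) (χ D : Set (RASQP.E n))
    (hc : RASQP.ConstraintAssumptions c χ D)
    (prm : RASQP.Params) (κH μH : ℝ) (hκH : 0 < κH) (hμH : 0 < μH)
    (hεd : prm.εd ≤ μH) (hεfeas : Real.sqrt m * prm.εfeas < 1)
    (x0 : RASQP.E n) (lam0 : RASQP.E m) :
    -- the finite-sum problem
    (∀ (ι : Type*) [Fintype ι] [Nonempty ι] (F : RASQP.E n → ι → ℝ) (ω₁ ω₂ : ℝ),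
      0 ≤ ω₁ → 0 ≤ ω₂ → RASQP.FinSumAssumptions F χ ω₁ ω₂ →
      -- well-posedness and sublinear convergence of the inner loop
      (∀ γbar εbar : ℝ, γbar < 1 →
        ∃ C : ℝ, 0 < C ∧ ∀ (S : ℕ → Finset ι) (γ ε : ℕ → ℝ) (tr : RASQP.Trace n m),
          let I : RASQP.Input n m := ⟨c, fun k => RASQP.sampleMean F (S k), γ, ε, x0, lam0⟩
          (∀ k, (S k).Nonempty) →
          (∀ k, ∃ L : NNReal, LipschitzOnWith L (gradient (RASQP.sampleMean F (S k))) D) →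
          (∀ k, 0 ≤ γ k ∧ γ k < 1 ∧ 0 ≤ ε k) →
          RASQP.IsRun prm I tr → RASQP.RunAssumptions prm κH μH χ D I tr →
          RASQP.WellPosed I tr ∧
          ((RASQP.StdDualRun I tr ∨ ∀ k, γ k ≤ γbar ∧ ε k ≤ εbar) → RASQP.Sublinear C I tr)) ∧
      -- total work
      (∀ θ θh a β ω ωh γbar : ℝ, 0 ≤ θ → 0 ≤ θh → 0 ≤ a → 0 < β → β < 1 → 0 < ω → 0 < ωh →
        0 ≤ γbar → γbar + θ * (ω + θh + γbar) < β →
        ∃ C : ℝ, 0 < C ∧ ∀ (S : ℕ → Finset ι) (γ : ℕ → ℝ) (tr : RASQP.Trace n m),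
          let I : RASQP.Input n m := ⟨c, fun k => RASQP.sampleMean F (S k), γ,
            fun k => ω * ‖gradient (RASQP.finObj F) (tr.x k 0)
                - gradient (RASQP.sampleMean F (S k)) (tr.x k 0)‖ + ωh * β ^ k, x0, lam0⟩
          (∀ k, (S k).Nonempty) →
          (∀ k, ∃ L : NNReal, LipschitzOnWith L (gradient (RASQP.sampleMean F (S k))) D) →
          (∀ k, 0 ≤ γ k ∧ γ k ≤ γbar) →
          RASQP.IsRun prm I tr → RASQP.RunAssumptions prm κH μH χ D I tr →
          (∀ k, RASQP.FinNormTest (RASQP.finObj F) θ θh a β I tr k) →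
          RASQP.AllTerminate I tr ∧
          ∀ e : ℝ, 0 < e → e ≤ 1 → ∃ K : ℕ,
            RASQP.endErr (RASQP.finObj F) I tr K ≤ e ∧
            ∑ k ∈ Finset.range (K + 1), (RASQP.innerCount I tr k : ℝ) ≤ C / e ^ 2 ∧
            ∑ k ∈ Finset.range (K + 1), ((S k).card : ℝ) * RASQP.innerCount I tr k ≤
              C * Fintype.card ι / e ^ 2)) ∧
    -- the expectation problem
    (∀ (Ξ : Type*) [MeasurableSpace Ξ] (P : MeasureTheory.Measure Ξ)
      [MeasureTheory.IsProbabilityMeasure P] (F : RASQP.E n → Ξ → ℝ)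
      (ω₁ ω₂ εG κG κσ : ℝ) (L : NNReal) (M : ℝ),
      0 ≤ ω₁ → 0 ≤ ω₂ → 0 < εG → 0 < κG → 0 < κσ →
      RASQP.ExpAssumptions P F χ ω₁ ω₂ εG κG →
      -- well-posedness and sublinear convergence of the inner loop
      (∀ γbar εbar : ℝ, γbar < 1 →
        ∃ C : ℝ, 0 < C ∧ ∀ (b : ℕ → ℕ) (s : ℕ → ℕ → Ξ) (γ ε : ℕ → ℝ) (tr : RASQP.Trace n m),
          let I : RASQP.Input n m :=
            ⟨c, fun k => RASQP.empMean F (b k) (fun i => s k i), γ, ε, x0, lam0⟩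
          (∀ k, 0 < b k) → (∀ k, RASQP.SubsampledSmooth L M χ D (I.Φ k)) →
          (∀ k, 0 ≤ γ k ∧ γ k < 1 ∧ 0 ≤ ε k) →
          RASQP.IsRun prm I tr → RASQP.RunAssumptions prm κH μH χ D I tr →
          RASQP.WellPosed I tr ∧
          ((RASQP.StdDualRun I tr ∨ ∀ k, γ k ≤ γbar ∧ ε k ≤ εbar) → RASQP.Sublinear C I tr)) ∧
      -- total expected work
      (∀ (θ β ω γbar κg : ℝ) (b0 : ℕ), 0 ≤ θ → 0 < β → β < 1 → 0 < ω → 0 ≤ γbar → 0 ≤ κg →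
        0 < b0 → γbar + θ * (ω + (εG + κg) / κσ + γbar) < β →
        ∃ C : ℝ, 0 < C ∧ ∀ (Ω : Type*) [mΩ : MeasurableSpace Ω] (μ : MeasureTheory.Measure Ω)
          [MeasureTheory.IsProbabilityMeasure μ] (𝓕 : MeasureTheory.Filtration ℕ mΩ)
          (ξ : ℕ → ℕ → Ω → Ξ) (b : ℕ → Ω → ℕ) (γ : ℕ → ℝ) (tr : Ω → RASQP.Trace n m),
          let f := RASQP.expObj P F
          let a := Real.sqrt ((ω₁ ^ 2 * κg ^ 2 + ω₂ ^ 2) / b0)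
          let I : Ω → RASQP.Input n m := fun w =>
            ⟨c, fun k => RASQP.empMean F (b k w) (fun i => ξ k i w), γ,
              fun k => ω * Real.sqrt (RASQP.gradVar P F ((tr w).x k 0) / b k w), x0, lam0⟩
          RASQP.Sampling μ P 𝓕 ξ b tr →
          (∀ k, 0 ≤ γ k ∧ γ k ≤ γbar) →
          (∀ᵐ w ∂μ, RASQP.IsRun prm (I w) (tr w) ∧
            RASQP.RunAssumptions prm κH μH χ D (I w) (tr w) ∧
            (∀ k, RASQP.SubsampledSmooth L M χ D ((I w).Φ k)) ∧
            (∀ k, ‖gradient f ((tr w).x k 0)‖ ≤ κg) ∧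
            (∀ k, κG ^ 2 * κσ ^ 2 ≤ RASQP.gradVar P F ((tr w).x k 0))) →
          -- the initial batch size is `b0`; later ones are the smallest that pass the norm test
          (∀ᵐ w ∂μ, b 0 w = b0 ∧ ∀ k, 1 ≤ k →
            IsLeast {N : ℕ | 0 < N ∧ RASQP.meanSqErr P F N ((tr w).x k 0) ≤
              ENNReal.ofReal (θ ^ 2 * RASQP.startErr f (I w) (tr w) k ^ 2
                + a ^ 2 * β ^ (2 * k))} (b k w)) →
          (∀ᵐ w ∂μ, RASQP.AllTerminate (I w) (tr w)) ∧
          ∀ e : ℝ, 0 < e → e ≤ 1 → ∃ K : ℕ,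
            ∫⁻ w, ENNReal.ofReal (RASQP.endErr f (I w) (tr w) K) ∂μ ≤ ENNReal.ofReal e ∧
            ∑ k ∈ Finset.range (K + 1), ∫⁻ w, (RASQP.innerCount (I w) (tr w) k : ENNReal) ∂μ ≤
              ENNReal.ofReal (C / e ^ 2) ∧
            ∑ k ∈ Finset.range (K + 1),
              ∫⁻ w, (b k w : ENNReal) * (RASQP.innerCount (I w) (tr w) k : ENNReal) ∂μ ≤
              ENNReal.ofReal (C / e ^ 4))) := by
  refine ⟨?_, ?_⟩
  · intro ι _ _ F ω₁ ω₂ _ _ hF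
    refine ⟨fun γbar εbar hγ => ?_, ?_⟩
    · obtain ⟨C, hC, hmain⟩ := RASQP.finSum_sublinear hc prm hκH hμH hεd hεfeas x0 lam0 hF.smooth
        γbar εbar hγ
      exact ⟨C, hC, fun S γ ε tr _ => hmain S γ ε tr⟩
    · intro θ θh a β ω ωh γbar hθ hθh ha hβ0 hβ1 hω hωh hγ0 hrate
      obtain ⟨C, hC, hmain⟩ := RASQP.finSum_complexity hc prm hκH hμH hεd hεfeas x0 lam0 hF.smooth
        hθ hθh ha hβ0 hβ1 hω hωh hγ0 hrate
      exact ⟨C, hC, fun S γ tr _ => hmain S γ tr⟩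
  · intro Ξ _ P _ F ω₁ ω₂ εG κG κσ L M _ _ hεG hκG hκσ hexp
    refine ⟨fun γbar εbar hγ => ?_, ?_⟩
    · obtain ⟨C, hC, hmain⟩ := RASQP.exp_sublinear hc prm hκH hμH hεd hεfeas x0 lam0 hexp.smoothF
        L M γbar εbar hγ
      exact ⟨C, hC, fun b s γ ε tr _ => hmain b s γ ε tr⟩
    · intro θ β ω γbar κg b0 hθ hβ0 hβ1 hω hγ0 hκg hb0 hrate
      exact RASQP.exp_complexity hc prm hκH hμH hεd hεfeas x0 lam0 L M hεG hκG hκσ hexp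
        hθ hβ0 hβ1 hω hγ0 hκg hb0 hrate
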